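/- Let $C\subset\mathbb{P}^2$ be the plane quartic over $\mathbb{Q}$ given by $$15X^4+112Y^4+112Z^4+288Y^2Z^2-88X^2Z^2-88X^2Y^2=0,$$ with its three involutions $\sigma_1,\sigma_2,\sigma_3$, which change the sign of $X$, $Y$, $Z$ respectively. 1. $C$ is smooth (so it is a Ciani quartic), and it has exactly four rational points: $$C(\mathbb{Q})=\{(2:1:0),\,(-2:1:0),\,(2:0:1),\,(-2:0:1)\}.$$ 2. The curve $E: y^2=x^3+\frac72x^2-\frac{15}{16}x$ is an elliptic curve of rank $0$ over $\mathbb{Q}$ with exactly eight rational points: $$E(\mathbb{Q})=\left\{\infty,\ (0,0),\ \left(-\tfrac34,-\tfrac32\right),\ \left(-\tfrac34,\tfrac32\right),\ \left(\tfrac14,0\right),\ \left(\tfrac54,-\tfrac52\right),\ \left(\tfrac54,\tfrac52\right),\ \left(-\tfrac{15}4,0\right)\right\}.$$ 3. Consider the plane quartics $$E_1: 112X^4+112Y^4+15Y^2Z^2-88ZY^3-88YZX^2+288X^2Y^2=0,$$ $$E_2: 112Y^4+112Z^4+15X^2Z^2-88XZ^3-88XZY^2+288Z^2Y^2=0,$$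 $$E_3: 112X^4+112Z^4+15Y^2X^2-88YX^3-88YXZ^2+288X^2Z^2=0.$$ The following rational maps to $E$ (in projective coordinates $(x:y:1)$ on $E$) are birational over $\mathbb{Q}$, so that the smooth projective models of $E_1,E_2,E_3$ are isomorphic to $E$: $$E_1\to E:\ \left(\tfrac{28}{15}X^2Y+\tfrac{58}{15}Y^3-Y^2Z:\ \tfrac{56}{15}X^3+\tfrac{116}{15}XY^2-2XYZ:\ -\tfrac{8}{15}Y^3\right),$$ $$E_2\to E:\ \left(\tfrac{28}{15}Y^2Z+\tfrac{58}{15}Z^3-Z^2X:\ \tfrac{56}{15}Y^3+\tfrac{116}{15}YZ^2-2XYZ:\ -\tfrac{8}{15}Z^3\right),$$ $$E_3\to E:\ \left(\tfrac{28}{15}Z^2X+\tfrac{58}{15}X^3-X^2Y:\ \tfrac{56}{15}Z^3+\tfrac{116}{15}ZX^2-2XYZ:\ -\tfrac{8}{15}X^3\right).$$ 4. The quotient $C/\langle\sigma_1\rangle$ is birational to $E_1$ over $\mathbb{Q}$ (hence isomorphic to $E$). The quotients $C/\langle\sigma_2\rangle$ and $C/\langle\sigma_3\rangle$ are both birational over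 $\mathbb{Q}$ (hence isomorphic) to the elliptic curve $E': y^2=x^3+22x^2-7x$, which has rank $0$ over $\mathbb{Q}$. 5. The Jacobian $J$ of $C$ has Mordell–Weil rank $0$ over $\mathbb{Q}$. The reduction $\overline{C}$ of $C$ modulo $17$ is smooth, with $$\overline{C}(\mathbb{F}_{17})=\{(2:1:0),\,(15:1:0),\,(2:0:1),\,(15:0:1)\}.$$ Stoll's bound is attained by $C$ at $p=17$. Stoll's bound says that $\#C(\mathbb{Q})\le\#\overline{C}(\mathbb{F}_p)+2r$ for a smooth curve $C$ over $\mathbb{Q}$ of genus $g\ge2$ whose Jacobian has rank $r<g-1$, and a prime $p>2r+2$ of good reduction. All these conditions hold here, with $g=3$, $r=0$, $p=17$, and equality holds. -/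

import Mathlib

open scoped LinearAlgebra.Projectivization

noncomputable section

/-! ### Divisor classes of a function field of one variable -/

/-- A place (closed point of the smooth projective model) of a function field `K` of one
variable over `k`: a discrete valuation ring of `K` that contains `k`. -/
structure Place (k K : Type) [Field k] [Field K] [Algebra k K] where
  ring : ValuationSubring K
  isDVR : IsDiscreteValuationRing ring
  const_mem : ∀ a : k, algebraMap k K a ∈ ring

namespace Place

variable {k K : Type} [Field k] [Field K] [Algebra k K]

instance (v : Place k K) : IsDiscreteValuationRing v.ring := v.isDVR

instance (v : Place k K) : Algebra k v.ring :=
  ((algebraMap k K).codRestrict v.ring.toSubring v.const_mem).toAlgebra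

/-- The degree of a place: the degree over `k` of its residue field. -/
def deg (v : Place k K) : ℕ := Module.finrank k (IsLocalRing.ResidueField v.ring)

/-- The order of vanishing of a rational function at a place (with value `0` at `f = 0`). -/
def ord (v : Place k K) (f : K) : ℤ := WithZero.log (Ring.ordFrac v.ring f)

theorem ord_one (v : Place k K) : v.ord 1 = 0 := by
  simp [ord]

theorem ord_mul (v : Place k K) {f g : K} (hf : f ≠ 0) (hg : g ≠ 0) :
    v.ord (f * g) = v.ord f + v.ord g := by
  unfold ord
  rw [map_mul, WithZero.log_mul]
  · exact (map_ne_zero _).2 hf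
  · exact (map_ne_zero _).2 hg

theorem ord_inv (v : Place k K) {f : K} (hf : f ≠ 0) : v.ord f⁻¹ = - v.ord f := by
  have h := v.ord_mul hf (inv_ne_zero hf)
  rw [mul_inv_cancel₀ hf, ord_one] at h
  linarith

end Place

section Pic

variable (k K : Type) [Field k] [Field K] [Algebra k K]

/-- Divisors: finite formal integral combinations of places. -/
abbrev CurveDivisor : Type := Place k K →₀ ℤ

/-- The degree homomorphism on divisors. -/
def divisorDegree : CurveDivisor k K →+ ℤ :=
  Finsupp.liftAddHom fun v => (AddMonoidHom.mulRight (v.deg : ℤ))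

/-- The group of divisors of nonzero rational functions. -/
def principalDivisors : AddSubgroup (CurveDivisor k K) where
  carrier := {D | ∃ f : K, f ≠ 0 ∧ ∀ v : Place k K, D v = v.ord f}
  zero_mem' := ⟨1, one_ne_zero, fun v => by simp [Place.ord_one]⟩
  add_mem' := by
    rintro D D' ⟨f, hf, hD⟩ ⟨g, hg, hD'⟩
    exact ⟨f * g, mul_ne_zero hf hg, fun v => by
      rw [Finsupp.add_apply, hD, hD', v.ord_mul hf hg]⟩
  neg_mem' := by
    rintro D ⟨f, hf, hD⟩
    exact ⟨f⁻¹, inv_ne_zero hf, fun v => by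
      rw [Finsupp.neg_apply, hD, v.ord_inv hf]⟩

/-- The group of degree zero divisors modulo principal divisors. For a smooth projective
geometrically integral curve `C` over `k` that has a `k`-rational point, this is the group
`J(k)` of rational points of the Jacobian variety `J` of `C`. -/
abbrev PicZero : Type :=
  (divisorDegree k K).ker ⧸ (principalDivisors k K).addSubgroupOf (divisorDegree k K).ker

end Pic

/-! ### Plane curves -/

namespace PlaneCurve

open MvPolynomial

variable {k : Type} [Field k]

/-- The rational points of the projective plane curve `F = 0` (`F` homogeneous). -/
def points (F : MvPolynomial (Fin 3) k) : Set (ℙ k (Fin 3 → k)) :=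
  {P | eval P.rep F = 0}

/-- Geometric smoothness of the projective plane curve `F = 0` (Jacobian criterion). -/
def IsSmooth (F : MvPolynomial (Fin 3) k) : Prop :=
  ∀ P : Fin 3 → AlgebraicClosure k, P ≠ 0 → aeval P F = 0 →
    ∃ i : Fin 3, aeval P (pderiv i F) ≠ 0

/-- Setting `Z = 1`. -/
def dehomog : MvPolynomial (Fin 3) k →ₐ[k] MvPolynomial (Fin 2) k :=
  aeval ![X 0, X 1, 1]

/-- The coordinate ring of the affine part `Z ≠ 0` of the plane curve `F = 0`. -/
abbrev CoordRing (F : MvPolynomial (Fin 3) k) : Type :=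
  MvPolynomial (Fin 2) k ⧸ Ideal.span {dehomog F}

/-- The function field of the plane curve `F = 0`, when the affine part `Z ≠ 0` of the curve
is integral and dense in it. -/
abbrev FunctionField (F : MvPolynomial (Fin 3) k) : Type := FractionRing (CoordRing F)

/-- A form in `X, Y, Z`, after setting `Z = 1`, as a function on the curve `F = 0`. -/
def coordFun (F G : MvPolynomial (Fin 3) k) : FunctionField F :=
  algebraMap (CoordRing F) (FunctionField F)
    (Ideal.Quotient.mk (Ideal.span {dehomog F}) (dehomog G))

/-- The rational function `G / H` on the curve `F = 0`, for forms `G`, `H` of equal degree. -/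
def ratio (F G H : MvPolynomial (Fin 3) k) [IsDomain (CoordRing F)] : FunctionField F :=
  coordFun F G / coordFun F H

/-- The curve `F = 0`, assumed to have a `k`-rational point, is integral and its Jacobian
has Mordell-Weil rank `r`. -/
def HasMordellWeilRank (F : MvPolynomial (Fin 3) k) (r : ℕ) : Prop :=
  ∃ _ : IsDomain (CoordRing F), Module.rank ℤ (PicZero k (FunctionField F)) = r

/-- `L` is the function field of the quotient of the curve `F = 0` by the group generated by
the automorphism `(X : Y : Z) ↦ (s 0 * X : s 1 * Y : s 2 * Z)`: pulling back along the quotient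
map embeds `L` in the function field of the curve, with image the field of functions
invariant under `σ`, the pullback along the automorphism. -/
def IsQuotientFunctionField (F : MvPolynomial (Fin 3) k) (s : Fin 3 → k)
    (L : Type) [CommRing L] [Algebra k L] : Prop :=
  ∃ _ : IsDomain (CoordRing F), ∃ σ : FunctionField F ≃ₐ[k] FunctionField F,
    (∀ i j : Fin 3, σ (ratio F (X i) (X j)) = (s i / s j) • ratio F (X i) (X j)) ∧
    ∃ φ : L →ₐ[k] FunctionField F, Function.Injective φ ∧ ∀ f, f ∈ φ.range ↔ σ f = f

/-- The rational map `(A : B : D)` from the integral plane curve `F = 0` to the projective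
closure of the Weierstrass curve `W` is birational: pullback along it is an isomorphism of
function fields. It thus induces an isomorphism from the smooth projective model of `F = 0`
to `W`, when `W` is smooth. -/
def IsBirationalVia (F : MvPolynomial (Fin 3) k) (W : WeierstrassCurve.Affine k)
    (A B D : MvPolynomial (Fin 3) k) : Prop :=
  ∃ _ : IsDomain (CoordRing F), coordFun F D ≠ 0 ∧
    ∃ e : W.FunctionField ≃ₐ[k] FunctionField F,
      e (algebraMap W.CoordinateRing W.FunctionField
          (WeierstrassCurve.Affine.CoordinateRing.mk W (Polynomial.C Polynomial.X)))
        = ratio F A D ∧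
      e (algebraMap W.CoordinateRing W.FunctionField
          (WeierstrassCurve.Affine.CoordinateRing.mk W Polynomial.X))
        = ratio F B D

/-- The genus of a smooth plane curve of degree `d`. -/
def smoothPlaneGenus (d : ℕ) : ℕ := (d - 1) * (d - 2) / 2

/-- Stoll's bound `#C(ℚ) ≤ #C̄(𝔽_p) + 2 r` applies to the plane curve `C : F = 0` with integral
coefficients at the prime `p` of good reduction, and is an equality. Here `d` is the degree of
`C` and `r` is the Mordell-Weil rank of its Jacobian; the bound requires that
the genus `g` is at least `2`, that `r < g - 1`, and that `p > 2 r + 2`. -/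
def StollBoundAttained (F : MvPolynomial (Fin 3) ℤ) (p : ℕ) [Fact p.Prime] : Prop :=
  ∃ d r : ℕ, F.IsHomogeneous d ∧
    IsSmooth (map (Int.castRingHom ℚ) F) ∧
    2 ≤ smoothPlaneGenus d ∧
    HasMordellWeilRank (map (Int.castRingHom ℚ) F) r ∧
    r + 1 < smoothPlaneGenus d ∧
    IsSmooth (map (Int.castRingHom (ZMod p)) F) ∧
    2 * r + 2 < p ∧
    (points (map (Int.castRingHom ℚ) F)).ncard =
      (points (map (Int.castRingHom (ZMod p)) F)).ncard + 2 * r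

end PlaneCurve

/-! ### The curves of the example -/

section Example

open MvPolynomial

instance fact_prime_seventeen : Fact (Nat.Prime 17) := ⟨by norm_num⟩

/-- The Ciani quartic, with integral coefficients. -/
def cianiInt : MvPolynomial (Fin 3) ℤ :=
  15 * X 0 ^ 4 + 112 * X 1 ^ 4 + 112 * X 2 ^ 4 + 288 * X 1 ^ 2 * X 2 ^ 2
    - 88 * X 0 ^ 2 * X 2 ^ 2 - 88 * X 0 ^ 2 * X 1 ^ 2

/-- The Ciani quartic over `ℚ`. -/
def ciani : MvPolynomial (Fin 3) ℚ := map (Int.castRingHom ℚ) cianiInt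

/-- The reduction of the Ciani quartic modulo `17`. -/
def cianiMod17 : MvPolynomial (Fin 3) (ZMod 17) := map (Int.castRingHom (ZMod 17)) cianiInt

/-- The quartic `E₁`. -/
def quarticE1 : MvPolynomial (Fin 3) ℚ :=
  112 * X 0 ^ 4 + 112 * X 1 ^ 4 + 15 * X 1 ^ 2 * X 2 ^ 2 - 88 * X 2 * X 1 ^ 3
    - 88 * X 1 * X 2 * X 0 ^ 2 + 288 * X 0 ^ 2 * X 1 ^ 2

/-- The quartic `E₂`. -/
def quarticE2 : MvPolynomial (Fin 3) ℚ :=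
  112 * X 1 ^ 4 + 112 * X 2 ^ 4 + 15 * X 0 ^ 2 * X 2 ^ 2 - 88 * X 0 * X 2 ^ 3
    - 88 * X 0 * X 2 * X 1 ^ 2 + 288 * X 2 ^ 2 * X 1 ^ 2

/-- The quartic `E₃`. -/
def quarticE3 : MvPolynomial (Fin 3) ℚ :=
  112 * X 0 ^ 4 + 112 * X 2 ^ 4 + 15 * X 1 ^ 2 * X 0 ^ 2 - 88 * X 1 * X 0 ^ 3
    - 88 * X 1 * X 0 * X 2 ^ 2 + 288 * X 0 ^ 2 * X 2 ^ 2

/-- The curve `E : y² = x³ + (7/2) x² - (15/16) x`. -/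
def curveE : WeierstrassCurve.Affine ℚ where
  a₁ := 0
  a₂ := 7 / 2
  a₃ := 0
  a₄ := -15 / 16
  a₆ := 0

/-- The curve `E' : y² = x³ + 22 x² - 7 x`. -/
def curveE' : WeierstrassCurve.Affine ℚ where
  a₁ := 0
  a₂ := 22
  a₃ := 0
  a₄ := -7
  a₆ := 0

end Example

end

/-!
Each quotient of the quartic `C` by one of its three sign changes is an elliptic curve, `E` or `E'`,
that has only finitely many rational points. Everything else follows from this.

*Quotients.* With `ξ = X/Z` and `η = Y/Z`, the functions `x = (15ξ² - 28η² - 58) / 8` and `y = 2ηx`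
satisfy the equation of `E` and generate the functions that are even in `ξ`. The quartics `E₁`, `E₂`,
`E₃` are models of the same field, and the given transformations are this pair of functions
(`isBirationalVia_curveE`). In the same way `ξ` and `η²` generate the function field of `E'`
(`exists_quotient_curveE'`), and the third quotient follows from the symmetry in `Y` and `Z`. The
coordinate rings are domains because quadratic and biquadratic polynomials over `ℚ[t]` are
irreducible when certain elements, such as the discriminant, are not squares.

*Rational points.* A point of `E'` gives a solution of `c² = a⁴ - 11a²b² + 32b⁴`, and a point of `E`,
through two further `2`-isogenies, one of `c² = a⁴ + 158a²b² + 3⁸b⁴`. Both are solved by infinite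
descent (`Int.sq_eq_four_mul_sq_of_quartic`, `Int.eq_zero_or_eq_zero_of_quartic`): writing the quartic
as a difference of two squares, equal to a constant times a fourth power, and factoring it twice leads
back to the same equation with a smaller `b`. The points of `C` are then found among the preimages of
the eight points of `E`.

*The Jacobian.* For commuting involutions `σ`, `τ` with product `ρ = στ`, twice a divisor `D` of degree
zero is `(D + σD) + (D + τD) + (D + ρD) - (1 + σ)(D + τD)`, so it suffices that `D + σD` is a torsion class
for each of the three involutions (`Place.rank_picZero_eq_zero`). It is a combination of the
divisors `v + σv`, which come from places of the quotient. If the quotient is an elliptic curve with only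
torsion points, a Riemann-Roch count shows that every ideal class of its affine coordinate ring comes
from a point (`WeierstrassCurve.Affine.isOfFinOrder_classGroup`), so a power of the prime ideal below
`v` is principal, and its generator has a divisor supported on `v`, `σv` and the places over the single
point at infinity (`Place.exists_divisor_of_quotient_elliptic`). As principal divisors have degree zero
(`Place.degree_eq_zero_of_mem_principalDivisors`), the contributions at infinity cancel in `D + σD`.
The degree formula itself is the identity `∑ eᵢ fᵢ = n` for the integral closure of `k[f]` in the
function field.
-/

open scoped LinearAlgebra.Projectivization

noncomputable section

/-! ### Places of a function field -/

namespace Place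

variable {k K : Type} [Field k] [Field K] [Algebra k K]

theorem ext_ring {v w : Place k K} (h : v.ring = w.ring) : v = w := by
  cases v; cases w; cases h; rfl

theorem ord_eq_neg_log (v : Place k K) (f : K) :
    v.ord f = -WithZero.log ((IsDiscreteValuationRing.maximalIdeal v.ring).valuation K f) := by
  rw [ord, Ring.ordFrac_eq_valuation_inv, WithZero.log_inv]

theorem mem_ring_iff (v : Place k K) {f : K} (hf : f ≠ 0) : f ∈ v.ring ↔ 0 ≤ v.ord f := by
  have h := IsDiscreteValuationRing.map_algebraMap_eq_valuationSubring (A := v.ring) (K := K)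
  have h1 : f ∈ v.ring ↔
      (IsDiscreteValuationRing.maximalIdeal v.ring).valuation K f ≤ 1 := by
    have h2 : f ∈ Subring.map (algebraMap v.ring K) ⊤ ↔ f ∈
      ((IsDiscreteValuationRing.maximalIdeal v.ring).valuation K).valuationSubring.toSubring := by
        rw [h]
    rw [ValuationSubring.mem_toSubring, Valuation.mem_valuationSubring_iff] at h2
    rw [← h2, Subring.mem_map]
    exact ⟨fun hf => ⟨⟨f, hf⟩, trivial, rfl⟩, by rintro ⟨x, -, rfl⟩; exact x.2⟩
  rw [h1, ord_eq_neg_log, neg_nonneg, ← WithZero.log_one]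
  exact (WithZero.log_le_log ((Valuation.ne_zero_iff _).2 hf) one_ne_zero).symm

theorem ord_nonneg (v : Place k K) {f : K} (hf : f ∈ v.ring) : 0 ≤ v.ord f := by
  rcases eq_or_ne f 0 with rfl | h
  · simp [ord]
  · exact (v.mem_ring_iff h).1 hf

theorem inv_mem_ring_iff (v : Place k K) {f : K} (hf : f ≠ 0) : f⁻¹ ∈ v.ring ↔ v.ord f ≤ 0 := by
  rw [v.mem_ring_iff (inv_ne_zero hf), v.ord_inv hf, neg_nonneg]

theorem ord_pos_iff (v : Place k K) {f : K} (hf : f ≠ 0) : 0 < v.ord f ↔ f ∈ v.ring.nonunits := by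
  rw [ValuationSubring.mem_nonunits_iff_or, v.inv_mem_ring_iff hf]
  simp [hf]

theorem ring_ne_top (v : Place k K) : v.ring ≠ ⊤ := by
  intro h
  apply IsDiscreteValuationRing.not_isField v.ring
  rw [← IsFractionRing.surjective_iff_isField (K := K)]
  intro x
  exact ⟨⟨x, h ▸ ValuationSubring.mem_top x⟩, rfl⟩

/-- Discrete valuation rings are maximal among the proper subrings of their fraction field. -/
theorem eq_of_le {v w : Place k K} (h : v.ring ≤ w.ring) : v = w := by
  have : Ring.KrullDimLE 1 v.ring :=
    Ring.KrullDimLE.mk₁' (fun _ a _ => IsPrime.to_maximal_ideal a)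
  exact ext_ring (ValuationSubring.eq_of_le_of_ne_top _ h w.ring_ne_top)

theorem ord_irreducible (v : Place k K) {ϖ : v.ring} (h : Irreducible ϖ) : v.ord ϖ = 1 := by
  rw [ord]
  change WithZero.log (Ring.ordFrac v.ring (algebraMap v.ring K ϖ)) = 1
  rw [Ring.ordFrac_irreducible h]; simp

theorem exists_ord_pos (v : Place k K) : ∃ f : K, f ≠ 0 ∧ 0 < v.ord f := by
  obtain ⟨ϖ, hϖ⟩ := IsDiscreteValuationRing.exists_irreducible v.ring
  exact ⟨ϖ, by simpa using hϖ.ne_zero, by rw [v.ord_irreducible hϖ]; simp⟩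

theorem ord_pow (v : Place k K) {f : K} (hf : f ≠ 0) (n : ℕ) : v.ord (f ^ n) = n * v.ord f := by
  induction n with
  | zero => simp [ord_one]
  | succ n ih => rw [pow_succ, v.ord_mul (pow_ne_zero n hf) hf, ih]; push_cast; ring

theorem ord_zpow (v : Place k K) {f : K} (hf : f ≠ 0) (n : ℤ) : v.ord (f ^ n) = n * v.ord f := by
  cases n with
  | ofNat n => simpa using v.ord_pow hf n
  | negSucc n =>
    rw [zpow_negSucc, v.ord_inv (pow_ne_zero _ hf), v.ord_pow hf, Int.negSucc_eq]
    push_cast; ring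

instance (v : Place k K) : IsScalarTower k v.ring K := IsScalarTower.of_algebraMap_eq fun _ => rfl

theorem mem_of_isIntegral (v : Place k K) {x : K} (hx : IsIntegral v.ring x) : x ∈ v.ring := by
  obtain ⟨y, rfl⟩ := IsIntegrallyClosed.isIntegral_iff.1 hx
  exact y.2

theorem ord_algebraic (v : Place k K) {f : K} (hf : IsAlgebraic k f) : v.ord f = 0 := by
  have key : ∀ g : K, IsAlgebraic k g → g ∈ v.ring := by
    intro g hg
    exact v.mem_of_isIntegral hg.isIntegral.tower_top
  rcases eq_or_ne f 0 with rfl | h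
  · simp [ord]
  · exact le_antisymm ((v.inv_mem_ring_iff h).1 (key _ hf.inv)) (v.ord_nonneg (key _ hf))

/-- The image of a place under an automorphism of the function field. -/
def conj (σ : K ≃ₐ[k] K) (v : Place k K) : Place k K where
  ring := v.ring.comap (σ : K →+* K)
  isDVR := by
    have e : v.ring ≃+* (v.ring.comap (σ : K →+* K)) :=
      { toFun := fun x => ⟨σ.symm x, by simp [ValuationSubring.mem_comap]⟩
        invFun := fun x => ⟨σ x, x.2⟩
        left_inv := fun x => by simp
        right_inv := fun x => by simp
        map_mul' := fun x y => by ext; simp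
        map_add' := fun x y => by ext; simp }
    exact IsDiscreteValuationRing.RingEquivClass.isDiscreteValuationRing e
  const_mem := fun a => by simpa [ValuationSubring.mem_comap] using v.const_mem a

theorem mem_conj {σ : K ≃ₐ[k] K} {v : Place k K} {x : K} :
    x ∈ (v.conj σ).ring ↔ σ x ∈ v.ring := Iff.rfl

theorem conj_conj (σ τ : K ≃ₐ[k] K) (v : Place k K) : (v.conj σ).conj τ = v.conj (τ.trans σ) :=
  rfl

/-- The isomorphism of valuation rings induced by an automorphism. -/
def conjEquiv (σ : K ≃ₐ[k] K) (v : Place k K) : (v.conj σ).ring ≃ₐ[k] v.ring where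
  toFun x := ⟨σ x, x.2⟩
  invFun x := ⟨σ.symm x, by simp [mem_conj]⟩
  left_inv x := by simp
  right_inv x := by simp
  map_mul' x y := by ext; simp
  map_add' x y := by ext; simp
  commutes' a := by ext; exact σ.commutes a

theorem deg_conj (σ : K ≃ₐ[k] K) (v : Place k K) : (v.conj σ).deg = v.deg := by
  let e := conjEquiv σ v
  let f : IsLocalRing.ResidueField (v.conj σ).ring ≃+* IsLocalRing.ResidueField v.ring :=
    IsLocalRing.ResidueField.mapEquiv e.toRingEquiv
  have hf : ∀ (a : k) x, f (a • x) = a • f x := by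
    intro a x
    obtain ⟨x, rfl⟩ := IsLocalRing.residue_surjective x
    rw [Algebra.smul_def, map_mul, Algebra.smul_def]
    congr 1
    rw [IsScalarTower.algebraMap_apply k (v.conj σ).ring (IsLocalRing.ResidueField (v.conj σ).ring),
      IsScalarTower.algebraMap_apply k v.ring (IsLocalRing.ResidueField v.ring)]
    exact congrArg (IsLocalRing.residue v.ring) (e.commutes a)
  exact LinearEquiv.finrank_eq
    ({ f with map_smul' := hf } :
      IsLocalRing.ResidueField (v.conj σ).ring ≃ₗ[k] IsLocalRing.ResidueField v.ring)

theorem ord_conj (σ : K ≃ₐ[k] K) (v : Place k K) (f : K) : (v.conj σ).ord f = v.ord (σ f) := by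
  rcases eq_or_ne f 0 with rfl | hf
  · simp [ord]
  obtain ⟨ϖ, hϖ⟩ := IsDiscreteValuationRing.exists_irreducible (v.conj σ).ring
  have h1 : (v.conj σ).ord ϖ = 1 := ord_irreducible _ hϖ
  have h2 : v.ord (σ ϖ) = 1 :=
    ord_irreducible v (ϖ := conjEquiv σ v ϖ) ((MulEquiv.irreducible_iff (conjEquiv σ v)).2 hϖ)
  have hϖ0 : (ϖ : K) ≠ 0 := by simpa using hϖ.ne_zero
  -- divide `f` by a power of a uniformizer to reduce to a unit
  set n := (v.conj σ).ord f
  set g := f * (ϖ : K) ^ (-n) with hg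
  have hp : (ϖ : K) ^ (-n) ≠ 0 := zpow_ne_zero _ hϖ0
  have hg0 : g ≠ 0 := mul_ne_zero hf hp
  have hgo : (v.conj σ).ord g = 0 := by
    rw [hg, ord_mul _ hf hp, ord_zpow _ hϖ0, h1]; ring
  have hσg : σ g ≠ 0 := by simpa using hg0
  have h3 : v.ord (σ g) = 0 := by
    apply le_antisymm
    · rw [← v.inv_mem_ring_iff hσg, ← map_inv₀]
      exact mem_conj.1 (((v.conj σ).inv_mem_ring_iff hg0).2 hgo.le)
    · rw [← v.mem_ring_iff hσg]
      exact mem_conj.1 (((v.conj σ).mem_ring_iff hg0).2 hgo.ge)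
  rw [hg, map_mul, v.ord_mul (by simpa using hf) (by simpa only [ne_eq, map_eq_zero] using hp),
    map_zpow₀,
    v.ord_zpow (by simpa using hϖ0), h2] at h3
  linarith

/-- Two places whose restrictions to the field fixed by an involution `σ` agree are equal or
conjugate under `σ`. -/
theorem eq_or_eq_conj {σ : K ≃ₐ[k] K} (hσ : ∀ x, σ (σ x) = x) {v w : Place k K}
    (h : ∀ x, σ x = x → (x ∈ v.ring ↔ x ∈ w.ring)) : w = v ∨ w = v.conj σ := by
  -- an element integral at `v` and `v.conj σ` has trace and norm integral at `w`
  have hT : ∀ x, x ∈ v.ring → σ x ∈ v.ring → x ∈ w.ring := by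
    intro x h1 h2
    have ht : x + σ x ∈ w.ring := (h _ (by rw [map_add, hσ, add_comm])).1 (add_mem h1 h2)
    have hn : x * σ x ∈ w.ring := (h _ (by rw [map_mul, hσ, mul_comm])).1 (mul_mem h1 h2)
    by_contra hx
    have hx0 : x ≠ 0 := by rintro rfl; exact hx (zero_mem _)
    have hi : x⁻¹ ∈ w.ring := (w.ring.mem_or_inv_mem x).resolve_left hx
    apply hx
    have : x = (x + σ x) - (x * σ x) * x⁻¹ := by field_simp; ring
    rw [this]
    exact sub_mem ht (mul_mem hn hi)
  have hN : ∀ x, x ∈ v.ring → σ x ∈ v.ring → x ∈ w.ring.nonunits →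
      x ∈ v.ring.nonunits ∨ σ x ∈ v.ring.nonunits := by
    intro x h1 h2 h3
    by_contra! hc
    simp only [ValuationSubring.mem_nonunits_iff_or, not_or, not_not] at hc h3
    obtain ⟨⟨hx0, hx⟩, -, hy⟩ := hc
    refine h3.resolve_left hx0 ?_
    have hn : (x * σ x)⁻¹ ∈ w.ring :=
      (h _ (by rw [map_inv₀, map_mul, hσ, mul_comm])).1 (by rw [mul_inv]; exact mul_mem hx hy)
    have : x⁻¹ = σ x * (x * σ x)⁻¹ := by
      have : σ x ≠ 0 := by simpa using hx0
      field_simp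
    rw [this]
    exact mul_mem (hT _ h2 (by rwa [hσ])) hn
  -- every element of a valuation ring is a quotient of elements of the intersection, with
  -- denominator a unit of the first ring
  have hunit : ∀ t ∈ v.ring.nonunits, (1 + t)⁻¹ ∈ v.ring := by
    intro t ht
    by_contra hc
    have h1 : 1 + t ∈ v.ring.nonunits := (ValuationSubring.mem_nonunits_iff_or _).2 (Or.inr hc)
    have h2 : (1 : K) ∈ v.ring.nonunits := by simpa using sub_mem h1 ht
    rcases (ValuationSubring.mem_nonunits_iff_or _).1 h2 with h3 | h3
    · exact one_ne_zero h3
    · exact h3 (by simp [one_mem])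
  have hmul : ∀ a ∈ v.ring, ∀ t ∈ v.ring.nonunits, a * t ∈ v.ring.nonunits := by
    intro a ha t ht
    rw [ValuationSubring.mem_nonunits_iff] at ht ⊢
    rw [map_mul]
    exact mul_lt_one_of_nonneg_of_lt_one_right ((v.ring.valuation_le_one_iff a).2 ha) zero_le ht
  have hden : ∀ z ∈ v.ring, ∃ s : K, s ≠ 0 ∧ s ∈ v.ring ∧ s⁻¹ ∈ v.ring ∧
      σ s ∈ v.ring ∧ z * s ∈ v.ring ∧ σ (z * s) ∈ v.ring := by
    intro z hz
    by_cases hz' : σ z ∈ v.ring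
    · exact ⟨1, by simp, one_mem _, by simp [one_mem], by simp [one_mem], by simpa using hz,
        by simpa using hz'⟩
    have hz1 : σ z ≠ 0 := fun h0 => hz' (h0 ▸ zero_mem _)
    have ht : (σ z)⁻¹ ∈ v.ring.nonunits := (ValuationSubring.mem_nonunits_iff_or _).2
      (Or.inr (by rwa [inv_inv]))
    have ht' : (σ z)⁻¹ ∈ v.ring := v.ring.nonunits_subset ht
    by_cases h1 : (1 + z)⁻¹ ∈ v.ring
    · have h0 : 1 + z ≠ 0 := by
        intro h0
        have : z = -1 := by linear_combination h0
        apply hz'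
        rw [this, map_neg, map_one]
        exact neg_mem (one_mem _)
      have h0' : 1 + σ z ≠ 0 := by simpa using (map_ne_zero σ).2 h0
      have h2 : (1 + σ z)⁻¹ ∈ v.ring := by
        have : (1 + σ z)⁻¹ = (σ z)⁻¹ * (1 + (σ z)⁻¹)⁻¹ := by
          rw [← mul_inv]; congr 1; field_simp; ring
        rw [this]
        exact mul_mem ht' (hunit _ ht)
      have h3 : z * (1 + z)⁻¹ = 1 - (1 + z)⁻¹ := by field_simp; ring
      refine ⟨(1 + z)⁻¹, inv_ne_zero h0, h1, ?_, ?_, ?_, ?_⟩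
      · rw [inv_inv]; exact add_mem (one_mem _) hz
      · simpa using h2
      · rw [h3]; exact sub_mem (one_mem _) h1
      · rw [h3]; simpa using sub_mem (one_mem v.ring) h2
    · have h1' : z * (1 + z) ∈ v.ring.nonunits :=
        hmul z hz _ ((ValuationSubring.mem_nonunits_iff_or _).2 (Or.inr h1))
      have h2 := hunit _ h1'
      have h3 : (1 + (σ z)⁻¹ * (1 + (σ z)⁻¹))⁻¹ ∈ v.ring := by
        apply hunit
        rw [mul_comm]
        exact hmul _ (add_mem (one_mem _) ht') _ ht
      have h0' : 1 + z * (1 + z) ≠ 0 := by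
        intro h0
        have : (1 : K) ∈ v.ring.nonunits := by
          have : (1 : K) = -(z * (1 + z)) := by linear_combination h0
          rw [this]; exact neg_mem h1'
        rcases (ValuationSubring.mem_nonunits_iff_or _).1 this with h3 | h3
        · exact one_ne_zero h3
        · exact h3 (by simp [one_mem])
      have h0 : 1 + σ z * (1 + σ z) ≠ 0 := by
        have := (map_ne_zero σ).2 h0'
        simpa using this
      have h4 : (1 + σ z * (1 + σ z))⁻¹ =
          (σ z)⁻¹ * (σ z)⁻¹ * (1 + (σ z)⁻¹ * (1 + (σ z)⁻¹))⁻¹ := by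
        rw [← mul_inv, ← mul_inv]; congr 1; field_simp; ring
      have h5 : (1 + σ z * (1 + σ z))⁻¹ ∈ v.ring := by
        rw [h4]; exact mul_mem (mul_mem ht' ht') h3
      refine ⟨(1 + z * (1 + z))⁻¹, inv_ne_zero h0', h2, ?_, ?_, mul_mem hz h2, ?_⟩
      · rw [inv_inv]; exact add_mem (one_mem _) (v.ring.nonunits_subset h1')
      · simpa using h5
      · have : σ (z * (1 + z * (1 + z))⁻¹) =
            (σ z)⁻¹ * (1 + (σ z)⁻¹ * (1 + (σ z)⁻¹))⁻¹ := by
          simp only [map_mul, map_inv₀, map_add, map_one]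
          rw [h4]; field_simp
        rw [this]
        exact mul_mem ht' h3
  -- prime avoidance for the two maximal ideals of the intersection
  by_cases hc : ∀ a ∈ v.ring, σ a ∈ v.ring → a ∈ w.ring.nonunits → a ∈ v.ring.nonunits
  · left
    symm
    apply eq_of_le
    intro z hz
    obtain ⟨s, s0, s1, s2, s3, s4, s5⟩ := hden z hz
    have hs : s ∉ w.ring.nonunits := fun hw => by
      rcases (ValuationSubring.mem_nonunits_iff_or _).1 (hc s s1 s3 hw) with h | h
      · exact s0 h
      · exact h s2
    rw [ValuationSubring.mem_nonunits_iff_or, not_or, not_not] at hs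
    have := mul_mem (hT _ s4 s5) hs.2
    rwa [mul_assoc, mul_inv_cancel₀ s0, mul_one] at this
  · right
    push Not at hc
    obtain ⟨a, a1, a2, a3, a4⟩ := hc
    have ha := (hN a a1 a2 a3).resolve_left a4
    have hc' : ∀ b ∈ v.ring, σ b ∈ v.ring → b ∈ w.ring.nonunits → σ b ∈ v.ring.nonunits := by
      intro b b1 b2 b3
      by_contra hb
      have hb' := (hN b b1 b2 b3).resolve_right hb
      rcases hN (a + b) (add_mem a1 b1) (by rw [map_add]; exact add_mem a2 b2)
        (add_mem a3 b3) with h | h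
      · exact a4 (by simpa using sub_mem h hb')
      · rw [map_add] at h
        exact hb (by simpa using sub_mem h ha)
    symm
    apply eq_of_le
    intro z hz
    rw [mem_conj] at hz
    obtain ⟨s, s0, s1, s2, s3, s4, s5⟩ := hden (σ z) hz
    have hs : σ s ∉ w.ring.nonunits := fun hw => by
      have h1 := hc' (σ s) s3 (by rwa [hσ]) hw
      rw [hσ] at h1
      rcases (ValuationSubring.mem_nonunits_iff_or _).1 h1 with h | h
      · exact s0 h
      · exact h s2
    rw [ValuationSubring.mem_nonunits_iff_or, not_or, not_not] at hs
    rw [map_mul, hσ] at s5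
    have s4' : z * σ s ∈ w.ring := hT _ s5 (by rwa [map_mul, hσ])
    have := mul_mem s4' hs.2
    rwa [mul_assoc, mul_inv_cancel₀ (by simpa using s0), mul_one] at this

end Place

/-! ### The degree of a principal divisor -/

namespace Place

open IsDedekindDomain

section Dedekind

variable {k K : Type} [Field k] [Field K] [Algebra k K]
variable {B : Type} [CommRing B] [IsDedekindDomain B] [Algebra k B] [Algebra B K]
  [IsFractionRing B K] [IsScalarTower k B K]

theorem mem_valuationSubringAtPrime (q : HeightOneSpectrum B) (b : B) :
    algebraMap B K b ∈ q.valuationSubringAtPrime K :=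
  (algebraMap B (q.valuationSubringAtPrime K) b).2

/-- The place attached to a nonzero prime of a Dedekind domain with fraction field `K`. -/
def ofPrime (q : HeightOneSpectrum B) : Place k K where
  ring := q.valuationSubringAtPrime K
  isDVR := by
    have : IsLocalization.AtPrime (q.valuationSubringAtPrime K) q.asIdeal :=
      inferInstanceAs (IsLocalization q.asIdeal.primeCompl _)
    exact IsLocalization.AtPrime.isDiscreteValuationRing_of_dedekind_domain B q.ne_bot _
  const_mem a := by
    rw [IsScalarTower.algebraMap_apply k B K]
    exact mem_valuationSubringAtPrime q _

instance (q : HeightOneSpectrum B) : Algebra B (ofPrime (k := k) (K := K) q).ring :=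
  inferInstanceAs (Algebra B (q.valuationSubringAtPrime K))

instance (q : HeightOneSpectrum B) : IsScalarTower B (ofPrime (k := k) (K := K) q).ring K :=
  inferInstanceAs (IsScalarTower B (q.valuationSubringAtPrime K) K)

instance (q : HeightOneSpectrum B) :
    IsLocalization.AtPrime (ofPrime (k := k) (K := K) q).ring q.asIdeal :=
  inferInstanceAs (IsLocalization q.asIdeal.primeCompl (q.valuationSubringAtPrime K))

theorem algebraMap_mem_nonunits_ofPrime (q : HeightOneSpectrum B) (b : B) :
    algebraMap B K b ∈ (ofPrime (k := k) (K := K) q).ring.nonunits ↔ b ∈ q.asIdeal := by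
  have := IsLocalization.AtPrime.to_map_mem_maximal_iff (ofPrime (k := k) (K := K) q).ring
    q.asIdeal b
  rw [← this, ← ValuationSubring.coe_mem_nonunits_iff]
  rfl

theorem ofPrime_injective : Function.Injective (ofPrime (k := k) (K := K) (B := B)) := by
  intro p q h
  ext b
  rw [← algebraMap_mem_nonunits_ofPrime (k := k) (K := K), h, algebraMap_mem_nonunits_ofPrime]

theorem exists_ofPrime_eq (v : Place k K) (h : ∀ b : B, algebraMap B K b ∈ v.ring) :
    ∃ q : HeightOneSpectrum B, ofPrime q = v := by
  let i : B →+* v.ring := (algebraMap B K).codRestrict v.ring.toSubring h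
  let q : Ideal B := (IsLocalRing.maximalIdeal v.ring).comap i
  have hq : ∀ b : B, b ∈ q ↔ algebraMap B K b ∈ v.ring.nonunits := by
    intro b
    rw [Ideal.mem_comap, ← ValuationSubring.coe_mem_nonunits_iff]
    rfl
  have hu : ∀ b : B, b ∉ q → (algebraMap B K b)⁻¹ ∈ v.ring := by
    intro b hb
    rw [hq, ValuationSubring.mem_nonunits_iff_or, not_or, not_not] at hb
    exact hb.2
  have hle : ∀ x : K, (∃ a b : B, b ∉ q ∧ x = algebraMap B K a / algebraMap B K b) →
      x ∈ v.ring := by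
    rintro x ⟨a, b, hb, rfl⟩
    rw [div_eq_mul_inv]
    exact mul_mem (h a) (hu b hb)
  have hbot : q ≠ ⊥ := by
    intro hb
    apply v.ring_ne_top
    rw [eq_top_iff]
    intro x _
    obtain ⟨a, b, hb', rfl⟩ := IsFractionRing.div_surjective (A := B) x
    refine hle _ ⟨a, b, ?_, rfl⟩
    rw [hb, Ideal.mem_bot]
    exact nonZeroDivisors.ne_zero hb'
  let Q : HeightOneSpectrum B := ⟨q, Ideal.comap_isPrime _ _, hbot⟩
  refine ⟨Q, eq_of_le ?_⟩
  rintro x ⟨a, s, hs, rfl⟩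
  exact hle _ ⟨a, s, hs, (div_eq_mul_inv _ _).symm⟩

theorem deg_ofPrime (q : HeightOneSpectrum B) :
    (ofPrime (k := k) (K := K) q).deg = Module.finrank k (B ⧸ q.asIdeal) := by
  have := q.isMaximal
  let e := IsLocalization.AtPrime.equivQuotMaximalIdeal q.asIdeal
    (ofPrime (k := k) (K := K) q).ring
  have he : ∀ (a : k) x, e (a • x) = a • e x := by
    intro a x
    rw [Algebra.smul_def, map_mul, Algebra.smul_def]
    congr 1
    change e (Ideal.Quotient.mk _ (algebraMap k B a)) = Ideal.Quotient.mk _ (algebraMap k _ a)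
    rw [IsLocalization.AtPrime.equivQuotMaximalIdeal_apply_mk]
    congr 1
    apply Subtype.ext
    exact (IsScalarTower.algebraMap_apply k B K a).symm
  exact (LinearEquiv.finrank_eq
    ({ e with map_smul' := he } :
      (B ⧸ q.asIdeal) ≃ₗ[k] IsLocalRing.ResidueField (ofPrime (k := k) (K := K) q).ring)).symm

theorem ord_eq_length (v : Place k K) {x : v.ring} (hx : x ≠ 0) :
    v.ord x = ((Ring.ord v.ring x).toNat : ℤ) := by
  have hx' : x ∈ nonZeroDivisors v.ring := mem_nonZeroDivisors_of_ne_zero hx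
  obtain ⟨n, hn⟩ := ENat.ne_top_iff_exists.1 (Ring.ord_ne_top hx')
  rw [ord]
  change WithZero.log (Ring.ordFrac v.ring (algebraMap v.ring K x)) = _
  rw [Ring.ordFrac_eq_ord _ hx, Ring.ordMonoidWithZeroHom_eq_coe _ hx' hn.symm, ← hn]
  rfl

theorem _root_.Ring.ord_ringEquiv {R S : Type*} [CommRing R] [CommRing S] (e : R ≃+* S) (x : R) :
    Ring.ord S (e x) = Ring.ord R x := by
  let _ : Algebra R S := e.toRingHom.toAlgebra
  let f : (R ⧸ Ideal.span {x}) ≃ₗ[R] (S ⧸ Ideal.span {e x}) :=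
    Submodule.Quotient.equiv (Ideal.span {x}) ((Ideal.span {e x}).restrictScalars R)
      (AlgEquiv.ofRingEquiv (f := e) fun _ => rfl : R ≃ₐ[R] S).toLinearEquiv (by
        ext y
        simp only [Submodule.mem_map, Submodule.restrictScalars_mem, Ideal.mem_span_singleton]
        constructor
        · rintro ⟨z, hz, rfl⟩
          exact map_dvd e hz
        · intro hy
          refine ⟨e.symm y, ?_, e.apply_symm_apply y⟩
          simpa using map_dvd e.symm hy)
  unfold Ring.ord
  rw [← Module.length_eq_of_surjective (S := R) (R := S) e.surjective, f.length_eq]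

theorem ord_ofPrime {A : Type} [CommRing A] [Algebra A B] (p : Ideal A) (q : HeightOneSpectrum B)
    [q.asIdeal.LiesOver p] {a : A} (hp : p = Ideal.span {a}) (ha : algebraMap A B a ≠ 0) :
    (ofPrime (k := k) (K := K) q).ord (algebraMap B K (algebraMap A B a)) =
      (q.asIdeal.ramificationIdx A : ℤ) := by
  rw [Ideal.ramificationIdx_eq p q.asIdeal, hp, Ideal.map_span, Set.image_singleton]
  let e : Localization.AtPrime q.asIdeal ≃ₐ[B] (ofPrime (k := k) (K := K) q).ring :=
    IsLocalization.algEquiv q.asIdeal.primeCompl _ _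
  rw [IsScalarTower.algebraMap_apply B (ofPrime (k := k) (K := K) q).ring K]
  have h0 : algebraMap B (ofPrime (k := k) (K := K) q).ring (algebraMap A B a) ≠ 0 := by
    intro h
    apply ha
    apply IsFractionRing.injective B K
    rw [IsScalarTower.algebraMap_apply B (ofPrime (k := k) (K := K) q).ring K, h, map_zero, map_zero]
  refine (ord_eq_length _ h0).trans ?_
  rw [← e.commutes]
  change ((Ring.ord _ (e.toRingEquiv _)).toNat : ℤ) = _
  rw [Ring.ord_ringEquiv, ← IsScalarTower.algebraMap_apply]
  rfl

end Dedekind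

section Degree

variable {k K : Type} [Field k] [Field K] [Algebra k K]

/-- The places at which `F` vanishes, for `F` generating a rational maximal ideal of a domain `A`
over which the Dedekind domain `B` is finite, correspond to the primes of `B` over `F`. -/
theorem exists_finset_zeros_aux {A B : Type} [CommRing A] [IsDomain A] [CommRing B]
    [IsDedekindDomain B] [Algebra k A] [Algebra k B] [Algebra A B] [IsScalarTower k A B]
    [Algebra A K] [Algebra B K] [IsScalarTower A B K] [IsScalarTower k B K]
    [IsFractionRing B K] [Module.Finite A B] [Module.Flat A B] [FaithfulSMul A B]
    (F : A) (hF : F ≠ 0) (hp : (Ideal.span {F}).IsMaximal)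
    (hconst : ∀ a : A, ∃ c : k, a - algebraMap k A c ∈ Ideal.span {F})
    (hB : ∀ v : Place k K, 0 < v.ord (algebraMap A K F) → ∀ b : B, algebraMap B K b ∈ v.ring) :
    ∃ S : Finset (Place k K), (∀ v, v ∈ S ↔ 0 < v.ord (algebraMap A K F)) ∧
      (∀ v ∈ S, 0 < v.deg) ∧
      ∑ v ∈ S, v.ord (algebraMap A K F) * v.deg = Module.finrank A B := by
  set p := Ideal.span {F} with hpF
  have hquot : Module.finrank k (A ⧸ p) = 1 := by
    have : Nontrivial (A ⧸ p) := Ideal.Quotient.nontrivial_iff.2 hp.ne_top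
    rw [finrank_eq_one_iff_of_nonzero' (1 : A ⧸ p) one_ne_zero]
    intro w
    obtain ⟨a, rfl⟩ := Ideal.Quotient.mk_surjective w
    obtain ⟨c, hc⟩ := hconst a
    refine ⟨c, ?_⟩
    rw [← Ideal.Quotient.eq] at hc
    rw [hc, ← Algebra.algebraMap_eq_smul_one]
    rfl
  have hp0 : p ≠ ⊥ := by rwa [hpF, Ne, Ideal.span_singleton_eq_bot]
  have hFB0 : algebraMap A B F ≠ 0 := by
    simpa using (FaithfulSMul.algebraMap_injective A B).ne hF
  have hFK : algebraMap A K F = algebraMap B K (algebraMap A B F) :=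
    IsScalarTower.algebraMap_apply A B K F
  have hFK0 : algebraMap A K F ≠ 0 := by
    rw [hFK]
    simpa using (IsFractionRing.injective B K).ne hFB0
  let Q : p.primesOver B → HeightOneSpectrum B := fun q =>
    ⟨q.1, q.2.1, Ideal.ne_bot_of_mem_primesOver hp0 q.2⟩
  let φ : p.primesOver B → Place k K := fun q => ofPrime (Q q)
  have hφ : Function.Injective φ := by
    intro q q' h
    have := ofPrime_injective h
    exact Subtype.ext (congrArg HeightOneSpectrum.asIdeal this)
  have hord : ∀ q, (φ q).ord (algebraMap A K F) = (q.1.ramificationIdx A : ℤ) := fun q => by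
    have : (Q q).asIdeal.LiesOver p := q.2.2
    rw [hFK]
    exact ord_ofPrime p (Q q) rfl hFB0
  have hdeg : ∀ q, (φ q).deg = q.1.inertiaDeg A := by
    intro q
    have : q.1.IsMaximal := (Q q).isMaximal
    rw [Ideal.inertiaDeg_eq_of_isMaximal p q.1]
    have : IsScalarTower k (A ⧸ p) (B ⧸ q.1) := by
      refine IsScalarTower.of_algebraMap_eq fun c => ?_
      change Ideal.Quotient.mk _ (algebraMap k B c) =
        Ideal.Quotient.mk _ (algebraMap A B (algebraMap k A c))
      rw [← IsScalarTower.algebraMap_apply]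
    let _ := Ideal.Quotient.field p
    rw [← one_mul (Module.finrank (A ⧸ p) (B ⧸ q.1)), ← hquot, Module.finrank_mul_finrank]
    exact deg_ofPrime (Q q)
  have hmem : ∀ v : Place k K, 0 < v.ord (algebraMap A K F) → ∃ q, φ q = v := by
    intro v hv
    obtain ⟨q, rfl⟩ := exists_ofPrime_eq v (hB v hv)
    have hFq : F ∈ q.asIdeal.under A := by
      rw [Ideal.mem_comap, ← algebraMap_mem_nonunits_ofPrime (k := k) (K := K), ← hFK]
      exact (ord_pos_iff _ hFK0).1 hv
    have hq : q.asIdeal.LiesOver p := by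
      refine ⟨hp.eq_of_le (Ideal.IsPrime.under A q.asIdeal).ne_top ?_⟩
      rwa [hpF, Ideal.span_singleton_le_iff_mem]
    exact ⟨⟨q.asIdeal, q.isPrime, hq⟩, rfl⟩
  have : Fintype (p.primesOver B) := (Algebra.QuasiFinite.finite_primesOver p).fintype
  have hpos : ∀ q, 0 < (φ q).ord (algebraMap A K F) := fun q => by
    rw [hord]; exact_mod_cast Ideal.ramificationIdx_pos _ _
  refine ⟨Finset.univ.map ⟨φ, hφ⟩, fun v => ?_, fun v hv => ?_, ?_⟩
  · constructor
    · intro hv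
      obtain ⟨q, -, rfl⟩ := Finset.mem_map.1 hv
      exact hpos q
    · intro hv
      obtain ⟨q, rfl⟩ := hmem v hv
      exact Finset.mem_map_of_mem _ (Finset.mem_univ q)
  · obtain ⟨q, -, rfl⟩ := Finset.mem_map.1 hv
    change 0 < (φ q).deg
    rw [hdeg]
    exact Ideal.inertiaDeg_pos _ _
  · rw [Finset.sum_map, ← Ideal.sum_ramification_inertia_eq_finrank p B]
    push_cast
    refine Finset.sum_congr rfl fun q _ => ?_
    rw [← hord, ← hdeg]
    rfl

open scoped IntermediateField.algebraAdjoinAdjoin IntermediateField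

theorem isPrincipalIdealRing_adjoin_singleton (f : K) :
    IsPrincipalIdealRing (Algebra.adjoin k {f}) := by
  have h : Function.Surjective (Polynomial.aeval (R := k)
      (⟨f, Algebra.self_mem_adjoin_singleton k f⟩ : Algebra.adjoin k {f})) := by
    rintro ⟨a, ha⟩
    have ha' : a ∈ (Polynomial.aeval (R := k) f).range := by
      rwa [← Algebra.adjoin_singleton_eq_range_aeval]
    obtain ⟨p, rfl⟩ := ha'
    refine ⟨p, Subtype.ext ?_⟩
    change (Algebra.adjoin k {f}).val _ = Polynomial.aeval f p
    rw [← Polynomial.aeval_algHom_apply]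
    rfl
  exact IsPrincipalIdealRing.of_surjective _ h

theorem exists_eq_aeval_of_mem_adjoin (f : K) (a : Algebra.adjoin k {f}) :
    ∃ P : Polynomial k, (a : K) = Polynomial.aeval f P := by
  have ha' : (a : K) ∈ (Polynomial.aeval (R := k) f).range := by
    rw [← Algebra.adjoin_singleton_eq_range_aeval]; exact a.2
  obtain ⟨p, hp⟩ := ha'
  exact ⟨p, hp.symm⟩

/-- The zeros of a nonconstant rational function `f`, counted with multiplicity and degree, are as
many as the degree of the function field over `k(f)`. -/
theorem exists_finset_zeros [CharZero k] {f : K} (hf : Transcendental k f)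
    [FiniteDimensional k⟮f⟯ K] :
    ∃ S : Finset (Place k K), (∀ v, v ∈ S ↔ 0 < v.ord f) ∧ (∀ v ∈ S, 0 < v.deg) ∧
      ∑ v ∈ S, v.ord f * v.deg = Module.finrank k⟮f⟯ K := by
  have hf0 : f ≠ 0 := by
    rintro rfl
    exact hf isAlgebraic_zero
  have := isPrincipalIdealRing_adjoin_singleton (k := k) f
  let A := Algebra.adjoin k {f}
  let F : A := ⟨f, Algebra.self_mem_adjoin_singleton k f⟩
  let B := integralClosure A K
  have : IsDedekindDomain B := integralClosure.isDedekindDomain A k⟮f⟯ K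
  have : Module.Finite A B := IsIntegralClosure.finite A k⟮f⟯ K B
  have : IsFractionRing B K := integralClosure.isFractionRing_of_finite_extension k⟮f⟯ K
  have hfin : Module.finrank k⟮f⟯ K = Module.finrank A B :=
    IsFractionRing.finrank_eq A k⟮f⟯ B K
  have hF0 : F ≠ 0 := fun h => hf0 (congrArg A.val h)
  have hconst : ∀ a : A, ∃ c : k, a - algebraMap k A c ∈ Ideal.span {F} := by
    intro a
    obtain ⟨P, hP⟩ := exists_eq_aeval_of_mem_adjoin f a
    refine ⟨P.coeff 0, Ideal.mem_span_singleton.2 ⟨Polynomial.aeval F P.divX, ?_⟩⟩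
    apply Subtype.ext
    have h := congrArg (Polynomial.aeval f) (Polynomial.X_mul_divX_add P)
    rw [map_add, map_mul, ← hP, Polynomial.aeval_X, Polynomial.aeval_C] at h
    change (a : K) - algebraMap k K (P.coeff 0) = f * A.val (Polynomial.aeval F P.divX)
    rw [← Polynomial.aeval_algHom_apply]
    change (a : K) - algebraMap k K (P.coeff 0) = f * Polynomial.aeval f P.divX
    rw [← h]; ring
  have hp1 : (1 : A) ∉ Ideal.span {F} := by
    rw [Ideal.mem_span_singleton]
    rintro ⟨a, ha⟩
    obtain ⟨P, hP⟩ := exists_eq_aeval_of_mem_adjoin f a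
    apply hf
    refine ⟨Polynomial.X * P - 1, ?_, ?_⟩
    · intro h
      have := congrArg (Polynomial.eval 0) h
      simp at this
    · have h2 : (1 : K) = f * a := congrArg A.val ha
      rw [map_sub, map_mul, Polynomial.aeval_X, map_one, sub_eq_zero, h2, hP]
  have hp : (Ideal.span {F}).IsMaximal := by
    rw [Ideal.isMaximal_iff]
    refine ⟨hp1, fun I a hI ha haI => ?_⟩
    obtain ⟨c, hc⟩ := hconst a
    have hc0 : c ≠ 0 := by
      rintro rfl
      simp only [map_zero, sub_zero] at hc
      exact ha hc
    have h1 : algebraMap k A c ∈ I := by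
      have := I.sub_mem haI (hI hc)
      rwa [sub_sub_cancel] at this
    have h2 := I.mul_mem_left (algebraMap k A c⁻¹) h1
    rwa [← map_mul, inv_mul_cancel₀ hc0, map_one] at h2
  rw [hfin]
  refine exists_finset_zeros_aux (B := B) F hF0 hp hconst ?_
  intro v hv b
  have hfv : f ∈ v.ring := (v.mem_ring_iff hf0).2 hv.le
  have hA : ∀ a : A, algebraMap A K a ∈ v.ring := by
    intro a
    obtain ⟨P, hP⟩ := exists_eq_aeval_of_mem_adjoin f a
    have h : (algebraMap A K a : K) = algebraMap v.ring K (Polynomial.aeval ⟨f, hfv⟩ P) := by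
      rw [← Polynomial.aeval_algebraMap_apply]
      exact hP
    rw [h]
    exact Subtype.mem _
  apply v.mem_of_isIntegral
  let i : A →+* v.ring := (algebraMap A K).codRestrict v.ring.toSubring hA
  obtain ⟨P, hP, hb⟩ := b.2
  exact ⟨P.map i, hP.map i, by rw [Polynomial.eval₂_map]; exact hb⟩

/-- `K` is a finitely generated extension of `k` of transcendence degree at most one: it is finite
over the subfield generated by any nonconstant function. -/
def _root_.IsCurveFunctionField (k K : Type) [Field k] [Field K] [Algebra k K] : Prop :=
  ∀ f : K, Transcendental k f → FiniteDimensional k⟮f⟯ K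

theorem transcendental_of_ord_ne_zero (v : Place k K) {f : K} (h : v.ord f ≠ 0) :
    Transcendental k f := fun hf => h (v.ord_algebraic hf)

theorem adjoin_simple_inv (f : K) : k⟮f⁻¹⟯ = k⟮f⟯ := by
  apply le_antisymm
  · rw [IntermediateField.adjoin_simple_le_iff]
    exact inv_mem (IntermediateField.mem_adjoin_simple_self k f)
  · rw [IntermediateField.adjoin_simple_le_iff]
    simpa using inv_mem (IntermediateField.mem_adjoin_simple_self k f⁻¹)

variable [CharZero k]

theorem deg_pos (hK : IsCurveFunctionField k K) (v : Place k K) : 0 < v.deg := by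
  obtain ⟨f, -, hv⟩ := v.exists_ord_pos
  have hf := v.transcendental_of_ord_ne_zero hv.ne'
  have := hK f hf
  obtain ⟨S, hS, hd, -⟩ := exists_finset_zeros hf
  exact hd v ((hS v).2 hv)

/-- The divisor of a rational function `f`. Its degree is zero since `f` and `f⁻¹` have the same
number of zeros, namely the degree of the function field over `k(f) = k(f⁻¹)`. -/
theorem exists_divisor (hK : IsCurveFunctionField k K) {f : K} (hf : f ≠ 0) :
    ∃ D : CurveDivisor k K, (∀ v, D v = v.ord f) ∧ divisorDegree k K D = 0 := by
  classical
  by_cases ht : IsAlgebraic k f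
  · exact ⟨0, fun v => by rw [v.ord_algebraic ht]; rfl, map_zero _⟩
  have ht' : Transcendental k f⁻¹ := fun h => ht (by simpa using h.inv)
  have := hK f ht
  have := hK f⁻¹ ht'
  obtain ⟨S, hS, -, hSn⟩ := exists_finset_zeros (k := k) ht
  obtain ⟨T, hT, -, hTn⟩ := exists_finset_zeros (k := k) ht'
  rw [adjoin_simple_inv, ← hSn] at hTn
  have hT' : ∀ v, v ∈ T ↔ v.ord f < 0 := fun v => by rw [hT, v.ord_inv hf, neg_pos]
  have hdis : Disjoint S T := by
    rw [Finset.disjoint_left]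
    intro v h1 h2
    rw [hS] at h1
    rw [hT'] at h2
    exact lt_asymm h1 h2
  let D : CurveDivisor k K := Finsupp.onFinset (S ∪ T) (fun v => v.ord f) (by
    intro v hv
    rw [Finset.mem_union, hS, hT']
    exact (lt_or_gt_of_ne hv).symm)
  refine ⟨D, fun v => rfl, ?_⟩
  have h1 : divisorDegree k K D = ∑ v ∈ S ∪ T, v.ord f * v.deg := by
    rw [divisorDegree, Finsupp.liftAddHom_apply]
    exact Finsupp.onFinset_sum _ (fun _ => map_zero _)
  rw [h1, Finset.sum_union hdis, ← hTn, ← Finset.sum_add_distrib]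
  refine Finset.sum_eq_zero fun v _ => ?_
  rw [v.ord_inv hf]; ring

theorem degree_eq_zero_of_mem_principalDivisors (hK : IsCurveFunctionField k K)
    {D : CurveDivisor k K} (hD : D ∈ principalDivisors k K) : divisorDegree k K D = 0 := by
  obtain ⟨f, hf, h⟩ := hD
  obtain ⟨D', h', hd⟩ := exists_divisor hK hf
  rwa [show D = D' from Finsupp.ext fun v => by rw [h, h']]

end Degree

end Place

/-! ### Divisors pulled back from a quotient by an involution -/

namespace Place

variable {k K : Type} [Field k] [Field K] [Algebra k K]

/-- The action of an automorphism on divisors. -/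
def conjDivisor (σ : K ≃ₐ[k] K) : CurveDivisor k K →+ CurveDivisor k K :=
  Finsupp.mapDomain.addMonoidHom (conj σ)

theorem conjDivisor_single (σ : K ≃ₐ[k] K) (v : Place k K) (n : ℤ) :
    conjDivisor σ (Finsupp.single v n) = Finsupp.single (v.conj σ) n :=
  Finsupp.mapDomain_single

theorem divisorDegree_single (v : Place k K) (n : ℤ) :
    divisorDegree k K (Finsupp.single v n) = n * v.deg := by
  simp [divisorDegree]

theorem divisorDegree_conjDivisor (σ : K ≃ₐ[k] K) (D : CurveDivisor k K) :
    divisorDegree k K (conjDivisor σ D) = divisorDegree k K D := by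
  induction D using Finsupp.induction_linear with
  | zero => simp
  | add D D' h h' => simp only [map_add, h, h']
  | single v n => rw [conjDivisor_single, divisorDegree_single, divisorDegree_single, deg_conj]

/-- If all divisors `v + σ v` are, up to torsion and up to principal divisors, multiples of one
divisor of positive degree, then `D + σ D` is a torsion class for all `D` of degree zero. -/
theorem exists_nsmul_add_conjDivisor_mem [CharZero k] (hK : IsCurveFunctionField k K)
    (σ : K ≃ₐ[k] K) {D₀ : CurveDivisor k K} (h₀ : 0 < divisorDegree k K D₀)
    (h : ∀ v : Place k K, ∃ m : ℕ, 0 < m ∧ ∃ b : ℤ,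
      m • (Finsupp.single v 1 + Finsupp.single (v.conj σ) 1) - b • D₀ ∈ principalDivisors k K)
    {D : CurveDivisor k K} (hD : divisorDegree k K D = 0) :
    ∃ m : ℕ, 0 < m ∧ m • (D + conjDivisor σ D) ∈ principalDivisors k K := by
  have key : ∀ D : CurveDivisor k K, ∃ m : ℕ, 0 < m ∧ ∃ b : ℤ,
      m • (D + conjDivisor σ D) - b • D₀ ∈ principalDivisors k K := by
    intro D
    induction D using Finsupp.induction_linear with
    | zero => exact ⟨1, one_pos, 0, by simp [zero_mem]⟩
    | add D D' h h' =>
      obtain ⟨m, hm, b, h⟩ := h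
      obtain ⟨m', hm', b', h'⟩ := h'
      refine ⟨m * m', Nat.mul_pos hm hm', m' * b + m * b', ?_⟩
      have := add_mem (AddSubgroup.nsmul_mem _ h m') (AddSubgroup.nsmul_mem _ h' m)
      convert this using 1
      rw [map_add]
      module
    | single v n =>
      obtain ⟨m, hm, b, h⟩ := h v
      refine ⟨m, hm, n * b, ?_⟩
      have := AddSubgroup.zsmul_mem _ h n
      convert this using 1
      have h1 : ∀ w : Place k K, Finsupp.single w n = n • Finsupp.single w (1 : ℤ) := by simp
      rw [conjDivisor_single, h1 v, h1 (v.conj σ)]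
      module
  obtain ⟨m, hm, b, h⟩ := key D
  have hd := degree_eq_zero_of_mem_principalDivisors hK h
  rw [map_sub, map_nsmul, map_zsmul, map_add, divisorDegree_conjDivisor, hD] at hd
  have hb : b = 0 := by simpa [h₀.ne'] using hd
  rw [hb, zero_smul, sub_zero] at h
  exact ⟨m, hm, h⟩

section Pullback

variable {R : Type} [CommRing R] [Algebra k R]
  {σ : K ≃ₐ[k] K} {ψ : R →ₐ[k] K}

open IsDedekindDomain

/-- The prime of `R` below a place of `K` that is finite on the image of `R`. -/
def below (ψ : R →ₐ[k] K) (v : Place k K) (hv : ∀ r, ψ r ∈ v.ring) : Ideal R :=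
  (IsLocalRing.maximalIdeal v.ring).comap
    ((ψ : R →+* K).codRestrict v.ring.toSubring hv : R →+* v.ring)

theorem mem_below {v : Place k K} (hv : ∀ r, ψ r ∈ v.ring) {r : R} :
    r ∈ below ψ v hv ↔ ψ r ∈ v.ring.nonunits := by
  rw [below, Ideal.mem_comap, ← ValuationSubring.coe_mem_nonunits_iff]
  rfl

instance {v : Place k K} (hv : ∀ r, ψ r ∈ v.ring) : (below ψ v hv).IsPrime :=
  Ideal.comap_isPrime _ _

variable (hσ : ∀ x, σ (σ x) = x) (hψ : Function.Injective ψ) (hfix : ∀ r, σ (ψ r) = ψ r)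
  (hrange : ∀ x, σ x = x → ∃ a b, b ≠ 0 ∧ x = ψ a / ψ b)

include hσ hrange in
theorem below_ne_bot {v : Place k K} (hv : ∀ r, ψ r ∈ v.ring) : below ψ v hv ≠ ⊥ := by
  intro hb
  have h1 : ∀ x, σ x = x → x ∈ v.ring := by
    intro x hx
    obtain ⟨a, b, hb0, rfl⟩ := hrange x hx
    have : b ∉ below ψ v hv := by rwa [hb, Ideal.mem_bot]
    rw [mem_below, ValuationSubring.mem_nonunits_iff_or, not_or, not_not] at this
    rw [div_eq_mul_inv]
    exact mul_mem (hv a) this.2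
  apply v.ring_ne_top
  rw [eq_top_iff]
  intro x _
  have ht : x + σ x ∈ v.ring := h1 _ (by rw [map_add, hσ, add_comm])
  have hn : x * σ x ∈ v.ring := h1 _ (by rw [map_mul, hσ, mul_comm])
  by_contra hx
  have hx0 : x ≠ 0 := by rintro rfl; exact hx (zero_mem _)
  have hi : x⁻¹ ∈ v.ring := (v.ring.mem_or_inv_mem x).resolve_left hx
  apply hx
  have : x = (x + σ x) - (x * σ x) * x⁻¹ := by field_simp; ring
  rw [this]
  exact sub_mem ht (mul_mem hn hi)

variable [IsDedekindDomain R]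

include hσ hψ hrange in
theorem eq_or_eq_conj_of_below_eq {v w : Place k K} (hv : ∀ r, ψ r ∈ v.ring)
    (hw : ∀ r, ψ r ∈ w.ring) (h : below ψ v hv = below ψ w hw) : w = v ∨ w = v.conj σ := by
  apply eq_or_eq_conj hσ
  intro x hx
  obtain ⟨a, b, hb, rfl⟩ := hrange x hx
  let q : HeightOneSpectrum R := ⟨below ψ v hv, inferInstance, below_ne_bot hσ hrange hv⟩
  have hq1 : ∀ r, r ∉ q.asIdeal → (ψ r)⁻¹ ∈ v.ring ∧ (ψ r)⁻¹ ∈ w.ring := by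
    intro r hr
    have hr' : r ∉ below ψ w hw := by rwa [← h]
    have hr : r ∉ below ψ v hv := hr
    rw [mem_below, ValuationSubring.mem_nonunits_iff_or, not_or, not_not] at hr hr'
    exact ⟨hr.2, hr'.2⟩
  have hq2 : ∀ r ∈ q.asIdeal, ψ r ∈ v.ring.nonunits ∧ ψ r ∈ w.ring.nonunits := by
    intro r hr
    exact ⟨(mem_below hv).1 hr, (mem_below hw).1 (h ▸ hr)⟩
  have hψb : ψ b ≠ 0 := (map_ne_zero_iff ψ hψ).2 hb
  obtain ⟨n, d, hnd⟩ := q.exists_primeCompl_mul_eq_or_mul_eq (K := FractionRing R)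
    (algebraMap R _ a / algebraMap R _ b)
  have hb' : algebraMap R (FractionRing R) b ≠ 0 := by simpa using hb
  have hd0 : ψ d ≠ 0 := (map_ne_zero_iff ψ hψ).2 (fun h0 => d.2 (h0 ▸ zero_mem _))
  have hcase1 : ∀ n d : R, d ∉ q.asIdeal → ψ d ≠ 0 → a * d = n * b →
      (ψ a / ψ b ∈ v.ring ↔ ψ a / ψ b ∈ w.ring) := by
    intro n d hd hd0 e
    have e' := congrArg ψ e
    rw [map_mul, map_mul] at e'
    have : ψ a / ψ b = ψ n * (ψ d)⁻¹ := by field_simp; linear_combination e'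
    rw [this]
    exact ⟨fun _ => mul_mem (hw n) (hq1 d hd).2, fun _ => mul_mem (hv n) (hq1 d hd).1⟩
  rcases hnd with hnd | hnd
  · apply hcase1 n d d.2 hd0
    apply IsFractionRing.injective R (FractionRing R)
    rw [map_mul, map_mul]
    field_simp at hnd
    linear_combination hnd
  · have e : a * n = d * b := by
      apply IsFractionRing.injective R (FractionRing R)
      rw [map_mul, map_mul]
      field_simp at hnd
      linear_combination hnd
    by_cases hn : n ∈ q.asIdeal
    · -- `x⁻¹` lies in both maximal ideals
      have e' := congrArg ψ e
      rw [map_mul, map_mul] at e'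
      have ha0 : ψ a ≠ 0 := by
        intro h0
        rw [h0, zero_mul] at e'
        exact mul_ne_zero hd0 hψb e'.symm
      have hx0 : ψ a / ψ b ≠ 0 := div_ne_zero ha0 hψb
      have hinv : (ψ a / ψ b)⁻¹ = (ψ d)⁻¹ * ψ n := by field_simp; linear_combination -e'
      have hno : ∀ u : Place k K, (ψ d)⁻¹ ∈ u.ring → ψ n ∈ u.ring.nonunits →
          ψ a / ψ b ∉ u.ring := by
        intro u hu hu'
        have : (ψ a / ψ b)⁻¹ ∈ u.ring.nonunits := by
          rw [hinv]
          rw [ValuationSubring.mem_nonunits_iff] at hu' ⊢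
          rw [map_mul]
          exact mul_lt_one_of_nonneg_of_lt_one_right
            ((u.ring.valuation_le_one_iff _).2 hu) zero_le hu'
        rw [ValuationSubring.inv_mem_nonunits_iff] at this
        exact this.resolve_left hx0
      exact iff_of_false (hno v (hq1 d d.2).1 (hq2 n hn).1) (hno w (hq1 d d.2).2 (hq2 n hn).2)
    · have hn0 : ψ n ≠ 0 := (map_ne_zero_iff ψ hψ).2 (fun h0 => hn (h0 ▸ zero_mem _))
      exact hcase1 d n hn hn0 e

/-- The divisor `v + σ v`. -/
def pairDivisor (σ : K ≃ₐ[k] K) (v : Place k K) : CurveDivisor k K :=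
  Finsupp.single v 1 + Finsupp.single (v.conj σ) 1

theorem divisorDegree_pairDivisor_pos [CharZero k] (hK : IsCurveFunctionField k K)
    (σ : K ≃ₐ[k] K) (v : Place k K) : 0 < divisorDegree k K (pairDivisor σ v) := by
  have := v.deg_pos hK
  rw [pairDivisor, map_add, divisorDegree_single, divisorDegree_single, deg_conj]
  positivity

/-- Twice a conjugation-invariant function on `{v, σ v}`, extended by zero, is a multiple of
`v + σ v`; the factor two is needed when `v = σ v`. -/
theorem exists_zsmul_pairDivisor (v : Place k K) (c : ℤ) :
    ∃ m : ℤ, (0 < c → 0 < m) ∧ ((m • pairDivisor σ v) v = 2 * c) ∧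
      ((m • pairDivisor σ v) (v.conj σ) = 2 * c) ∧
      ∀ w, w ≠ v → w ≠ v.conj σ → (m • pairDivisor σ v) w = 0 := by
  by_cases h : v.conj σ = v
  · refine ⟨c, id, ?_, ?_, ?_⟩
    · simp [pairDivisor, h]; ring
    · simp [pairDivisor, h]; ring
    · intro w h1 h2
      simp [pairDivisor, h, h1.symm]
  · refine ⟨2 * c, fun h => by linarith, ?_, ?_, ?_⟩
    · simp [pairDivisor, h]
    · simp [pairDivisor, Ne.symm h]
    · intro w h1 h2
      simp [pairDivisor, h1.symm, h2.symm]

include hσ hψ hfix hrange in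
/-- The pullbacks of the places of the quotient are, up to torsion and principal divisors,
multiples of one divisor, when the affine coordinate ring `R` of the quotient has torsion class
group and only one place at infinity. -/
theorem exists_divisor_of_isOfFinOrder [CharZero k] (hK : IsCurveFunctionField k K)
    [Nonempty (Place k K)]
    (hcl : ∀ c : ClassGroup R, IsOfFinOrder c)
    (hinf : ∀ v w : Place k K, (∃ r, ψ r ∉ v.ring) → (∃ r, ψ r ∉ w.ring) →
      ∀ x, σ x = x → (x ∈ v.ring ↔ x ∈ w.ring)) :
    ∃ D₀ : CurveDivisor k K, 0 < divisorDegree k K D₀ ∧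
      ∀ v : Place k K, ∃ m : ℕ, 0 < m ∧ ∃ b : ℤ,
      m • (Finsupp.single v 1 + Finsupp.single (v.conj σ) 1) - b • D₀ ∈ principalDivisors k K := by
  -- a place at infinity, if there is one
  obtain ⟨v₀, hv₀⟩ : ∃ v₀ : Place k K, ∀ v : Place k K, (∃ r, ψ r ∉ v.ring) → ∃ r, ψ r ∉ v₀.ring := by
    by_cases h : ∃ v : Place k K, ∃ r, ψ r ∉ v.ring
    · exact ⟨h.choose, fun _ _ => h.choose_spec⟩
    · exact ⟨Classical.arbitrary _, fun v hv => (h ⟨v, hv⟩).elim⟩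
  have hv₀' : ∀ v : Place k K, (∃ r, ψ r ∉ v.ring) → v = v₀ ∨ v = v₀.conj σ := fun v hv =>
    eq_or_eq_conj hσ (hinf v₀ v (hv₀ v hv) hv)
  refine ⟨pairDivisor σ v₀, divisorDegree_pairDivisor_pos hK σ v₀, fun v => ?_⟩
  change ∃ m : ℕ, 0 < m ∧ ∃ b : ℤ, m • pairDivisor σ v - _ ∈ _
  have hinvol : (v₀.conj σ).conj σ = v₀ := by
    rw [conj_conj]
    apply ext_ring
    ext x
    simp [mem_conj, hσ]
  by_cases hv : ∀ r, ψ r ∈ v.ring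
  swap
  · push Not at hv
    refine ⟨1, one_pos, 1, ?_⟩
    rcases hv₀' v hv with rfl | rfl
    · simp [zero_mem]
    · rw [pairDivisor, pairDivisor, hinvol, add_comm (Finsupp.single v₀ _)]
      simp [zero_mem]
  let q : HeightOneSpectrum R := ⟨below ψ v hv, inferInstance, below_ne_bot hσ hrange hv⟩
  obtain ⟨n, hn, hqn⟩ := (hcl (ClassGroup.mk0 ⟨q.asIdeal,
    mem_nonZeroDivisors_of_ne_zero q.ne_bot⟩)).exists_pow_eq_one
  rw [← map_pow, ClassGroup.mk0_eq_one_iff] at hqn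
  obtain ⟨a, ha⟩ := hqn.principal
  replace ha : q.asIdeal ^ n = Ideal.span {a} := ha
  have haq : a ∈ q.asIdeal ^ n := ha ▸ Ideal.mem_span_singleton_self a
  have ha0 : a ≠ 0 := by
    rintro rfl
    have : q.asIdeal ^ n = 0 := by simpa using ha
    exact q.ne_bot (eq_zero_of_pow_eq_zero this)
  have hg0 : ψ a ≠ 0 := (map_ne_zero_iff ψ hψ).2 ha0
  obtain ⟨D, hD, -⟩ := exists_divisor hK hg0
  have hσord : ∀ w : Place k K, (w.conj σ).ord (ψ a) = w.ord (ψ a) := fun w => by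
    rw [ord_conj, hfix]
  have hpos : 0 < v.ord (ψ a) := by
    rw [ord_pos_iff _ hg0]
    exact (mem_below hv).1 (Ideal.pow_le_self hn.ne' haq)
  -- `ψ a` is a unit at the other finite places
  have hzero : ∀ w : Place k K, (∀ r, ψ r ∈ w.ring) → w ≠ v → w ≠ v.conj σ →
      w.ord (ψ a) = 0 := by
    intro w hw h1 h2
    by_contra h0
    have h3 : a ∈ below ψ w hw := by
      rw [mem_below, ← ord_pos_iff _ hg0]
      exact lt_of_le_of_ne (w.ord_nonneg (hw a)) (Ne.symm h0)
    have h4 : q.asIdeal ≤ below ψ w hw := by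
      refine Ideal.IsPrime.le_of_pow_le (n := n) ?_
      rwa [ha, Ideal.span_singleton_le_iff_mem]
    have h5 : below ψ v hv = below ψ w hw :=
      q.isMaximal.eq_of_le (Ideal.IsPrime.ne_top inferInstance) h4
    rcases eq_or_eq_conj_of_below_eq hσ hψ hrange hv hw h5 with h | h
    · exact h1 h
    · exact h2 h
  obtain ⟨m, hm, hm1, hm2, hm3⟩ := exists_zsmul_pairDivisor (σ := σ) v (v.ord (ψ a))
  have hfin : ∀ w : Place k K, w = v ∨ w = v.conj σ → ∀ r, ψ r ∈ w.ring := by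
    rintro w (rfl | rfl) r
    · exact hv r
    · rw [mem_conj, hfix]; exact hv r
  have hmem : ∀ E : CurveDivisor k K, (∀ w, E w = 2 * w.ord (ψ a)) → E ∈ principalDivisors k K :=
    fun E hE => ⟨ψ a ^ 2, pow_ne_zero 2 hg0, fun w => by rw [hE, ord_pow _ hg0]; rfl⟩
  have hmv : ∀ w, w = v ∨ w = v.conj σ → (m • pairDivisor σ v) w = 2 * w.ord (ψ a) := by
    rintro w (rfl | rfl)
    · exact hm1
    · rw [hσord]; exact hm2
  have hm' : ((m.toNat : ℕ) : ℤ) = m := Int.toNat_of_nonneg (hm hpos).le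
  by_cases hi : ∃ r, ψ r ∉ v₀.ring
  · obtain ⟨b, -, hb1, hb2, hb3⟩ := exists_zsmul_pairDivisor (σ := σ) v₀ (v₀.ord (ψ a))
    have hinf₀ : ∀ w : Place k K, w = v₀ ∨ w = v₀.conj σ → ∃ r, ψ r ∉ w.ring := by
      obtain ⟨r, hr⟩ := hi
      rintro w (rfl | rfl)
      · exact ⟨r, hr⟩
      · exact ⟨r, by rwa [mem_conj, hfix]⟩
    have hbv : ∀ w, w = v₀ ∨ w = v₀.conj σ →
        (b • pairDivisor σ v₀) w = 2 * w.ord (ψ a) := by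
      rintro w (rfl | rfl)
      · exact hb1
      · rw [hσord]; exact hb2
    refine ⟨m.toNat, by simpa using hm hpos, -b, hmem _ fun w => ?_⟩
    rw [← natCast_zsmul, hm', neg_smul, sub_neg_eq_add, Finsupp.add_apply]
    by_cases h1 : w = v ∨ w = v.conj σ
    · have h2 : ¬ (w = v₀ ∨ w = v₀.conj σ) := fun h2 => by
        obtain ⟨r, hr⟩ := hinf₀ w h2
        exact hr (hfin w h1 r)
      rw [not_or] at h2
      rw [hmv w h1, hb3 w h2.1 h2.2, add_zero]
    · rw [not_or] at h1
      rw [hm3 w h1.1 h1.2, zero_add]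
      by_cases h2 : w = v₀ ∨ w = v₀.conj σ
      · exact hbv w h2
      · have hw : ∀ r, ψ r ∈ w.ring := by
          by_contra! hw
          exact h2 (hv₀' w hw)
        rw [not_or] at h2
        rw [hb3 w h2.1 h2.2, hzero w hw h1.1 h1.2, mul_zero]
  · refine ⟨m.toNat, by simpa using hm hpos, 0, hmem _ fun w => ?_⟩
    rw [← natCast_zsmul, hm', zero_smul, sub_zero]
    by_cases h1 : w = v ∨ w = v.conj σ
    · exact hmv w h1
    · rw [not_or] at h1
      have hw : ∀ r, ψ r ∈ w.ring := by
        by_contra! hw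
        exact hi (hv₀ w hw)
      rw [hm3 w h1.1 h1.2, hzero w hw h1.1 h1.2, mul_zero]

end Pullback

end Place

/-! ### The class group of the coordinate ring of an elliptic curve -/

namespace WeierstrassCurve.Affine

open Polynomial

section RiemannRoch

variable {F : Type} [Field F] {W : WeierstrassCurve.Affine F}

namespace CoordinateRing

theorem finiteDimensional_quotient {I : Ideal W.CoordinateRing} (hI : I ≠ ⊥) :
    FiniteDimensional F (W.CoordinateRing ⧸ I) := by
  exact Module.Finite.equiv
    (I.quotientEquivDirectSum F (CoordinateRing.basis W) hI).symm

/-- Codimensions of ideals add up; only the inequality that is used later is stated. -/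
theorem finrank_add_finrank_le [IsDedekindDomain W.CoordinateRing] {I P : Ideal W.CoordinateRing}
    (hI : I ≠ ⊥) (hP : P.IsMaximal) (hP0 : P ≠ ⊥) :
    Module.finrank F (W.CoordinateRing ⧸ I) + Module.finrank F (W.CoordinateRing ⧸ P) ≤
      Module.finrank F (W.CoordinateRing ⧸ I * P) := by
  have hIP0 : I * P ≠ ⊥ := mul_ne_zero hI hP0
  have := finiteDimensional_quotient hIP0
  have hlt : ¬ I ≤ I * P := by
    intro h
    have h1 : I * P = I * 1 := by rw [mul_one]; exact le_antisymm Ideal.mul_le_left h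
    have h2 := mul_left_cancel₀ hI h1
    exact hP.ne_top (by rw [h2, Ideal.one_eq_top])
  obtain ⟨x, hxI, hx⟩ := Set.not_subset.1 hlt
  let g : (W.CoordinateRing ⧸ P) →ₗ[F] (W.CoordinateRing ⧸ I * P) :=
    (Submodule.mapQ P (I * P) (LinearMap.mulRight W.CoordinateRing x) (by
      intro r hr
      exact Ideal.mul_mem_mul_rev hxI hr)).restrictScalars F
  have hg : Function.Injective g := by
    rw [← LinearMap.ker_eq_bot, LinearMap.ker_eq_bot']
    intro m hm
    obtain ⟨r, rfl⟩ := Ideal.Quotient.mk_surjective m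
    have hm' : r * x ∈ I * P := Ideal.Quotient.eq_zero_iff_mem.1 hm
    rw [Ideal.Quotient.eq_zero_iff_mem]
    by_contra hr
    obtain ⟨s, hs⟩ := hP.exists_inv hr
    obtain ⟨i, hi, e⟩ := hs
    apply hx
    have : x = s * (r * x) + x * i := by linear_combination x * (-e)
    rw [this]
    exact add_mem (Ideal.mul_mem_left _ _ hm') (Ideal.mul_mem_mul hxI hi)
  let π : (W.CoordinateRing ⧸ I * P) →ₗ[F] (W.CoordinateRing ⧸ I) := (Ideal.Quotient.factorₐ F Ideal.mul_le_left).toLinearMap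
  have hπ : Function.Surjective π := fun y => by
    obtain ⟨r, rfl⟩ := Ideal.Quotient.mk_surjective y
    exact ⟨Ideal.Quotient.mk _ r, rfl⟩
  have hgπ : LinearMap.range g ≤ LinearMap.ker π := by
    rintro _ ⟨m, rfl⟩
    obtain ⟨r, rfl⟩ := Ideal.Quotient.mk_surjective m
    change Ideal.Quotient.mk I (r * x) = 0
    rw [Ideal.Quotient.eq_zero_iff_mem]
    exact Ideal.mul_mem_left _ _ hxI
  have h1 := LinearMap.finrank_range_add_finrank_ker π
  rw [LinearMap.range_eq_top.2 hπ, finrank_top] at h1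
  have h2 := Submodule.finrank_mono hgπ
  rw [LinearMap.finrank_range_of_inj hg] at h2
  change Module.finrank F (W.CoordinateRing ⧸ I) + Module.finrank F (W.CoordinateRing ⧸ P) ≤ _
  omega

/-- The Riemann-Roch space argument: an ideal of codimension `d` contains a nonzero function whose
pole at infinity has order at most `d + 1`. -/
theorem exists_mem_finrank_le {I : Ideal W.CoordinateRing} (hI : I ≠ ⊥) :
    ∃ f ∈ I, f ≠ 0 ∧ Module.finrank F (W.CoordinateRing ⧸ Ideal.span {f}) ≤
      Module.finrank F (W.CoordinateRing ⧸ I) + 1 := by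
  have := finiteDimensional_quotient hI
  set d := Module.finrank F (W.CoordinateRing ⧸ I)
  -- these bounds on the degrees of `p` and `q` allow poles of order at most `d + 1` at infinity,
  -- where `p + qY` has a pole of order `max (2 deg p) (2 deg q + 3)`
  let V := degreeLT F ((d + 1) / 2 + 1) × degreeLT F (d / 2)
  let ev : V →ₗ[F] W.CoordinateRing :=
    { toFun := fun v => (v.1 : F[X]) • (1 : W.CoordinateRing) + (v.2 : F[X]) • mk W X
      map_add' := fun v w => by
        change ((v.1 : F[X]) + w.1) • (1 : W.CoordinateRing) + ((v.2 : F[X]) + w.2) • mk W X = _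
        rw [add_smul, add_smul]; abel
      map_smul' := fun c v => by
        change (c • (v.1 : F[X])) • (1 : W.CoordinateRing) + (c • (v.2 : F[X])) • mk W X = _
        rw [smul_assoc, smul_assoc, ← smul_add]; rfl }
  have hV : Module.finrank F V = d + 1 := by
    have h1 : ∀ n, Module.finrank F (degreeLT F n) = n := fun n => by
      rw [(degreeLTEquiv F n).finrank_eq, Module.finrank_fin_fun]
    have h2 : ∀ n, Module.Finite F (degreeLT F n) := fun n =>
      Module.Finite.equiv (degreeLTEquiv F n).symm
    have := h2 ((d + 1) / 2 + 1)
    have := h2 (d / 2)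
    rw [Module.finrank_prod, h1, h1]
    omega
  have : Module.Finite F V := Module.finite_of_finrank_pos (by omega)
  let q : V →ₗ[F] (W.CoordinateRing ⧸ I) := (Ideal.Quotient.mkₐ F I).toLinearMap ∘ₗ ev
  obtain ⟨v, hv, hv0⟩ : ∃ v, q v = 0 ∧ v ≠ 0 := by
    have hker : LinearMap.ker q ≠ ⊥ := LinearMap.ker_ne_bot_of_finrank_lt (by omega)
    obtain ⟨v, hv, hv0⟩ := (Submodule.ne_bot_iff _).1 hker
    exact ⟨v, hv, hv0⟩
  have hev : ev v ∈ I := Ideal.Quotient.eq_zero_iff_mem.1 hv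
  have hev0 : ev v ≠ 0 := by
    intro h
    obtain ⟨h1, h2⟩ := smul_basis_eq_zero h
    exact hv0 (Prod.ext (Subtype.ext h1) (Subtype.ext h2))
  refine ⟨ev v, hev, hev0, ?_⟩
  rw [finrank_quotient_span_eq_natDegree_norm (CoordinateRing.basis W) hev0]
  apply natDegree_le_of_degree_le
  change (Algebra.norm F[X] ((v.1 : F[X]) • (1 : W.CoordinateRing) + (v.2 : F[X]) • mk W X)).degree ≤ _
  rw [degree_norm_smul_basis]
  have h1 := mem_degreeLT.1 v.1.2
  have h2 := mem_degreeLT.1 v.2.2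
  apply max_le
  · by_cases h0 : (v.1 : F[X]) = 0
    · simp [h0]
    · rw [degree_eq_natDegree h0] at h1 ⊢
      have : (v.1 : F[X]).natDegree < (d + 1) / 2 + 1 := by exact_mod_cast h1
      have : 2 * (v.1 : F[X]).natDegree ≤ d + 1 := by omega
      rw [nsmul_eq_mul]
      exact_mod_cast this
  · by_cases h0 : (v.2 : F[X]) = 0
    · simp [h0]
    · rw [degree_eq_natDegree h0] at h2 ⊢
      have : (v.2 : F[X]).natDegree < d / 2 := by exact_mod_cast h2
      have : 2 * (v.2 : F[X]).natDegree + 3 ≤ d + 1 := by omega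
      rw [nsmul_eq_mul]
      exact_mod_cast this

/-- The class of a nonzero ideal `I` is trivial or inverse to the class of a maximal ideal of degree
one: for `f` in `I` with at most `deg I + 1` zeros, `(f) = I P` with `P` of degree at most one. -/
theorem isPrincipal_or_exists_mul_isPrincipal [IsDedekindDomain W.CoordinateRing] {I : Ideal W.CoordinateRing}
    (hI : I ≠ ⊥) : (∃ f, f ≠ 0 ∧ I = Ideal.span {f}) ∨
      ∃ P : Ideal W.CoordinateRing, P.IsMaximal ∧
        Module.finrank F (W.CoordinateRing ⧸ P) = 1 ∧ ∃ f, f ≠ 0 ∧ I * P = Ideal.span {f} := by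
  obtain ⟨f, hfI, hf0, hle⟩ := exists_mem_finrank_le hI
  obtain ⟨J, hJ⟩ := Ideal.dvd_iff_le.2 ((Ideal.span_singleton_le_iff_mem I).2 hfI)
  by_cases hJ1 : J = ⊤
  · left
    exact ⟨f, hf0, by rw [hJ, hJ1, ← Ideal.one_eq_top, mul_one]⟩
  right
  have hf0' : Ideal.span {f} ≠ ⊥ := by simpa using hf0
  have hJ0 : J ≠ ⊥ := by
    rintro rfl
    apply hf0'
    rw [hJ, Ideal.mul_bot]
  obtain ⟨P, hP, hJP⟩ := Ideal.exists_le_maximal J hJ1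
  have hP0 : P ≠ ⊥ := fun h => hJ0 (le_bot_iff.1 (h ▸ hJP))
  have h1 := finrank_add_finrank_le hI hP hP0
  have hle2 : Ideal.span {f} ≤ I * P := hJ ▸ Ideal.mul_mono_right hJP
  have := finiteDimensional_quotient hf0'
  have := finiteDimensional_quotient hP0
  have := finiteDimensional_quotient (mul_ne_zero hI hP0 : I * P ≠ ⊥)
  let π : (W.CoordinateRing ⧸ Ideal.span {f}) →ₗ[F] (W.CoordinateRing ⧸ I * P) :=
    (Ideal.Quotient.factorₐ F hle2).toLinearMap
  have hπ : Function.Surjective π := fun y => by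
    obtain ⟨r, rfl⟩ := Ideal.Quotient.mk_surjective y
    exact ⟨Ideal.Quotient.mk _ r, rfl⟩
  have h2 := LinearMap.finrank_range_add_finrank_ker π
  rw [LinearMap.range_eq_top.2 hπ, finrank_top] at h2
  have h3 : 0 < Module.finrank F (W.CoordinateRing ⧸ P) := by
    have : Nontrivial (W.CoordinateRing ⧸ P) := Ideal.Quotient.nontrivial_iff.2 hP.ne_top
    exact Module.finrank_pos
  have h4 : Module.finrank F (LinearMap.ker π) = 0 := by omega
  refine ⟨P, hP, by omega, f, hf0, le_antisymm ?_ hle2⟩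
  have h5 := LinearMap.ker_eq_bot.1 (Submodule.finrank_eq_zero.1 h4)
  intro r hr
  rw [← Ideal.Quotient.eq_zero_iff_mem] at hr ⊢
  apply h5
  rw [map_zero]
  exact hr

/-- A maximal ideal of degree one is the ideal of a rational point. -/
theorem exists_eq_XYIdeal {P : Ideal W.CoordinateRing}
    (h1 : Module.finrank F (W.CoordinateRing ⧸ P) = 1) :
    ∃ x y : F, W.Equation x y ∧ P = XYIdeal W x (C y) := by
  have hne : Nontrivial (W.CoordinateRing ⧸ P) :=
    Module.nontrivial_of_finrank_pos (R := F) (by omega)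
  have hs : ∀ r : W.CoordinateRing, ∃ c : F, r - algebraMap F _ c ∈ P := by
    intro r
    obtain ⟨c, hc⟩ := (finrank_eq_one_iff_of_nonzero' (1 : W.CoordinateRing ⧸ P) one_ne_zero).1 h1
      (Ideal.Quotient.mk P r)
    refine ⟨c, ?_⟩
    rw [← Ideal.Quotient.eq, ← hc, ← Algebra.algebraMap_eq_smul_one]
    rfl
  obtain ⟨x, hx⟩ := hs (mk W (C X))
  obtain ⟨y, hy⟩ := hs (mk W X)
  have hle : XYIdeal W x (C y) ≤ P := by
    rw [XYIdeal, Ideal.span_le]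
    rintro _ (rfl | rfl)
    · rw [XClass, map_sub, map_sub]; exact hx
    · rw [YClass, map_sub]; exact hy
  have heq : (W.polynomial.eval (C y)).eval x = 0 := by
    let θ : F[X][X] →+* W.CoordinateRing ⧸ P := (Ideal.Quotient.mk P).comp (mk W)
    have hθ : θ = (algebraMap F (W.CoordinateRing ⧸ P)).comp (evalEvalRingHom x y) := by
      refine Polynomial.ringHom_ext (fun p => ?_) ?_
      · have : θ.comp C = ((algebraMap F (W.CoordinateRing ⧸ P)).comp
            (evalEvalRingHom x y)).comp C := by
          refine Polynomial.ringHom_ext (fun a => ?_) ?_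
          · simp [θ]
            rfl
          · simpa [θ] using Ideal.Quotient.eq.2 hx
        exact RingHom.congr_fun this p
      · simpa [θ] using Ideal.Quotient.eq.2 hy
    have h0 : θ W.polynomial = 0 := by simp [θ, AdjoinRoot.mk_self]
    rw [hθ] at h0
    simpa [evalEval] using h0
  refine ⟨x, y, heq, ?_⟩
  have hmax : (XYIdeal W x (C y)).IsMaximal := by
    have : IsField (W.CoordinateRing ⧸ XYIdeal W x (C y)) :=
      MulEquiv.isField (Field.toIsField F) (quotientXYIdealEquiv heq).toMulEquiv
    exact Ideal.Quotient.maximal_of_isField _ this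
  exact (hmax.eq_of_le (Ideal.Quotient.nontrivial_iff.1 hne) hle).symm

end CoordinateRing

/-- If all rational points of an elliptic curve are torsion, then so are all classes in the ideal
class group of its coordinate ring. -/
theorem isOfFinOrder_classGroup [W.IsElliptic] [IsDedekindDomain W.CoordinateRing]
    [DecidableEq F]
    (h : ∀ P : W.Point, IsOfFinAddOrder P) (c : ClassGroup W.CoordinateRing) :
    IsOfFinOrder c := by
  obtain ⟨I, rfl⟩ := ClassGroup.mk0_surjective c
  have hI : (I : Ideal W.CoordinateRing) ≠ ⊥ := nonZeroDivisors.coe_ne_zero I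
  rcases CoordinateRing.isPrincipal_or_exists_mul_isPrincipal hI with ⟨f, hf, hIf⟩ | ⟨P, hP, h1, f, hf, hIf⟩
  · rw [(ClassGroup.mk0_eq_one_iff _).2 ⟨f, hIf⟩]
    exact IsOfFinOrder.one
  · obtain ⟨x, y, hxy, rfl⟩ := CoordinateRing.exists_eq_XYIdeal h1
    have hns : W.Nonsingular x y := (equation_iff_nonsingular (W := W)).1 hxy
    have hP0 : CoordinateRing.XYIdeal W x (C y) ≠ ⊥ := by
      intro h0
      rw [h0, Ideal.mul_bot, eq_comm, Ideal.span_singleton_eq_bot] at hIf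
      exact hf hIf
    have h2 := (Point.toClass (W := W)).isOfFinAddOrder (h (Point.some _ _ hns))
    have h3 : ClassGroup.mk0 ⟨CoordinateRing.XYIdeal W x (C y), mem_nonZeroDivisors_of_ne_zero hP0⟩ =
        (Point.toClass (Point.some _ _ hns)).toMul := by
      rw [Point.toClass_some, ← ClassGroup.mk_mk0 W.FunctionField]
      exact congrArg _ (Units.ext rfl)
    have h4 : ClassGroup.mk0 I * ClassGroup.mk0
        ⟨CoordinateRing.XYIdeal W x (C y), mem_nonZeroDivisors_of_ne_zero hP0⟩ = 1 := by
      rw [← map_mul, ClassGroup.mk0_eq_one_iff]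
      exact ⟨f, hIf⟩
    rw [eq_inv_of_mul_eq_one_left h4, h3]
    exact (isOfFinOrder_inv_iff).2 (isOfFinAddOrder_ofMul_iff.1 h2)

end RiemannRoch

end WeierstrassCurve.Affine

/-! ### The coordinate ring of an elliptic curve is a Dedekind domain -/

namespace WeierstrassCurve.Affine

open Polynomial

section Dedekind

variable {F : Type} [Field F] {W : WeierstrassCurve.Affine F}

/-- The right-hand side of the Weierstrass equation `Y² = X³ + a₂X² + a₄X + a₆`. -/
def cubic (W : WeierstrassCurve.Affine F) : F[X] :=
  X ^ 3 + C W.a₂ * X ^ 2 + C W.a₄ * X + C W.a₆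

namespace CoordinateRing

theorem mk_X_sq (h₁ : W.a₁ = 0) (h₃ : W.a₃ = 0) :
    mk W X ^ 2 = algebraMap F[X] W.CoordinateRing W.cubic := by
  have h' : mk W (X ^ 2 - C W.cubic) = 0 := by
    have h : X ^ 2 - C W.cubic = W.polynomial := by
      simp [WeierstrassCurve.Affine.polynomial, h₁, h₃, cubic]
    rw [h]
    exact AdjoinRoot.mk_self
  rw [map_sub, map_pow, sub_eq_zero] at h'
  exact h'

/-- The automorphism `Y ↦ -Y` of the coordinate ring. -/
def negHom (h₁ : W.a₁ = 0) (h₃ : W.a₃ = 0) : W.CoordinateRing →ₐ[F[X]] W.CoordinateRing :=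
  AdjoinRoot.liftAlgHom W.polynomial (Algebra.ofId _ _) (-mk W X) (by
    refine (congrArg (eval₂ _ _) (show W.polynomial = X ^ 2 - C W.cubic by
      simp [WeierstrassCurve.Affine.polynomial, h₁, h₃, cubic])).trans ?_
    rw [eval₂_sub, eval₂_pow, eval₂_X, eval₂_C, neg_sq, mk_X_sq h₁ h₃, sub_eq_zero]
    rfl)

theorem negHom_mk_X (h₁ : W.a₁ = 0) (h₃ : W.a₃ = 0) : negHom h₁ h₃ (mk W X) = -mk W X :=
  AdjoinRoot.liftAlgHom_root _ _ _ _

theorem negHom_injective (h₁ : W.a₁ = 0) (h₃ : W.a₃ = 0) :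
    Function.Injective (negHom h₁ h₃) := by
  have : ∀ x, negHom h₁ h₃ (negHom h₁ h₃ x) = x := by
    intro x
    obtain ⟨p, q, rfl⟩ := exists_smul_basis_eq x
    simp only [map_add, map_smul, map_one, negHom_mk_X, map_neg, neg_neg]
  exact (show Function.LeftInverse _ _ from this).injective

instance finite : Module.Finite F[X] W.CoordinateRing := .of_basis (CoordinateRing.basis W)

instance : IsNoetherianRing W.CoordinateRing := IsNoetherianRing.of_finite F[X] _

/-- The polynomial ring is integrally closed: a quotient of polynomials that is integral is a
polynomial. -/
theorem dvd_of_isIntegral {K : Type} [Field K] [Algebra F[X] K] (p n : F[X]) (hn : n ≠ 0)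
    [FaithfulSMul F[X] K]
    (h : _root_.IsIntegral F[X] (algebraMap F[X] K p / algebraMap F[X] K n)) : n ∣ p := by
  let _ : Algebra (FractionRing F[X]) K := FractionRing.liftAlgebra F[X] K
  have : IsScalarTower F[X] (FractionRing F[X]) K := FractionRing.isScalarTower_liftAlgebra F[X] K
  have h2 : algebraMap (FractionRing F[X]) K
      (algebraMap F[X] _ p / algebraMap F[X] _ n) = algebraMap F[X] K p / algebraMap F[X] K n := by
    rw [map_div₀, ← IsScalarTower.algebraMap_apply, ← IsScalarTower.algebraMap_apply]
  rw [← h2, isIntegral_algebraMap_iff (algebraMap (FractionRing F[X]) K).injective] at h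
  obtain ⟨y, hy⟩ := IsIntegrallyClosed.isIntegral_iff.1 h
  have hn' : algebraMap F[X] (FractionRing F[X]) n ≠ 0 := by simpa using hn
  rw [eq_div_iff hn', ← map_mul] at hy
  exact ⟨y, by rw [mul_comm]; exact ((IsFractionRing.injective F[X] (FractionRing F[X])) hy).symm⟩

theorem exists_eq_div (x : W.FunctionField) : ∃ p q n : F[X], n ≠ 0 ∧
    x = algebraMap W.CoordinateRing _ (p • (1 : W.CoordinateRing) + q • mk W X) /
      algebraMap F[X] _ n := by
  obtain ⟨r, s, hs, rfl⟩ := IsFractionRing.div_surjective (A := W.CoordinateRing) x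
  have hs0 := nonZeroDivisors.ne_zero hs
  obtain ⟨n, hn, t, ht⟩ : ∃ n : F[X], n ≠ 0 ∧ ∃ t, t * s = algebraMap F[X] W.CoordinateRing n := by
    have hI : Ideal.comap (algebraMap F[X] W.CoordinateRing) (Ideal.span {s}) ≠ ⊥ :=
      Ideal.comap_ne_bot_of_integral_mem hs0 (Ideal.mem_span_singleton_self s)
        (Algebra.IsIntegral.isIntegral (R := F[X]) s)
    obtain ⟨n, hn, hn0⟩ := (Submodule.ne_bot_iff _).1 hI
    obtain ⟨t, ht⟩ := Ideal.mem_span_singleton'.1 hn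
    exact ⟨n, hn0, t, ht⟩
  obtain ⟨p, q, hpq⟩ := exists_smul_basis_eq (r * t)
  refine ⟨p, q, n, hn, ?_⟩
  have hn' : algebraMap F[X] W.CoordinateRing n ≠ 0 :=
    (map_ne_zero_iff _ (FaithfulSMul.algebraMap_injective _ _)).2 hn
  have inj := IsFractionRing.injective W.CoordinateRing W.FunctionField
  rw [hpq, IsScalarTower.algebraMap_apply F[X] W.CoordinateRing,
    div_eq_div_iff ((map_ne_zero_iff _ inj).2 hs0) ((map_ne_zero_iff _ inj).2 hn'),
    ← map_mul, ← map_mul, ← ht]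
  congr 1
  ring

/-- If `x = (p + qY) / n` is integral over `F[X]`, then so are its trace `2p/n`, whence `n ∣ p`, and
`(x - p/n)² = q² · cubic / n²`, whence `n ∣ q` as the cubic is squarefree. -/
theorem isIntegrallyClosed (h₁ : W.a₁ = 0) (h₃ : W.a₃ = 0) (h2 : (2 : F) ≠ 0)
    (hc : Squarefree W.cubic) : IsIntegrallyClosed W.CoordinateRing := by
  rw [isIntegrallyClosed_iff W.FunctionField]
  intro x hx
  have inj := IsFractionRing.injective W.CoordinateRing W.FunctionField
  have : FaithfulSMul F[X] W.FunctionField := by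
    rw [faithfulSMul_iff_algebraMap_injective, IsScalarTower.algebraMap_eq F[X] W.CoordinateRing]
    exact inj.comp (FaithfulSMul.algebraMap_injective _ _)
  have hx : _root_.IsIntegral F[X] x := isIntegral_trans x hx
  obtain ⟨p, q, n, hn, hpq⟩ := exists_eq_div x
  have inj2 := FaithfulSMul.algebraMap_injective F[X] W.FunctionField
  have hn' : algebraMap F[X] W.FunctionField n ≠ 0 := (map_ne_zero_iff _ inj2).2 hn
  set Y : W.FunctionField := algebraMap W.CoordinateRing _ (mk W X) with hY
  have hcomp : ∀ p q : F[X], algebraMap W.CoordinateRing W.FunctionField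
      (p • (1 : W.CoordinateRing) + q • mk W X) = algebraMap F[X] _ p + algebraMap F[X] _ q * Y := by
    intro p q
    rw [map_add, Algebra.smul_def, Algebra.smul_def, mul_one, map_mul,
      ← IsScalarTower.algebraMap_apply, ← IsScalarTower.algebraMap_apply]
  rw [hcomp] at hpq
  have hYY : Y ^ 2 = algebraMap F[X] _ W.cubic := by
    rw [hY, ← map_pow, mk_X_sq h₁ h₃, ← IsScalarTower.algebraMap_apply]
  -- the trace `2p/n` of `x` is integral
  let ν : W.CoordinateRing →ₐ[F[X]] W.FunctionField :=
    (IsScalarTower.toAlgHom F[X] W.CoordinateRing W.FunctionField).comp (negHom h₁ h₃)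
  have hν : Function.Injective ν := inj.comp (negHom_injective h₁ h₃)
  let τ : W.FunctionField →ₐ[F[X]] W.FunctionField := IsFractionRing.liftAlgHom hν
  have hτY : τ Y = -Y := by
    rw [hY]
    simp only [τ]
    rw [IsFractionRing.liftAlgHom_apply, IsFractionRing.lift_algebraMap]
    change algebraMap _ _ (negHom h₁ h₃ (mk W X)) = _
    rw [negHom_mk_X, map_neg]
  have hτ : _root_.IsIntegral F[X] (τ x) := hx.map τ
  have hsum : x + τ x = algebraMap F[X] _ (2 * p) / algebraMap F[X] _ n := by
    rw [hpq, map_div₀, map_add, map_mul, hτY, τ.commutes, τ.commutes, τ.commutes, map_mul,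
      map_ofNat]
    ring
  have hd := dvd_of_isIntegral (2 * p) n hn (hsum ▸ hx.add hτ)
  have h2u : IsUnit (2 : F[X]) := by
    rw [← map_ofNat C 2]
    exact isUnit_C.2 (isUnit_iff_ne_zero.2 h2)
  obtain ⟨p', rfl⟩ : n ∣ p := h2u.dvd_mul_left.1 hd
  have hx1 : _root_.IsIntegral F[X] ((x - algebraMap F[X] _ p') ^ 2) :=
    (hx.sub (isIntegral_algebraMap)).pow 2
  have hx2 : (x - algebraMap F[X] _ p') ^ 2 =
      algebraMap F[X] _ (q ^ 2 * W.cubic) / algebraMap F[X] _ (n ^ 2) := by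
    rw [hpq, map_mul, map_mul, map_pow, ← hYY, map_pow]
    field_simp
    ring
  -- the remaining part `qY/n` has an integral square
  have hd2 := dvd_of_isIntegral _ _ (pow_ne_zero 2 hn) (hx2 ▸ hx1)
  obtain ⟨q', rfl⟩ : n ∣ q := by
    obtain ⟨g, n', q', hcop, hne, hnq⟩ : ∃ g n' q', IsCoprime n' q' ∧ n = g * n' ∧ q = g * q' := by
      let _ := UniqueFactorizationMonoid.toGCDMonoid F[X]
      obtain ⟨n', q', h1, h2, h3⟩ := extract_gcd n q
      exact ⟨_, n', q', (gcd_isUnit_iff _ _).1 h3, h1, h2⟩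
    rw [hne, hnq] at hd2 ⊢
    have hg : g ≠ 0 := by rintro rfl; simp at hne; exact hn hne
    have hd3 : n' ^ 2 ∣ q' ^ 2 * W.cubic := by
      rw [mul_pow, mul_pow, mul_assoc] at hd2
      exact (mul_dvd_mul_iff_left (pow_ne_zero 2 hg)).1 hd2
    have hd4 : n' * n' ∣ W.cubic := by
      rw [← sq]; exact (hcop.pow).dvd_of_dvd_mul_left hd3
    exact mul_dvd_mul_left g ((hc n' hd4).dvd)
  refine ⟨p' • (1 : W.CoordinateRing) + q' • mk W X, ?_⟩
  rw [hcomp, hpq, map_mul, map_mul]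
  field_simp

theorem isDedekindDomain (h₁ : W.a₁ = 0) (h₃ : W.a₃ = 0) (h2 : (2 : F) ≠ 0)
    (hc : Squarefree W.cubic) : IsDedekindDomain W.CoordinateRing :=
  have := isIntegrallyClosed h₁ h₃ h2 hc
  have : Ring.DimensionLEOne W.CoordinateRing := Ring.DimensionLEOne.of_isIntegral F[X] _
  have : IsDedekindRing W.CoordinateRing := ⟨⟩
  ⟨⟩

end CoordinateRing

end Dedekind

end WeierstrassCurve.Affine

/-! ### The place at infinity of an elliptic curve -/

namespace Place

open Polynomial WeierstrassCurve.Affine WeierstrassCurve.Affine.CoordinateRing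

variable {k K : Type} [Field k] [Field K] [Algebra k K]

theorem ne_zero_of_notMem {v : Place k K} {f : K} (h : f ∉ v.ring) : f ≠ 0 := by
  rintro rfl
  exact h (zero_mem _)

theorem add_ne_zero_of_ord_lt (v : Place k K) {f g : K} (hf : f ≠ 0)
    (h : v.ord f < v.ord g) : f + g ≠ 0 := by
  intro h0
  rw [add_eq_zero_iff_eq_neg, ← neg_one_mul] at h0
  have hg : g ≠ 0 := by rintro rfl; simp at h0; exact hf h0
  rw [h0, v.ord_mul (by simp) hg, v.ord_algebraic (isAlgebraic_one.neg)] at h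
  simp at h

/-- The strict case of the ultrametric inequality. -/
theorem ord_add_of_lt (v : Place k K) {f g : K} (hf : f ≠ 0) (hg : g ≠ 0)
    (h : v.ord f < v.ord g) : v.ord (f + g) = v.ord f := by
  have h0 := v.add_ne_zero_of_ord_lt hf h
  have key : ∀ f g : K, f ≠ 0 → g ≠ 0 → f + g ≠ 0 → v.ord f ≤ v.ord g →
      v.ord f ≤ v.ord (f + g) := by
    intro f g hf hg h0 h
    have h1 : g * f⁻¹ ∈ v.ring := by
      rw [v.mem_ring_iff (mul_ne_zero hg (inv_ne_zero hf)), v.ord_mul hg (inv_ne_zero hf),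
        v.ord_inv hf]
      linarith
    have h2 : (f + g) * f⁻¹ ∈ v.ring := by
      rw [add_mul, mul_inv_cancel₀ hf]
      exact add_mem (one_mem _) h1
    rw [v.mem_ring_iff (mul_ne_zero h0 (inv_ne_zero hf)), v.ord_mul h0 (inv_ne_zero hf),
      v.ord_inv hf] at h2
    linarith
  refine le_antisymm ?_ (key f g hf hg h0 h.le)
  by_contra! h3
  have hng : v.ord (-g) = v.ord g := by
    rw [← neg_one_mul, v.ord_mul (by simp) hg, v.ord_algebraic (isAlgebraic_one.neg), zero_add]
  have e : -g + (f + g) = f := by ring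
  rcases le_total (v.ord (-g)) (v.ord (f + g)) with h4 | h4
  · have := key (-g) (f + g) (neg_ne_zero.2 hg) h0 (by rwa [e]) h4
    rw [e] at this
    linarith
  · have := key (f + g) (-g) h0 (neg_ne_zero.2 hg) (by rwa [add_comm, e]) h4
    rw [add_comm (f + g) (-g), e] at this
    linarith

/-- At a pole of `x`, a polynomial in `x` has the order of its leading term. -/
theorem ord_aeval (v : Place k K) {x : K} (hx : v.ord x < 0) {p : k[X]} (hp : p ≠ 0) :
    aeval x p ≠ 0 ∧ v.ord (aeval x p) = p.natDegree * v.ord x := by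
  have hx0 : x ≠ 0 := by
    rintro rfl
    simp [ord] at hx
  have hl : algebraMap k K p.leadingCoeff ≠ 0 := by simpa using hp
  have hlead : v.ord (algebraMap k K p.leadingCoeff * x ^ p.natDegree) = p.natDegree * v.ord x := by
    rw [v.ord_mul hl (pow_ne_zero _ hx0), v.ord_algebraic (isAlgebraic_algebraMap _), zero_add,
      v.ord_pow hx0]
  have hsum : aeval x p = algebraMap k K p.leadingCoeff * x ^ p.natDegree +
      aeval x p.eraseLead := by
    conv_lhs => rw [← p.eraseLead_add_C_mul_X_pow]
    rw [map_add, map_mul, map_pow, aeval_X, aeval_C, add_comm]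
  have hl0 := mul_ne_zero hl (pow_ne_zero p.natDegree hx0)
  by_cases h0 : p.eraseLead = 0
  · rw [h0, map_zero, add_zero] at hsum
    rw [hsum]
    exact ⟨hl0, hlead⟩
  · have hlt : p.eraseLead.natDegree < p.natDegree :=
      (p.eraseLead_natDegree_lt_or_eraseLead_eq_zero).resolve_right h0
    obtain ⟨h1, h2⟩ := ord_aeval v hx h0
    have h3 : v.ord (algebraMap k K p.leadingCoeff * x ^ p.natDegree) <
        v.ord (aeval x p.eraseLead) := by
      rw [hlead, h2]
      exact mul_lt_mul_of_neg_right (by exact_mod_cast hlt) hx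
    rw [hsum]
    exact ⟨v.add_ne_zero_of_ord_lt hl0 h3, by rw [v.ord_add_of_lt hl0 h1 h3, hlead]⟩
termination_by p.natDegree

variable {W : WeierstrassCurve.Affine k}

/-- A place that is not finite on the coordinate ring is a pole of `x`, since the coordinate ring is
integral over `k[x]`. -/
theorem notMem_of_exists_notMem (v : Place k K) (ψ : W.CoordinateRing →ₐ[k] K)
    (h : ∃ r, ψ r ∉ v.ring) : ψ (CoordinateRing.mk W (C X)) ∉ v.ring := by
  intro hx
  obtain ⟨r, hr⟩ := h
  apply hr
  apply v.mem_of_isIntegral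
  obtain ⟨p, hp, hpr⟩ := Algebra.IsIntegral.isIntegral (R := k[X]) r
  let θ : k[X] →ₐ[k] v.ring := aeval ⟨ψ (CoordinateRing.mk W (C X)), hx⟩
  have hθ : (algebraMap v.ring K).comp θ.toRingHom = ψ.toRingHom.comp (algebraMap k[X] W.CoordinateRing) := by
    refine Polynomial.ringHom_ext (fun a => ?_) ?_
    · simp only [RingHom.comp_apply]
      change ((θ (C a) : v.ring) : K) = ψ (algebraMap k[X] W.CoordinateRing (C a))
      have h1 : θ (C a) = algebraMap k v.ring a := θ.commutes a
      have h2 : algebraMap k[X] W.CoordinateRing (C a) = algebraMap k _ a :=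
        (IsScalarTower.algebraMap_apply k k[X] W.CoordinateRing a).symm
      rw [h1, h2, ψ.commutes]
      rfl
    · change ((θ X : v.ring) : K) = ψ (CoordinateRing.mk W (C X))
      simp [θ]
  refine ⟨p.map θ.toRingHom, hp.map _, ?_⟩
  rw [eval₂_map, hθ]
  have := congrArg ψ hpr
  rw [map_zero] at this
  rw [← this]
  exact (hom_eval₂ p _ ψ.toRingHom r).symm

/-- At a place above infinity the order of a function in the coordinate ring is determined by the
degree of its norm. -/
theorem two_mul_ord_eq (v : Place k K) {ψ : W.CoordinateRing →ₐ[k] K}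
    (h₁ : W.a₁ = 0) (h₃ : W.a₃ = 0)
    (hx : ψ (CoordinateRing.mk W (C X)) ∉ v.ring) {r : W.CoordinateRing} (hr : r ≠ 0) :
    2 * v.ord (ψ r) = v.ord (ψ (CoordinateRing.mk W (C X))) * (Algebra.norm k[X] r).natDegree := by
  set x := ψ (CoordinateRing.mk W (C X)) with hxdef
  have hx0 : x ≠ 0 := ne_zero_of_notMem hx
  have hneg : v.ord x < 0 := by
    rw [v.mem_ring_iff hx0] at hx
    exact not_le.1 hx
  have hpoly : ∀ p : k[X], ψ (algebraMap k[X] W.CoordinateRing p) = aeval x p := by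
    intro p
    have := aeval_algHom_apply (ψ.comp ((Algebra.ofId k[X] W.CoordinateRing).restrictScalars k)) X p
    rw [aeval_X_left_apply] at this
    exact this.symm.trans rfl
  obtain ⟨p, q, rfl⟩ := exists_smul_basis_eq r
  have hcubic : W.cubic.natDegree = 3 := by
    unfold cubic
    compute_degree!
  have hcubic0 : W.cubic ≠ 0 := by
    intro h
    rw [h] at hcubic
    simp at hcubic
  set y := ψ (CoordinateRing.mk W X)
  have hyy : y ^ 2 = aeval x W.cubic := by
    rw [← hpoly, ← mk_X_sq h₁ h₃, map_pow]
  obtain ⟨hc0, hc⟩ := v.ord_aeval hneg hcubic0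
  have hy0 : y ≠ 0 := by
    intro h
    rw [← hyy, h] at hc0
    simp at hc0
  have hy : 2 * v.ord y = 3 * v.ord x := by
    rw [← hyy, v.ord_pow hy0, hcubic] at hc
    exact_mod_cast hc
  have hψr : ψ (p • (1 : W.CoordinateRing) + q • CoordinateRing.mk W X) = aeval x p + aeval x q * y := by
    rw [map_add, Algebra.smul_def, Algebra.smul_def, mul_one, map_mul, hpoly, hpoly]
  have hdeg := degree_norm_smul_basis (W' := W) p q
  rw [hψr]
  by_cases hp : p = 0
  · have hq : q ≠ 0 := by rintro rfl; simp [hp] at hr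
    obtain ⟨hq0, hqo⟩ := v.ord_aeval hneg hq
    have hd : (Algebra.norm k[X] (p • (1 : W.CoordinateRing) + q • CoordinateRing.mk W X)).natDegree =
        2 * q.natDegree + 3 := by
      apply natDegree_eq_of_degree_eq_some
      rw [hdeg, hp, degree_eq_natDegree hq]
      simp
    rw [hd, hp, map_zero, zero_add, v.ord_mul hq0 hy0, hqo]
    push_cast
    linear_combination hy
  obtain ⟨hp0, hpo⟩ := v.ord_aeval hneg hp
  by_cases hq : q = 0
  · have hd : (Algebra.norm k[X] (p • (1 : W.CoordinateRing) + q • CoordinateRing.mk W X)).natDegree =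
        2 * p.natDegree := by
      apply natDegree_eq_of_degree_eq_some
      rw [hdeg, hq, degree_eq_natDegree hp]
      simp
    rw [hd, hq, map_zero, zero_mul, add_zero, hpo]
    push_cast
    ring
  obtain ⟨hq0, hqo⟩ := v.ord_aeval hneg hq
  have hd : (Algebra.norm k[X] (p • (1 : W.CoordinateRing) + q • CoordinateRing.mk W X)).natDegree =
      max (2 * p.natDegree) (2 * q.natDegree + 3) := by
    apply natDegree_eq_of_degree_eq_some
    rw [hdeg, degree_eq_natDegree hp, degree_eq_natDegree hq]
    rcases le_total (2 * p.natDegree) (2 * q.natDegree + 3) with h | h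
    · rw [max_eq_right h, max_eq_right (by rw [nsmul_eq_mul, nsmul_eq_mul]; exact_mod_cast h)]
      simp
    · rw [max_eq_left h, max_eq_left (by rw [nsmul_eq_mul, nsmul_eq_mul]; exact_mod_cast h)]
      simp
  have hqy : v.ord (aeval x q * y) = q.natDegree * v.ord x + v.ord y := by
    rw [v.ord_mul hq0 hy0, hqo]
  rw [hd]
  rcases lt_or_ge (2 * p.natDegree) (2 * q.natDegree + 3) with h | h
  · rw [max_eq_right h.le, add_comm, v.ord_add_of_lt (mul_ne_zero hq0 hy0) hp0, hqy]
    · push_cast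
      linear_combination hy
    · rw [hqy, hpo]
      have : (2 * p.natDegree : ℤ) < 2 * q.natDegree + 3 := by exact_mod_cast h
      nlinarith
  · have h' : 2 * q.natDegree + 3 < 2 * p.natDegree := by omega
    rw [max_eq_left h, v.ord_add_of_lt hp0 (mul_ne_zero hq0 hy0), hpo]
    · push_cast
      ring
    · rw [hqy, hpo]
      have : (2 * q.natDegree + 3 : ℤ) < 2 * p.natDegree := by exact_mod_cast h'
      nlinarith

/-- The elliptic curve has only one place at infinity: the places above infinity restrict to the
same valuation ring of its function field. -/
theorem mem_iff_mem_of_notMem {v w : Place k K} {ψ : W.CoordinateRing →ₐ[k] K}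
    (h₁ : W.a₁ = 0) (h₃ : W.a₃ = 0) (hψ : Function.Injective ψ)
    (hv : ∃ r, ψ r ∉ v.ring) (hw : ∃ r, ψ r ∉ w.ring) (a b : W.CoordinateRing) :
    ψ a / ψ b ∈ v.ring ↔ ψ a / ψ b ∈ w.ring := by
  by_cases ha : a = 0
  · simp [ha, zero_mem]
  by_cases hb : b = 0
  · simp [hb, zero_mem]
  have ha' : ψ a ≠ 0 := (map_ne_zero_iff _ hψ).2 ha
  have hb' : ψ b ≠ 0 := (map_ne_zero_iff _ hψ).2 hb
  have key : ∀ v : Place k K, (∃ r, ψ r ∉ v.ring) → (ψ a / ψ b ∈ v.ring ↔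
      (Algebra.norm k[X] a).natDegree ≤ (Algebra.norm k[X] b).natDegree) := by
    intro v hv
    have hx := v.notMem_of_exists_notMem ψ hv
    have h1 := v.two_mul_ord_eq h₁ h₃ hx ha
    have h2 := v.two_mul_ord_eq h₁ h₃ hx hb
    have hx0 := ne_zero_of_notMem hx
    rw [v.mem_ring_iff hx0, not_le] at hx
    rw [div_eq_mul_inv, v.mem_ring_iff (mul_ne_zero ha' (inv_ne_zero hb')),
      v.ord_mul ha' (inv_ne_zero hb'), v.ord_inv hb', ← Nat.cast_le (α := ℤ)]
    constructor <;> intro h <;> nlinarith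
  rw [key v hv, key w hw]

/-- If an involution of a curve has an elliptic curve with only torsion points as its quotient, the
divisors `v + σ v` are, up to torsion and principal divisors, multiples of one divisor. -/
theorem exists_divisor_of_quotient_elliptic [CharZero k] [DecidableEq k]
    (hK : IsCurveFunctionField k K) [Nonempty (Place k K)] [W.IsElliptic]
    (h₁ : W.a₁ = 0) (h₃ : W.a₃ = 0) (hsq : Squarefree W.cubic)
    (htors : ∀ P : W.Point, IsOfFinAddOrder P) {σ : K ≃ₐ[k] K} (hσ : ∀ x, σ (σ x) = x)
    (φ : W.FunctionField →ₐ[k] K) (hφ : ∀ f, f ∈ φ.range ↔ σ f = f) :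
    ∃ D₀ : CurveDivisor k K, 0 < divisorDegree k K D₀ ∧
      ∀ v : Place k K, ∃ m : ℕ, 0 < m ∧ ∃ b : ℤ,
      m • (Finsupp.single v 1 + Finsupp.single (v.conj σ) 1) - b • D₀ ∈ principalDivisors k K := by
  have := isDedekindDomain h₁ h₃ two_ne_zero hsq
  let ψ : W.CoordinateRing →ₐ[k] K :=
    φ.comp (IsScalarTower.toAlgHom k W.CoordinateRing W.FunctionField)
  have hψ : Function.Injective ψ :=
    φ.toRingHom.injective.comp (IsFractionRing.injective W.CoordinateRing W.FunctionField)
  have hrange : ∀ x, σ x = x → ∃ a b, b ≠ 0 ∧ x = ψ a / ψ b := by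
    intro x hx
    obtain ⟨f, rfl⟩ := (hφ x).2 hx
    obtain ⟨a, b, hb, rfl⟩ := IsFractionRing.div_surjective (A := W.CoordinateRing) f
    exact ⟨a, b, nonZeroDivisors.ne_zero hb, map_div₀ φ _ _⟩
  refine exists_divisor_of_isOfFinOrder hσ hψ (fun r => (hφ _).1 ⟨_, rfl⟩) hrange hK
    (isOfFinOrder_classGroup htors) fun v w hv hw x hx => ?_
  obtain ⟨a, b, -, rfl⟩ := hrange x hx
  exact mem_iff_mem_of_notMem h₁ h₃ hψ hv hw a b

/-- On divisor classes, `2 = (1 + σ) + (1 + τ) + (1 + στ) - (1 + σ)(1 + τ)` for commuting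
involutions `σ`, `τ`, here `σ 0` and `σ 1`. The hypothesis makes each summand on the right torsion on
classes of degree zero, so these classes are torsion. -/
theorem rank_picZero_eq_zero [CharZero k] (hK : IsCurveFunctionField k K)
    (σ : Fin 3 → K ≃ₐ[k] K) (h12 : ∀ x, σ 2 x = σ 1 (σ 0 x))
    (h : ∀ i, ∃ D₀ : CurveDivisor k K, 0 < divisorDegree k K D₀ ∧
      ∀ v : Place k K, ∃ m : ℕ, 0 < m ∧ ∃ b : ℤ,
      m • (Finsupp.single v 1 + Finsupp.single (v.conj (σ i)) 1) - b • D₀ ∈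
        principalDivisors k K) :
    Module.rank ℤ (PicZero k K) = 0 := by
  rw [Module.rank_eq_zero_iff_isTorsion]
  intro c
  obtain ⟨⟨D, hD⟩, rfl⟩ := QuotientAddGroup.mk_surjective c
  have hD' : divisorDegree k K D = 0 := hD
  have key : ∀ i {D : CurveDivisor k K}, divisorDegree k K D = 0 →
      ∃ m : ℕ, 0 < m ∧ m • (D + conjDivisor (σ i) D) ∈ principalDivisors k K := fun i D hD => by
    obtain ⟨D₀, h₀, h⟩ := h i
    exact exists_nsmul_add_conjDivisor_mem hK (σ i) h₀ h hD
  have hcomp : ∀ D : CurveDivisor k K,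
      conjDivisor (σ 2) D = conjDivisor (σ 0) (conjDivisor (σ 1) D) := by
    intro D
    induction D using Finsupp.induction_linear with
    | zero => simp
    | add D D' h h' => simp only [map_add, h, h']
    | single v n =>
      rw [conjDivisor_single, conjDivisor_single, conjDivisor_single]
      congr 1
      apply ext_ring
      ext x
      simp [mem_conj, h12]
  obtain ⟨m₀, hm₀, h0⟩ := key 0 hD'
  obtain ⟨m₁, hm₁, h1⟩ := key 1 hD'
  obtain ⟨m₂, hm₂, h2⟩ := key 2 hD'
  obtain ⟨m₃, hm₃, h3⟩ := key 0 (D := D + conjDivisor (σ 1) D)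
    (by rw [map_add, divisorDegree_conjDivisor, hD', add_zero])
  have hM : 0 < 2 * (m₀ * m₁ * m₂ * m₃) := by positivity
  refine ⟨⟨(2 * (m₀ * m₁ * m₂ * m₃) : ℕ), mem_nonZeroDivisors_of_ne_zero (by exact_mod_cast hM.ne')⟩, ?_⟩
  have hmem : (2 * (m₀ * m₁ * m₂ * m₃)) • D ∈ principalDivisors k K := by
    have := sub_mem (add_mem (add_mem (AddSubgroup.nsmul_mem _ h0 (m₁ * m₂ * m₃))
      (AddSubgroup.nsmul_mem _ h1 (m₀ * m₂ * m₃))) (AddSubgroup.nsmul_mem _ h2 (m₀ * m₁ * m₃)))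
      (AddSubgroup.nsmul_mem _ h3 (m₀ * m₁ * m₂))
    convert this using 1
    rw [map_add, hcomp]
    module
  have h0 : (2 * (m₀ * m₁ * m₂ * m₃)) • (QuotientAddGroup.mk ⟨D, hD⟩ : PicZero k K) = 0 :=
    (QuotientAddGroup.eq_zero_iff ((2 * (m₀ * m₁ * m₂ * m₃)) •
      (⟨D, hD⟩ : (divisorDegree k K).ker))).2 hmem
  rw [Submonoid.mk_smul, natCast_zsmul, h0]

end Place

/-! ### Generators of function fields -/

section FieldTheory

open IntermediateField

variable {k K : Type} [Field k] [Field K] [Algebra k K]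

/-- A finite extension of a rational function field in one variable is finite over every
rational function subfield. -/
theorem isCurveFunctionField_of_finiteDimensional {x : K} (hx : Transcendental k x)
    [FiniteDimensional k⟮x⟯ K] : IsCurveFunctionField k K := by
  intro y hy
  have halg : IsAlgebraic k⟮y⟯ x :=
    isAlgebraic_adjoin_iff.mpr (.adjoin_singleton (A := K) (B := K) hx hy
      (isAlgebraic_adjoin_iff.mp (Algebra.IsAlgebraic.isAlgebraic y)))
  let Fyx := restrictScalars k k⟮y⟯⟮x⟯
  let Fxy := restrictScalars k k⟮x⟯⟮y⟯
  let : Algebra k⟮y⟯ Fyx := k⟮y⟯⟮x⟯.algebra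
  let : Module k⟮y⟯ Fyx := Algebra.toModule
  let : SMul k⟮y⟯ Fyx := Algebra.toSMul
  let : Algebra k⟮x⟯ Fxy := k⟮x⟯⟮y⟯.algebra
  let : Module k⟮x⟯ Fxy := Algebra.toModule
  let : SMul k⟮x⟯ Fxy := Algebra.toSMul
  have : FiniteDimensional k⟮y⟯ Fyx :=
    adjoin.finiteDimensional (isAlgebraic_iff_isIntegral.mp halg)
  have : FiniteDimensional Fyx K := by
    unfold Fyx
    rw [adjoin_simple_comm]
    have : IsScalarTower k⟮x⟯ Fxy K := isScalarTower_mid' k⟮x⟯⟮y⟯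
    exact .right k⟮x⟯ Fxy K
  have : IsScalarTower k⟮y⟯ Fyx K := isScalarTower_mid' k⟮y⟯⟮x⟯
  exact .trans k⟮y⟯ Fyx K

theorem finiteDimensional_of_adjoin_pair_eq_top {x y : K} (h : adjoin k {x, y} = ⊤)
    (hy : IsAlgebraic k⟮x⟯ y) : FiniteDimensional k⟮x⟯ K := by
  have h1 : k⟮x⟯⟮y⟯ = ⊤ := by
    apply restrictScalars_injective k
    rw [adjoin_simple_adjoin_simple, h, restrictScalars_top]
  have := adjoin.finiteDimensional (isAlgebraic_iff_isIntegral.mp hy)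
  rw [h1] at this
  exact Module.Finite.equiv (topEquiv (F := k⟮x⟯) (E := K)).toLinearEquiv

theorem isAlgebraic_of_adjoin_eq_top {S : Set K} (h : adjoin k S = ⊤)
    (hS : ∀ x ∈ S, IsAlgebraic k x) (t : K) : IsAlgebraic k t := by
  have := isAlgebraic_adjoin (S := S) fun x hx => (hS x hx).isIntegral
  rw [h] at this
  have h2 := this.isAlgebraic ⟨t, trivial⟩
  rwa [isAlgebraic_iff] at h2

theorem algEquiv_ext_of_adjoin_eq_top {S : Set K} (h : adjoin k S = ⊤) {σ τ : K →ₐ[k] K}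
    (hS : ∀ x ∈ S, σ x = τ x) (t : K) : σ t = τ t := by
  have ht : t ∈ adjoin k S := h ▸ mem_top
  induction ht using adjoin_induction with
  | mem x hx => exact hS x hx
  | algebraMap x => rw [σ.commutes, τ.commutes]
  | add x y _ _ h1 h2 => rw [map_add, map_add, h1, h2]
  | inv x _ h1 => rw [map_inv₀, map_inv₀, h1]
  | mul x y _ _ h1 h2 => rw [map_mul, map_mul, h1, h2]

/-- If `K` is generated over `M` by a square root `s` and `σ` fixes `M` and negates `s`, then `M`
is the fixed field of `σ`. -/
theorem mem_of_apply_eq_self [NeZero (2 : k)] {σ : K →ₐ[k] K} {S : Set K} {s : K}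
    (hS : ∀ x ∈ S, σ x = x) (hs : σ s = -s) (hs0 : s ≠ 0) (hsq : s ^ 2 ∈ adjoin k S)
    (htop : adjoin k (insert s S) = ⊤) {f : K} (hf : σ f = f) : f ∈ adjoin k S := by
  have h2 : (2 : K) ≠ 0 := by
    rw [← map_ofNat (algebraMap k K) 2]
    exact (map_ne_zero _).2 (NeZero.ne (2 : k))
  have hfix : ∀ x ∈ adjoin k S, σ x = x := by
    intro x hx
    induction hx using adjoin_induction with
    | mem x hx => exact hS x hx
    | algebraMap x => rw [σ.commutes]
    | add x y _ _ h1 h2 => rw [map_add, h1, h2]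
    | inv x _ h1 => rw [map_inv₀, h1]
    | mul x y _ _ h1 h2 => rw [map_mul, h1, h2]
  have hsM : s ∉ adjoin k S := by
    intro h
    have h3 := hfix s h
    rw [hs] at h3
    exact (mul_ne_zero h2 hs0) (by linear_combination -h3)
  have key : ∀ g ∈ adjoin k (insert s S), ∃ a ∈ adjoin k S, ∃ b ∈ adjoin k S, g = a + b * s := by
    intro g hg
    induction hg using adjoin_induction with
    | mem x hx =>
      rcases hx with rfl | hx
      · exact ⟨0, zero_mem _, 1, one_mem _, by ring⟩
      · exact ⟨x, subset_adjoin _ _ hx, 0, zero_mem _, by ring⟩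
    | algebraMap x => exact ⟨_, IntermediateField.algebraMap_mem _ x, 0, zero_mem _, by ring⟩
    | add x y _ _ h1 h2 =>
      obtain ⟨a, ha, b, hb, rfl⟩ := h1
      obtain ⟨c, hc, d, hd, rfl⟩ := h2
      exact ⟨a + c, add_mem ha hc, b + d, add_mem hb hd, by ring⟩
    | inv x _ h1 =>
      obtain ⟨a, ha, b, hb, rfl⟩ := h1
      have hN : a ^ 2 - b ^ 2 * s ^ 2 ∈ adjoin k S :=
        sub_mem (pow_mem ha 2) (mul_mem (pow_mem hb 2) hsq)
      by_cases hb0 : b = 0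
      · exact ⟨a⁻¹, inv_mem ha, 0, zero_mem _, by simp [hb0]⟩
      have h3 : ∀ c ∈ adjoin k S, c + b * s ≠ 0 := by
        intro c hc h0
        apply hsM
        have : s = -c / b := by field_simp; linear_combination h0
        rw [this]
        exact div_mem (neg_mem hc) hb
      have h4 : a - b * s ≠ 0 := by
        intro h0
        exact h3 (-a) (neg_mem ha) (by linear_combination -h0)
      have h5 := h3 a ha
      have hN0 : a ^ 2 - b ^ 2 * s ^ 2 ≠ 0 := by
        have := mul_ne_zero h5 h4
        rwa [show (a + b * s) * (a - b * s) = a ^ 2 - b ^ 2 * s ^ 2 by ring] at this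
      refine ⟨a / (a ^ 2 - b ^ 2 * s ^ 2), div_mem ha hN, -b / (a ^ 2 - b ^ 2 * s ^ 2),
        div_mem (neg_mem hb) hN, ?_⟩
      field_simp
      ring
    | mul x y _ _ h1 h2 =>
      obtain ⟨a, ha, b, hb, rfl⟩ := h1
      obtain ⟨c, hc, d, hd, rfl⟩ := h2
      exact ⟨a * c + b * d * s ^ 2, add_mem (mul_mem ha hc) (mul_mem (mul_mem hb hd) hsq),
        a * d + b * c, add_mem (mul_mem ha hd) (mul_mem hb hc), by ring⟩
  obtain ⟨a, ha, b, hb, rfl⟩ := key f (htop ▸ mem_top)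
  rw [map_add, map_mul, hfix a ha, hfix b hb, hs] at hf
  have : b * s = 0 := by
    have h3 : 2 * (b * s) = 0 := by linear_combination -hf
    exact (mul_eq_zero.1 h3).resolve_left h2
  rw [this, add_zero]
  exact ha

end FieldTheory

namespace WeierstrassCurve.Affine

open Polynomial IntermediateField

variable {k K : Type} [Field k] [Field K] [Algebra k K]

/-- A point of a Weierstrass curve with coordinates in a field `K`, not both algebraic, defines an
embedding of the function field of the curve in `K`. -/
theorem exists_functionField_algHom (W : WeierstrassCurve.Affine k) {x y : K}
    (h : (W.map (algebraMap k K)).toAffine.Equation x y)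
    (hxy : ¬ (IsAlgebraic k x ∧ IsAlgebraic k y)) :
    ∃ φ : W.FunctionField →ₐ[k] K,
      φ (algebraMap W.CoordinateRing W.FunctionField (CoordinateRing.mk W (C X))) = x ∧
      φ (algebraMap W.CoordinateRing W.FunctionField (CoordinateRing.mk W X)) = y ∧
      φ.fieldRange = adjoin k {x, y} := by
  have heval : W.polynomial.eval₂ (aeval x : k[X] →ₐ[k] K) y = 0 := by
    rw [equation_iff] at h
    simp only [map_a₁, map_a₂, map_a₃, map_a₄, map_a₆] at h
    simp only [WeierstrassCurve.Affine.polynomial, eval₂_sub, eval₂_add, eval₂_mul, eval₂_pow,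
      eval₂_C, eval₂_X]
    simp only [RingHom.coe_coe, map_add, map_mul, map_pow, aeval_X, aeval_C]
    linear_combination h
  let ψ : W.CoordinateRing →ₐ[k] K := AdjoinRoot.liftAlgHom W.polynomial (aeval x) y heval
  have hψx : ψ (CoordinateRing.mk W (C X)) = x := by
    change ψ (AdjoinRoot.of _ X) = x
    simp [ψ]
  have hψy : ψ (CoordinateRing.mk W X) = y := AdjoinRoot.liftAlgHom_root _ _ _ _
  have hψ : Function.Injective ψ := by
    rw [injective_iff_map_eq_zero]
    by_contra! h0
    obtain ⟨r, hr, hr0⟩ := h0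
    have hker : RingHom.ker ψ ≠ ⊥ := fun h => hr0 (by rwa [← Ideal.mem_bot, ← h])
    have := CoordinateRing.finiteDimensional_quotient hker
    have halg : ∀ s, IsAlgebraic k (ψ s) := by
      intro s
      have := (Algebra.IsAlgebraic.isAlgebraic (R := k) (Ideal.Quotient.mk (RingHom.ker ψ) s)).algHom
        (Ideal.kerLiftAlg ψ)
      exact this
    exact hxy ⟨hψx ▸ halg _, hψy ▸ halg _⟩
  refine ⟨IsFractionRing.liftAlgHom hψ, ?_, ?_, le_antisymm ?_ ?_⟩
  · rw [IsFractionRing.liftAlgHom_apply, IsFractionRing.lift_algebraMap]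
    exact hψx
  · rw [IsFractionRing.liftAlgHom_apply, IsFractionRing.lift_algebraMap]
    exact hψy
  · have hmem : ∀ r, ψ r ∈ adjoin k {x, y} := by
      intro r
      obtain ⟨p, q, rfl⟩ := CoordinateRing.exists_smul_basis_eq r
      have hp : ∀ p : k[X], ψ (algebraMap k[X] W.CoordinateRing p) ∈ adjoin k {x, y} := by
        intro p
        change ψ (AdjoinRoot.of _ p) ∈ _
        have : ψ (AdjoinRoot.of _ p) = aeval x p := by simp [ψ]
        rw [this]
        exact Algebra.adjoin_le (S := (adjoin k {x, y}).toSubalgebra)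
          (by simpa using subset_adjoin k {x, y} (by simp)) (aeval_mem_adjoin_singleton k x)
      rw [map_add, Algebra.smul_def, Algebra.smul_def, mul_one, map_mul, hψy]
      exact add_mem (hp p) (mul_mem (hp q) (subset_adjoin k {x, y} (by simp)))
    rintro _ ⟨f, rfl⟩
    obtain ⟨a, b, -, rfl⟩ := IsFractionRing.div_surjective (A := W.CoordinateRing) f
    change IsFractionRing.liftAlgHom hψ (_ / _) ∈ _
    rw [map_div₀, IsFractionRing.liftAlgHom_apply, IsFractionRing.lift_algebraMap,
      IsFractionRing.liftAlgHom_apply, IsFractionRing.lift_algebraMap]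
    exact div_mem (hmem a) (hmem b)
  · rw [adjoin_le_iff]
    rintro _ (rfl | rfl)
    · refine ⟨algebraMap W.CoordinateRing W.FunctionField (CoordinateRing.mk W (C X)), ?_⟩
      change IsFractionRing.liftAlgHom hψ _ = _
      rw [IsFractionRing.liftAlgHom_apply, IsFractionRing.lift_algebraMap]
      exact hψx
    · refine ⟨algebraMap W.CoordinateRing W.FunctionField (CoordinateRing.mk W X), ?_⟩
      change IsFractionRing.liftAlgHom hψ _ = _
      rw [IsFractionRing.liftAlgHom_apply, IsFractionRing.lift_algebraMap]
      exact hψy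

/-- Functions `x`, `y` that satisfy a Weierstrass equation and generate a field identify it with the
function field of the Weierstrass curve. -/
theorem exists_functionField_algEquiv (W : WeierstrassCurve.Affine k) {x y t : K}
    (h : (W.map (algebraMap k K)).toAffine.Equation x y) (htop : adjoin k {x, y} = ⊤)
    (ht : Transcendental k t) :
    ∃ e : W.FunctionField ≃ₐ[k] K,
      e (algebraMap W.CoordinateRing W.FunctionField (CoordinateRing.mk W (C X))) = x ∧
      e (algebraMap W.CoordinateRing W.FunctionField (CoordinateRing.mk W X)) = y := by
  obtain ⟨φ, hx, hy, hφ⟩ := exists_functionField_algHom W h fun h =>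
    ht (isAlgebraic_of_adjoin_eq_top htop (by simpa using h) t)
  refine ⟨AlgEquiv.ofBijective φ ⟨φ.toRingHom.injective, fun z => ?_⟩, hx, hy⟩
  have hz : z ∈ φ.fieldRange := by rw [hφ, htop]; exact mem_top
  exact hz

/-- If an involution of a function field fixes functions `x`, `y` that satisfy a Weierstrass
equation, and negates `s`, where `s²` is a rational function of `x` and `y`, and `x`, `y`, `s`
generate the field, then the fixed field is the function field of the Weierstrass curve. -/
theorem exists_functionField_algHom_range_eq_fixed [NeZero (2 : k)] (W : WeierstrassCurve.Affine k)
    {x y s t : K} (h : (W.map (algebraMap k K)).toAffine.Equation x y)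
    (htop : adjoin k {s, x, y} = ⊤) (ht : Transcendental k t) {σ : K ≃ₐ[k] K}
    (hx : σ x = x) (hy : σ y = y) (hs : σ s = -s) (hs0 : s ≠ 0) (hsq : s ^ 2 ∈ adjoin k {x, y}) :
    ∃ φ : W.FunctionField →ₐ[k] K, ∀ f, f ∈ φ.range ↔ σ f = f := by
  have hS : ∀ z ∈ ({x, y} : Set K), (σ : K →ₐ[k] K) z = z := by
    rintro z (rfl | rfl)
    · exact hx
    · exact hy
  obtain ⟨φ, -, -, hφ⟩ := exists_functionField_algHom W h fun h => by
    apply ht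
    have h2 : IsAlgebraic k s := by
      have h3 : IsAlgebraic k (s ^ 2) := by
        have := isAlgebraic_adjoin (K := k) (S := {x, y}) fun z hz => by
          rcases hz with rfl | rfl
          · exact h.1.isIntegral
          · exact h.2.isIntegral
        have h4 := this.isAlgebraic ⟨s ^ 2, hsq⟩
        rwa [isAlgebraic_iff] at h4
      exact IsAlgebraic.of_pow two_pos h3
    refine isAlgebraic_of_adjoin_eq_top htop ?_ t
    rintro z (rfl | rfl | rfl)
    exacts [h2, h.1, h.2]
  have hrange : ∀ f, f ∈ φ.range ↔ f ∈ adjoin k {x, y} := fun f => by rw [← hφ]; rfl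
  refine ⟨φ, fun f => ?_⟩
  rw [hrange]
  refine ⟨fun hf => ?_, fun hf => mem_of_apply_eq_self (σ := (σ : K →ₐ[k] K)) hS hs hs0 hsq htop hf⟩
  induction hf using adjoin_induction with
  | mem x hx => exact hS x hx
  | algebraMap x => rw [σ.commutes]
  | add x y _ _ h1 h2 => rw [map_add, h1, h2]
  | inv x _ h1 => rw [map_inv₀, h1]
  | mul x y _ _ h1 h2 => rw [map_mul, h1, h2]

end WeierstrassCurve.Affine

/-! ### Irreducibility of quadratic and biquadratic polynomials -/

namespace Polynomial

variable {A : Type} [CommRing A] [IsDomain A]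

/-- A quadratic polynomial with nonsquare discriminant is irreducible when its coefficients have no
common factor. -/
theorem irreducible_quadratic {a b c : A} (ha : a ≠ 0) (hac : IsCoprime a c)
    (hd : ¬ IsSquare (b ^ 2 - 4 * a * c)) : Irreducible (C a * X ^ 2 + C b * X + C c) := by
  set f := C a * X ^ 2 + C b * X + C c with hf
  have hdeg : f.natDegree = 2 := natDegree_quadratic ha
  have hf0 : f ≠ 0 := by
    intro h
    rw [h] at hdeg
    simp at hdeg
  have h2 : f.coeff 2 = a := by simp [hf]
  have h1 : f.coeff 1 = b := by simp [hf]
  have h0 : f.coeff 0 = c := by simp [hf]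
  have hconst : ∀ g h, f = g * h → g.natDegree = 0 → IsUnit g := by
    intro g h e hg
    obtain ⟨d, rfl⟩ : ∃ d, g = C d := ⟨_, eq_C_of_natDegree_eq_zero hg⟩
    rw [isUnit_C]
    refine hac.isUnit_of_dvd' ?_ ?_
    · exact ⟨h.coeff 2, by rw [← h2, e, coeff_C_mul]⟩
    · exact ⟨h.coeff 0, by rw [← h0, e, coeff_C_mul]⟩
  refine ⟨fun hu => ?_, fun g h e => ?_⟩
  · have := natDegree_eq_zero_of_isUnit hu
    omega
  have hg0 : g ≠ 0 := by rintro rfl; simp at e; exact hf0 e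
  have hh0 : h ≠ 0 := by rintro rfl; simp at e; exact hf0 e
  have hadd : g.natDegree + h.natDegree = 2 := by rw [← natDegree_mul hg0 hh0, ← e, hdeg]
  by_cases hg : g.natDegree = 0
  · exact Or.inl (hconst g h e hg)
  by_cases hh : h.natDegree = 0
  · exact Or.inr (hconst h g (by rw [e, mul_comm]) hh)
  exfalso
  obtain ⟨p, q, rfl⟩ := exists_eq_X_add_C_of_natDegree_le_one (p := g) (by omega)
  obtain ⟨r, s, rfl⟩ := exists_eq_X_add_C_of_natDegree_le_one (p := h) (by omega)
  have e' : f = C (p * r) * X ^ 2 + C (p * s + q * r) * X + C (q * s) := by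
    rw [e]
    simp only [C_mul, C_add]
    ring
  rw [e'] at h0 h1 h2
  simp only [coeff_add, coeff_C_mul, coeff_X_pow, coeff_C, coeff_X] at h0 h1 h2
  norm_num at h0 h1 h2
  exact hd ⟨p * s - q * r, by rw [← h0, ← h1, ← h2]; ring⟩

/-- A biquadratic polynomial with unit leading coefficient that is reducible is a product of two
quadratic polynomials, of the form `g(X) g(-X)` or in `X²`. -/
theorem irreducible_biquadratic {a b c : A} (ha : IsUnit a) (hac : ¬ IsSquare (a * c))
    (hd : ¬ IsSquare (b ^ 2 - 4 * a * c)) : Irreducible (C a * X ^ 4 + C b * X ^ 2 + C c) := by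
  set f := C a * X ^ 4 + C b * X ^ 2 + C c with hf
  have ha0 : a ≠ 0 := ha.ne_zero
  have hdeg : f.natDegree = 4 := by rw [hf]; compute_degree!
  have hf0 : f ≠ 0 := by
    intro h
    rw [h] at hdeg
    simp at hdeg
  have hlead : f.leadingCoeff = a := by
    rw [leadingCoeff, hdeg, hf]
    simp
  have hunit : ∀ g h, f = g * h → IsUnit g.leadingCoeff := by
    intro g h e
    rw [e, leadingCoeff_mul] at hlead
    exact isUnit_of_mul_isUnit_left (hlead ▸ ha)
  have hconst : ∀ g h, f = g * h → g.natDegree = 0 → IsUnit g := by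
    intro g h e hg
    have hu := hunit g h e
    rw [eq_C_of_natDegree_eq_zero hg] at hu ⊢
    rw [leadingCoeff_C] at hu
    exact isUnit_C.2 hu
  have hlin : ∀ g h, f = g * h → g.natDegree ≠ 1 := by
    intro g h e hg
    have hu := hunit g h e
    obtain ⟨p, q, rfl⟩ := exists_eq_X_add_C_of_natDegree_le_one hg.le
    rw [leadingCoeff, hg] at hu
    obtain ⟨u, hu⟩ : ∃ u, p * u = 1 := by
      rw [coeff_add, coeff_C_mul_X, coeff_C] at hu
      simpa using hu.exists_right_inv
    have hev : f.eval (-q * u) = 0 := by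
      have : (C p * X + C q).eval (-q * u) = 0 := by
        simp only [eval_add, eval_mul, eval_C, eval_X]
        linear_combination (-q) * hu
      rw [e, eval_mul, this, zero_mul]
    rw [hf] at hev
    simp only [eval_add, eval_mul, eval_C, eval_pow, eval_X] at hev
    set ρ := -q * u
    exact hd ⟨2 * a * ρ ^ 2 + b, by linear_combination -(4 * a) * hev⟩
  refine ⟨fun hu => ?_, fun g h e => ?_⟩
  · have := natDegree_eq_zero_of_isUnit hu
    omega
  have hg0 : g ≠ 0 := by rintro rfl; simp at e; exact hf0 e
  have hh0 : h ≠ 0 := by rintro rfl; simp at e; exact hf0 e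
  have e₂ : f = h * g := by rw [e, mul_comm]
  have hadd : g.natDegree + h.natDegree = 4 := by rw [← natDegree_mul hg0 hh0, ← e, hdeg]
  by_cases hg : g.natDegree = 0
  · exact Or.inl (hconst g h e hg)
  by_cases hh : h.natDegree = 0
  · exact Or.inr (hconst h g e₂ hh)
  exfalso
  have hg1 := hlin g h e
  have hh1 := hlin h g e₂
  have quad : ∀ g : A[X], g.natDegree = 2 →
      ∃ p q r, g = C p * X ^ 2 + C q * X + C r := fun g hg =>
    ⟨_, _, _, eq_quadratic_of_degree_le_two (natDegree_le_iff_degree_le.1 hg.le)⟩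
  obtain ⟨p, q, r, rfl⟩ := quad g (by omega)
  obtain ⟨p', q', r', rfl⟩ := quad h (by omega)
  have e' : f = C (p * p') * X ^ 4 + C (p * q' + q * p') * X ^ 3 +
      C (p * r' + q * q' + r * p') * X ^ 2 + C (q * r' + r * q') * X + C (r * r') := by
    rw [e]
    simp only [C_mul, C_add]
    ring
  have hc : ∀ n, (C a * X ^ 4 + C b * X ^ 2 + C c : A[X]).coeff n =
      (C (p * p') * X ^ 4 + C (p * q' + q * p') * X ^ 3 +
      C (p * r' + q * q' + r * p') * X ^ 2 + C (q * r' + r * q') * X + C (r * r')).coeff n :=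
    fun n => by rw [← e', hf]
  have h4 := hc 4
  have h3 := hc 3
  have h2 := hc 2
  have h1 := hc 1
  have h0 := hc 0
  simp only [coeff_add, coeff_C_mul, coeff_X_pow, coeff_C, coeff_X] at h0 h1 h2 h3 h4
  norm_num at h0 h1 h2 h3 h4
  have hp : p ≠ 0 := by rintro rfl; simp at h4; exact ha0 h4
  have hp' : p' ≠ 0 := by rintro rfl; simp at h4; exact ha0 h4
  have key : q * (p * r' - r * p') = 0 := by linear_combination (-p) * h1 + r * h3
  rcases mul_eq_zero.1 key with hq | hr
  · have hq' : q' = 0 := by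
      have : p * q' = 0 := by rw [hq] at h3; linear_combination -h3
      exact (mul_eq_zero.1 this).resolve_left hp
    refine hd ⟨p * r' - r * p', ?_⟩
    rw [h4, h2, h0, hq, hq']
    ring
  · refine hac ⟨p * r', ?_⟩
    rw [h4, h0]
    linear_combination (-(p * r')) * hr

end Polynomial

/-! ### Function fields of plane curves -/

namespace PlaneCurve

open MvPolynomial

variable {k : Type} [Field k]

theorem isDomain_coordRing (F : MvPolynomial (Fin 3) k)
    (e : MvPolynomial (Fin 2) k ≃ₐ[k] Polynomial (Polynomial k))
    (hF : Irreducible (e (dehomog F))) : IsDomain (CoordRing F) := by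
  have h1 : Irreducible (dehomog F) := (MulEquiv.irreducible_iff e).1 hF
  have h2 : (Ideal.span {dehomog F}).IsPrime :=
    (Ideal.span_singleton_prime h1.ne_zero).2 h1.prime
  exact Ideal.Quotient.isDomain _

/-- The function on the curve given by a polynomial in the two affine coordinates. -/
def affineFun (F : MvPolynomial (Fin 3) k) : MvPolynomial (Fin 2) k →ₐ[k] FunctionField F :=
  (IsScalarTower.toAlgHom k (CoordRing F) (FunctionField F)).comp (Ideal.Quotient.mkₐ k _)

theorem affineFun_eq_zero_iff {F : MvPolynomial (Fin 3) k} {p : MvPolynomial (Fin 2) k} :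
    affineFun F p = 0 ↔ dehomog F ∣ p := by
  rw [← Ideal.mem_span_singleton, ← Ideal.Quotient.eq_zero_iff_mem]
  exact map_eq_zero_iff (algebraMap (CoordRing F) (FunctionField F))
    (IsFractionRing.injective (CoordRing F) (FunctionField F))

theorem coordFun_eq_affineFun (F G : MvPolynomial (Fin 3) k) :
    coordFun F G = affineFun F (dehomog G) := rfl

/-- If the equation of the curve involves the main variable of the polynomial ring `k[t][s]`, then no
nonzero polynomial in `t` vanishes on the curve. -/
theorem transcendental_affineFun (F : MvPolynomial (Fin 3) k)
    (e : MvPolynomial (Fin 2) k ≃ₐ[k] Polynomial (Polynomial k))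
    (hF : 0 < (e (dehomog F)).natDegree) :
    Transcendental k (affineFun F (e.symm (Polynomial.C Polynomial.X))) := by
  rw [transcendental_iff]
  intro p hp
  rw [Polynomial.aeval_algHom_apply, affineFun_eq_zero_iff, Polynomial.aeval_algHom_apply,
    ← map_dvd_iff e, AlgEquiv.apply_symm_apply] at hp
  by_contra h0
  have h1 : Polynomial.aeval (Polynomial.C Polynomial.X : Polynomial (Polynomial k)) p =
      Polynomial.C p := by
    have := Polynomial.aeval_algHom_apply
      ((Algebra.ofId (Polynomial k) (Polynomial (Polynomial k))).restrictScalars k) Polynomial.X p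
    rw [Polynomial.aeval_X_left_apply] at this
    exact this
  rw [h1] at hp
  have h2 := Polynomial.natDegree_le_of_dvd hp (by simpa using h0)
  rw [Polynomial.natDegree_C] at h2
  omega

theorem coordFun_self (F : MvPolynomial (Fin 3) k) : coordFun F F = 0 :=
  affineFun_eq_zero_iff.2 dvd_rfl

theorem coordFun_X_two (F : MvPolynomial (Fin 3) k) : coordFun F (X 2) = 1 := by
  have h : dehomog (X 2 : MvPolynomial (Fin 3) k) = 1 := aeval_X _ _
  rw [coordFun_eq_affineFun, h, map_one]

theorem coordFun_eq_aeval (F G : MvPolynomial (Fin 3) k) :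
    coordFun F G = aeval ![coordFun F (X 0), coordFun F (X 1), 1] G := by
  rw [coordFun_eq_affineFun]
  change (affineFun F).comp dehomog G = _
  congr 1
  ext i
  fin_cases i
  · simp [coordFun_eq_affineFun]
  · simp [coordFun_eq_affineFun]
  · simpa [coordFun_eq_affineFun] using coordFun_X_two F

variable (F : MvPolynomial (Fin 3) k) [IsDomain (CoordRing F)]

open IntermediateField in
theorem adjoin_coordFun_eq_top :
    adjoin k {coordFun F (X 0), coordFun F (X 1)} = ⊤ := by
  have key : ∀ p, affineFun F p ∈ adjoin k {coordFun F (X 0), coordFun F (X 1)} := by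
    intro p
    induction p using MvPolynomial.induction_on with
    | C a =>
      rw [← algebraMap_eq, AlgHom.commutes]
      exact IntermediateField.algebraMap_mem _ a
    | add p q hp hq => rw [map_add]; exact add_mem hp hq
    | mul_X p i hp =>
      rw [map_mul]
      refine mul_mem hp (subset_adjoin _ _ ?_)
      fin_cases i
      · left
        simp [coordFun_eq_affineFun, dehomog]
      · right
        simp [coordFun_eq_affineFun, dehomog]
  rw [eq_top_iff]
  intro f _
  obtain ⟨a, b, -, rfl⟩ := IsFractionRing.div_surjective (A := CoordRing F) f
  obtain ⟨a, rfl⟩ := Ideal.Quotient.mk_surjective a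
  obtain ⟨b, rfl⟩ := Ideal.Quotient.mk_surjective b
  exact div_mem (key a) (key b)

/-- A diagonal change of signs that preserves the equation of a plane curve acts on its function
field. -/
theorem exists_sign_algEquiv {s : Fin 3 → k} (hs : ∀ i, s i ^ 2 = 1)
    (hF : aeval ![C (s 0 / s 2) * X 0, C (s 1 / s 2) * X 1] (dehomog F) = dehomog F) :
    ∃ σ : FunctionField F ≃ₐ[k] FunctionField F,
      ∀ i j : Fin 3, σ (ratio F (X i) (X j)) = (s i / s j) • ratio F (X i) (X j) := by
  have hs0 : ∀ i, s i ≠ 0 := fun i h => by simpa [h] using hs i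
  have hs2 : ∀ i, (s i / s 2) * (s i / s 2) = 1 := fun i => by
    rw [div_mul_div_comm, ← sq, ← sq, hs, hs, div_one]
  let τ : MvPolynomial (Fin 2) k →ₐ[k] MvPolynomial (Fin 2) k :=
    aeval ![C (s 0 / s 2) * X 0, C (s 1 / s 2) * X 1]
  have hττ : τ.comp τ = AlgHom.id k _ := by
    ext1 i
    fin_cases i
    · simp only [τ, AlgHom.comp_apply, Fin.zero_eta, aeval_X, Matrix.cons_val_zero, map_mul, aeval_C,
        algebraMap_eq, ← mul_assoc, ← C_mul, hs2]
      simp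
    · simp only [τ, AlgHom.comp_apply, Fin.mk_one, aeval_X, Matrix.cons_val_one, map_mul,
        aeval_C, algebraMap_eq, ← mul_assoc, ← C_mul, hs2, Matrix.cons_val_fin_one]
      simp
  let T : MvPolynomial (Fin 2) k ≃ₐ[k] MvPolynomial (Fin 2) k := AlgEquiv.ofAlgHom τ τ hττ hττ
  let Q : CoordRing F ≃ₐ[k] CoordRing F := Ideal.quotientEquivAlg _ _ T (by
    rw [Ideal.map_span, Set.image_singleton]
    exact congrArg (fun x => Ideal.span {x}) hF.symm)
  let σ : FunctionField F ≃ₐ[k] FunctionField F := IsFractionRing.fieldEquivOfAlgEquiv k _ _ Q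
  have hσ : ∀ p, σ (affineFun F p) = affineFun F (τ p) := fun p =>
    IsFractionRing.fieldEquivOfAlgEquiv_algebraMap k _ _ Q _
  have hX : ∀ i, σ (coordFun F (X i)) = (s i / s 2) • coordFun F (X i) := by
    intro i
    fin_cases i
    · simp [coordFun_eq_affineFun, dehomog, hσ, τ, Algebra.smul_def, ← algebraMap_eq]
    · simp [coordFun_eq_affineFun, dehomog, hσ, τ, Algebra.smul_def, ← algebraMap_eq]
    · simp [coordFun_X_two, hs0]
  refine ⟨σ, fun i j => ?_⟩
  rw [ratio, map_div₀, hX, hX]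
  simp only [Algebra.smul_def, map_div₀]
  have : ∀ i, algebraMap k (FunctionField F) (s i) ≠ 0 := fun i => by simpa using hs0 i
  have h1 := this 2
  have h2 := this j
  field_simp

end PlaneCurve

/-! ### The four quartics are integral -/

section


open MvPolynomial (X)
open Polynomial (C)

/-- Bivariate polynomials as polynomials in the first variable. -/
def firstVarEquiv : MvPolynomial (Fin 2) ℚ ≃ₐ[ℚ] Polynomial (Polynomial ℚ) :=
  (Polynomial.Bivariate.equivMvPolynomial ℚ).symm.trans Polynomial.Bivariate.swap

theorem firstVarEquiv_X_zero : firstVarEquiv (X 0) = Polynomial.X := by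
  simp [firstVarEquiv, Polynomial.Bivariate.swap_X]

theorem firstVarEquiv_X_one : firstVarEquiv (X 1) = C Polynomial.X := by
  simp [firstVarEquiv, Polynomial.Bivariate.swap_Y]

theorem firstVarEquiv_symm_C_X : firstVarEquiv.symm (C Polynomial.X) = X 1 := by
  rw [AlgEquiv.symm_apply_eq, firstVarEquiv_X_one]

theorem ciani_eq : ciani = 15 * X 0 ^ 4 + 112 * X 1 ^ 4 + 112 * X 2 ^ 4 + 288 * X 1 ^ 2 * X 2 ^ 2
    - 88 * X 0 ^ 2 * X 2 ^ 2 - 88 * X 0 ^ 2 * X 1 ^ 2 := by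
  simp [ciani, cianiInt]

theorem PlaneCurve.dehomog_X (i : Fin 3) :
    PlaneCurve.dehomog (X i : MvPolynomial (Fin 3) ℚ) = ![X 0, X 1, 1] i :=
  MvPolynomial.aeval_X _ _

/-- A specialization certifies that a polynomial is not a square. -/
theorem not_isSquare_of_eval {p : Polynomial ℚ} (x : ℚ) (h : ¬ IsSquare (p.eval x)) :
    ¬ IsSquare p := fun hp => h (hp.map (Polynomial.evalRingHom x))

theorem firstVarEquiv_dehomog_ciani : firstVarEquiv (PlaneCurve.dehomog ciani) =
    C 15 * Polynomial.X ^ 4 + C (-88 * (Polynomial.X ^ 2 + 1)) * Polynomial.X ^ 2 +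
      C (112 * Polynomial.X ^ 4 + 288 * Polynomial.X ^ 2 + 112) := by
  rw [ciani_eq]
  simp only [map_add, map_sub, map_mul, map_pow, PlaneCurve.dehomog_X, map_ofNat, map_neg, map_one]
  simp only [Matrix.cons_val, firstVarEquiv_X_zero, firstVarEquiv_X_one, map_one]
  ring

theorem firstVarEquiv_dehomog_quarticE1 : firstVarEquiv (PlaneCurve.dehomog quarticE1) =
    C 112 * Polynomial.X ^ 4 + C (288 * Polynomial.X ^ 2 - 88 * Polynomial.X) * Polynomial.X ^ 2 +
      C (112 * Polynomial.X ^ 4 + 15 * Polynomial.X ^ 2 - 88 * Polynomial.X ^ 3) := by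
  rw [quarticE1]
  simp only [map_add, map_sub, map_mul, map_pow, PlaneCurve.dehomog_X, map_ofNat]
  simp only [Matrix.cons_val, firstVarEquiv_X_zero, firstVarEquiv_X_one, map_one]
  ring

theorem firstVarEquiv_dehomog_quarticE2 : firstVarEquiv (PlaneCurve.dehomog quarticE2) =
    C 15 * Polynomial.X ^ 2 + C (-88 * (Polynomial.X ^ 2 + 1)) * Polynomial.X +
      C (112 * Polynomial.X ^ 4 + 288 * Polynomial.X ^ 2 + 112) := by
  rw [quarticE2]
  simp only [map_add, map_sub, map_mul, map_pow, PlaneCurve.dehomog_X, map_ofNat, map_neg]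
  simp only [Matrix.cons_val, firstVarEquiv_X_zero, firstVarEquiv_X_one, map_one]
  ring

/-- The quartic `E₃` is quadratic in `Y`, the second variable. -/
theorem equivMvPolynomial_symm_dehomog_quarticE3 :
    (Polynomial.Bivariate.equivMvPolynomial ℚ).symm (PlaneCurve.dehomog quarticE3) =
    C (15 * Polynomial.X ^ 2) * Polynomial.X ^ 2 + C (-88 * (Polynomial.X ^ 3 + Polynomial.X)) * Polynomial.X +
      C (112 * Polynomial.X ^ 4 + 288 * Polynomial.X ^ 2 + 112) := by
  rw [quarticE3]
  simp only [map_add, map_sub, map_mul, map_pow, PlaneCurve.dehomog_X, map_ofNat, map_neg]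
  simp only [Matrix.cons_val, Polynomial.Bivariate.equivMvPolynomial_symm_X_0,
    Polynomial.Bivariate.equivMvPolynomial_symm_X_1, map_one]
  ring

theorem isUnit_ofNat_polynomial (n : ℕ) [n.AtLeastTwo] : IsUnit (OfNat.ofNat n : Polynomial ℚ) := by
  rw [← map_ofNat C n, Polynomial.isUnit_C]
  exact isUnit_iff_ne_zero.2 (OfNat.ofNat_ne_zero n)

instance isDomain_coordRing_ciani : IsDomain (PlaneCurve.CoordRing ciani) := by
  refine PlaneCurve.isDomain_coordRing _ firstVarEquiv ?_
  rw [firstVarEquiv_dehomog_ciani]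
  refine Polynomial.irreducible_biquadratic (isUnit_ofNat_polynomial 15)
    (not_isSquare_of_eval 0 ?_) (not_isSquare_of_eval 2 ?_)
  · simp
    norm_num
  · simp
    norm_num

instance isDomain_coordRing_quarticE1 : IsDomain (PlaneCurve.CoordRing quarticE1) := by
  refine PlaneCurve.isDomain_coordRing _ firstVarEquiv ?_
  rw [firstVarEquiv_dehomog_quarticE1]
  refine Polynomial.irreducible_biquadratic (isUnit_ofNat_polynomial 112)
    (not_isSquare_of_eval 1 ?_) (not_isSquare_of_eval 1 ?_)
  · simp
    norm_num
  · simp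
    norm_num

instance isDomain_coordRing_quarticE2 : IsDomain (PlaneCurve.CoordRing quarticE2) := by
  refine PlaneCurve.isDomain_coordRing _ firstVarEquiv ?_
  rw [firstVarEquiv_dehomog_quarticE2]
  obtain ⟨u, hu⟩ := (isUnit_ofNat_polynomial 15).exists_left_inv
  refine Polynomial.irreducible_quadratic (isUnit_ofNat_polynomial 15).ne_zero
    ⟨u, 0, by rw [hu, zero_mul, add_zero]⟩ (not_isSquare_of_eval 2 ?_)
  simp
  norm_num

instance isDomain_coordRing_quarticE3 : IsDomain (PlaneCurve.CoordRing quarticE3) := by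
  refine PlaneCurve.isDomain_coordRing _ (Polynomial.Bivariate.equivMvPolynomial ℚ).symm ?_
  rw [equivMvPolynomial_symm_dehomog_quarticE3]
  refine Polynomial.irreducible_quadratic
    (mul_ne_zero (isUnit_ofNat_polynomial 15).ne_zero (pow_ne_zero 2 Polynomial.X_ne_zero))
    ?_ (not_isSquare_of_eval 2 ?_)
  · refine ⟨-(C (1 / 15) * C (1 / 112)) * (112 * Polynomial.X ^ 2 + 288), C (1 / 112), ?_⟩
    have h1 : C (1 / 15) * 15 = (1 : Polynomial ℚ) := by
      rw [← map_ofNat C 15, ← Polynomial.C_mul]; norm_num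
    have h2 : C (1 / 112) * 112 = (1 : Polynomial ℚ) := by
      rw [← map_ofNat C 112, ← Polynomial.C_mul]; norm_num
    linear_combination (-(C (1 / 112)) * (112 * Polynomial.X ^ 2 + 288) * Polynomial.X ^ 2) * h1 + h2
  · simp
    norm_num

theorem transcendental_coordFun_one {F : MvPolynomial (Fin 3) ℚ}
    (h : 0 < (firstVarEquiv (PlaneCurve.dehomog F)).natDegree) :
    Transcendental ℚ (PlaneCurve.coordFun F (X 1)) := by
  have := PlaneCurve.transcendental_affineFun F firstVarEquiv h
  rwa [firstVarEquiv_symm_C_X, ← show PlaneCurve.dehomog (X 1 : MvPolynomial (Fin 3) ℚ) = X 1 from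
    PlaneCurve.dehomog_X 1, ← PlaneCurve.coordFun_eq_affineFun] at this

theorem transcendental_ciani : Transcendental ℚ (PlaneCurve.coordFun ciani (X 1)) := by
  apply transcendental_coordFun_one
  rw [firstVarEquiv_dehomog_ciani]
  have h := (isUnit_ofNat_polynomial 15).ne_zero
  have : (C 15 * Polynomial.X ^ 4 + C (-88 * (Polynomial.X ^ 2 + 1)) * Polynomial.X ^ 2 +
      C (112 * Polynomial.X ^ 4 + 288 * Polynomial.X ^ 2 + 112) : Polynomial (Polynomial ℚ)).natDegree = 4 := by
    compute_degree!
  omega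

theorem transcendental_quarticE1 : Transcendental ℚ (PlaneCurve.coordFun quarticE1 (X 1)) := by
  apply transcendental_coordFun_one
  rw [firstVarEquiv_dehomog_quarticE1]
  have h := (isUnit_ofNat_polynomial 112).ne_zero
  have : (C 112 * Polynomial.X ^ 4 + C (288 * Polynomial.X ^ 2 - 88 * Polynomial.X) * Polynomial.X ^ 2 +
      C (112 * Polynomial.X ^ 4 + 15 * Polynomial.X ^ 2 - 88 * Polynomial.X ^ 3) : Polynomial (Polynomial ℚ)).natDegree = 4 := by
    compute_degree!
  omega

theorem transcendental_quarticE2 : Transcendental ℚ (PlaneCurve.coordFun quarticE2 (X 1)) := by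
  apply transcendental_coordFun_one
  rw [firstVarEquiv_dehomog_quarticE2,
    Polynomial.natDegree_quadratic (isUnit_ofNat_polynomial 15).ne_zero]
  norm_num

theorem transcendental_quarticE3 : Transcendental ℚ (PlaneCurve.coordFun quarticE3 (X 0)) := by
  have := PlaneCurve.transcendental_affineFun quarticE3
    (Polynomial.Bivariate.equivMvPolynomial ℚ).symm (by
      rw [equivMvPolynomial_symm_dehomog_quarticE3, Polynomial.natDegree_quadratic
        (mul_ne_zero (isUnit_ofNat_polynomial 15).ne_zero (pow_ne_zero 2 Polynomial.X_ne_zero))]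
      norm_num)
  rwa [AlgEquiv.symm_symm, Polynomial.Bivariate.equivMvPolynomial_C_X,
    ← show PlaneCurve.dehomog (X 0 : MvPolynomial (Fin 3) ℚ) = X 0 from
    PlaneCurve.dehomog_X 0, ← PlaneCurve.coordFun_eq_affineFun] at this

end

/-! ### Maps to the elliptic curves -/

section


open MvPolynomial (X)
open Polynomial (C)
open IntermediateField WeierstrassCurve.Affine PlaneCurve

section Maps

variable {K : Type} [Field K] [Algebra ℚ K]

theorem adjoin_eq_top_of_mem {ξ η : K} {S : Set K} (htop : adjoin ℚ {ξ, η} = ⊤)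
    (hξ : ξ ∈ adjoin ℚ S) (hη : η ∈ adjoin ℚ S) : adjoin ℚ S = ⊤ := by
  rw [eq_top_iff, ← htop, adjoin_le_iff]
  rintro _ (rfl | rfl)
  exacts [hξ, hη]

/-- The quartic equation in `u = Y/Z` and `w = (X/Z)²` becomes that of `E` under
`x = (15w - 28u² - 58) / 8`, `y = 2ux`. -/
theorem curveE_equation {u w : K}
    (h : 15 * w ^ 2 - 88 * w - 88 * u ^ 2 * w + 112 * u ^ 4 + 112 + 288 * u ^ 2 = 0) :
    (curveE.map (algebraMap ℚ K)).toAffine.Equation ((15 * w - 28 * u ^ 2 - 58) / 8)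
      (2 * u * ((15 * w - 28 * u ^ 2 - 58) / 8)) := by
  have := algebraRat.charZero K
  rw [equation_iff]
  simp [curveE]
  linear_combination (-(15 * w - 28 * u ^ 2 - 58) / 8 * (15 / 64)) * h

theorem curveE_x_ne_zero {u w : K}
    (h : 15 * w ^ 2 - 88 * w - 88 * u ^ 2 * w + 112 * u ^ 4 + 112 + 288 * u ^ 2 = 0) :
    (15 * w - 28 * u ^ 2 - 58) / 8 ≠ 0 := by
  have := algebraRat.charZero K
  intro h0
  have h1 : (4 : K) = 0 := by
    linear_combination (w - 4 * u ^ 2 - 2) * 8 * h0 - h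
  norm_num at h1

/-- The functions `u` and `w` are recovered from `x` and `y` through `u = y / (2x)`. -/
theorem mem_adjoin_curveE {u w : K}
    (h : 15 * w ^ 2 - 88 * w - 88 * u ^ 2 * w + 112 * u ^ 4 + 112 + 288 * u ^ 2 = 0) :
    u ∈ adjoin ℚ {(15 * w - 28 * u ^ 2 - 58) / 8, 2 * u * ((15 * w - 28 * u ^ 2 - 58) / 8)} ∧
    w ∈ adjoin ℚ {(15 * w - 28 * u ^ 2 - 58) / 8, 2 * u * ((15 * w - 28 * u ^ 2 - 58) / 8)} := by
  have := algebraRat.charZero K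
  have h0 := curveE_x_ne_zero h
  set x := (15 * w - 28 * u ^ 2 - 58) / 8 with hx
  set M := adjoin ℚ {x, 2 * u * x}
  have hxM : x ∈ M := subset_adjoin _ _ (by simp)
  have hyM : 2 * u * x ∈ M := subset_adjoin _ _ (by simp)
  have huM : u ∈ M := by
    have : u = 2 * u * x / (2 * x) := by field_simp
    rw [this]
    exact div_mem hyM (mul_mem (ofNat_mem M 2) hxM)
  refine ⟨huM, ?_⟩
  have : w = (8 * x + 28 * u ^ 2 + 58) / 15 := by rw [hx]; ring
  rw [this]
  exact div_mem (add_mem (add_mem (mul_mem (ofNat_mem M 8) hxM)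
    (mul_mem (ofNat_mem M 28) (pow_mem huM 2))) (ofNat_mem M 58)) (ofNat_mem M 15)

/-- The quotient of the Ciani quartic by `(ξ, η) ↦ (ξ, -η)` is the curve `E'`. -/
theorem exists_quotient_curveE' {ξ η t : K}
    (h : 15 * ξ ^ 4 + 112 * η ^ 4 + 112 + 288 * η ^ 2 - 88 * ξ ^ 2 - 88 * ξ ^ 2 * η ^ 2 = 0)
    (htop : adjoin ℚ {ξ, η} = ⊤) (ht : Transcendental ℚ t) (hη : η ≠ 0) {σ : K ≃ₐ[ℚ] K}
    (hσξ : σ ξ = ξ) (hση : σ η = -η) :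
    ∃ φ : curveE'.FunctionField →ₐ[ℚ] K, ∀ f, f ∈ φ.range ↔ σ f = f := by
  have := algebraRat.charZero K
  -- with `v = 7η² + 9 - (11/4)ξ²` the equation reads `v² = ξ⁴ - 11ξ² + 32`, and
  -- `x = 2v + 2ξ² - 11`, `y = 2ξx` leads from this quartic to the cubic
  obtain ⟨x, hx⟩ : ∃ x, x = 2 * (7 * η ^ 2 + 9 - 11 / 4 * ξ ^ 2) + 2 * ξ ^ 2 - 11 := ⟨_, rfl⟩
  have hquad : x ^ 2 - 4 * ξ ^ 2 * x + 22 * x - 7 = 0 := by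
    rw [hx]
    linear_combination (7 / 4) * h
  have hx0 : x ≠ 0 := by
    rintro h0
    rw [h0] at hquad
    norm_num at hquad
  have heq : (curveE'.map (algebraMap ℚ K)).toAffine.Equation x (2 * ξ * x) := by
    rw [equation_iff]
    simp [curveE']
    linear_combination (-x) * hquad
  set M := adjoin ℚ {x, 2 * ξ * x} with hM
  have hxM : x ∈ M := subset_adjoin _ _ (by simp)
  have hyM : 2 * ξ * x ∈ M := subset_adjoin _ _ (by simp)
  have hξM : ξ ∈ M := by
    have : ξ = 2 * ξ * x / (2 * x) := by field_simp
    rw [this]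
    exact div_mem hyM (mul_mem (ofNat_mem M 2) hxM)
  have hηM : η ^ 2 ∈ M := by
    have : η ^ 2 = (2 * x + 7 * ξ ^ 2 - 14) / 28 := by rw [hx]; ring
    rw [this]
    exact div_mem (sub_mem (add_mem (mul_mem (ofNat_mem M 2) hxM)
      (mul_mem (ofNat_mem M 7) (pow_mem hξM 2))) (ofNat_mem M 14)) (ofNat_mem M 28)
  have hσx : σ x = x := by
    rw [hx]
    simp only [map_add, map_sub, map_mul, map_div₀, map_pow, map_ofNat, hσξ, hση]
    ring
  refine exists_functionField_algHom_range_eq_fixed curveE' (s := η) heq ?_ ht hσx ?_ hση hη hηM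
  · rw [eq_top_iff, ← htop, adjoin_le_iff]
    have hle : M ≤ adjoin ℚ {η, x, 2 * ξ * x} := adjoin.mono _ _ _ (Set.subset_insert _ _)
    rintro _ (rfl | rfl)
    · exact hle hξM
    · exact subset_adjoin _ _ (by simp)
  · rw [map_mul, map_mul, hσx, hσξ, map_ofNat]

end Maps

/-- A plane curve whose function field is generated by `u`, `w`, related as on the quotient of the
Ciani quartic with `w = (X/Z)²`, `u = Y/Z`, is birational to `E`. -/
theorem isBirationalVia_curveE {F A B D : MvPolynomial (Fin 3) ℚ} [hF : IsDomain (CoordRing F)]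
    {u w t : FunctionField F}
    (h : 15 * w ^ 2 - 88 * w - 88 * u ^ 2 * w + 112 * u ^ 4 + 112 + 288 * u ^ 2 = 0)
    (htop : adjoin ℚ {u, w} = ⊤) (ht : Transcendental ℚ t) (hD : coordFun F D ≠ 0)
    (hA : coordFun F A = (15 * w - 28 * u ^ 2 - 58) / 8 * coordFun F D)
    (hB : coordFun F B = 2 * u * ((15 * w - 28 * u ^ 2 - 58) / 8) * coordFun F D) :
    IsBirationalVia F curveE A B D := by
  have hgen : adjoin ℚ {(15 * w - 28 * u ^ 2 - 58) / 8,
      2 * u * ((15 * w - 28 * u ^ 2 - 58) / 8)} = ⊤ := by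
    rw [eq_top_iff, ← htop, adjoin_le_iff]
    rintro _ (rfl | rfl)
    exacts [(mem_adjoin_curveE h).1, (mem_adjoin_curveE h).2]
  obtain ⟨e, hx, hy⟩ := exists_functionField_algEquiv curveE (curveE_equation h) hgen ht
  exact ⟨hF, hD, e, by rw [hx, ratio, hA, mul_div_cancel_right₀ _ hD],
    by rw [hy, ratio, hB, mul_div_cancel_right₀ _ hD]⟩

theorem isBirationalVia_quarticE1 : PlaneCurve.IsBirationalVia quarticE1 curveE
      (MvPolynomial.C (28 / 15) * MvPolynomial.X 0 ^ 2 * MvPolynomial.X 1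
        + MvPolynomial.C (58 / 15) * MvPolynomial.X 1 ^ 3
        - MvPolynomial.X 1 ^ 2 * MvPolynomial.X 2)
      (MvPolynomial.C (56 / 15) * MvPolynomial.X 0 ^ 3
        + MvPolynomial.C (116 / 15) * MvPolynomial.X 0 * MvPolynomial.X 1 ^ 2
        - 2 * MvPolynomial.X 0 * MvPolynomial.X 1 * MvPolynomial.X 2)
      (MvPolynomial.C (-8 / 15) * MvPolynomial.X 1 ^ 3) := by
  have heq := coordFun_self quarticE1
  have htop := adjoin_coordFun_eq_top quarticE1
  have ht := transcendental_quarticE1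
  have hc : ∀ G, coordFun quarticE1 G = _ := coordFun_eq_aeval quarticE1
  rw [hc, quarticE1] at heq
  simp only [map_add, map_sub, map_mul, map_pow, map_ofNat, MvPolynomial.aeval_X,
    Matrix.cons_val] at heq
  rw [← quarticE1] at heq
  set ξ := coordFun quarticE1 (X 0)
  set η := coordFun quarticE1 (X 1)
  have hη : η ≠ 0 := fun h0 => ht (h0 ▸ isAlgebraic_zero)
  have hu : ξ / η ∈ adjoin ℚ {ξ / η, 1 / η} := subset_adjoin _ _ (by simp)
  have hw : 1 / η ∈ adjoin ℚ {ξ / η, 1 / η} := subset_adjoin _ _ (by simp)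
  refine isBirationalVia_curveE (u := ξ / η) (w := 1 / η) ?_ (adjoin_eq_top_of_mem htop ?_ ?_) ht
    ?_ ?_ ?_
  · have hchar := algebraRat.charZero (FunctionField quarticE1)
    field_simp
    linear_combination heq
  · have := div_mem hu hw
    rwa [show ξ / η / (1 / η) = ξ by field_simp] at this
  · have := inv_mem hw
    rwa [show (1 / η)⁻¹ = η by field_simp] at this
  · have hchar := algebraRat.charZero (FunctionField quarticE1)
    rw [hc]
    simp [hη]
  · have hchar := algebraRat.charZero (FunctionField quarticE1)
    rw [hc, hc]
    simp
    field_simp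
    ring
  · have hchar := algebraRat.charZero (FunctionField quarticE1)
    rw [hc, hc]
    simp
    field_simp
    ring

theorem isBirationalVia_quarticE2 : PlaneCurve.IsBirationalVia quarticE2 curveE
      (MvPolynomial.C (28 / 15) * MvPolynomial.X 1 ^ 2 * MvPolynomial.X 2
        + MvPolynomial.C (58 / 15) * MvPolynomial.X 2 ^ 3
        - MvPolynomial.X 2 ^ 2 * MvPolynomial.X 0)
      (MvPolynomial.C (56 / 15) * MvPolynomial.X 1 ^ 3
        + MvPolynomial.C (116 / 15) * MvPolynomial.X 1 * MvPolynomial.X 2 ^ 2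
        - 2 * MvPolynomial.X 0 * MvPolynomial.X 1 * MvPolynomial.X 2)
      (MvPolynomial.C (-8 / 15) * MvPolynomial.X 2 ^ 3) := by
  have heq := coordFun_self quarticE2
  have htop := adjoin_coordFun_eq_top quarticE2
  have ht := transcendental_quarticE2
  have hc : ∀ G, coordFun quarticE2 G = _ := coordFun_eq_aeval quarticE2
  rw [hc, quarticE2] at heq
  simp only [map_add, map_sub, map_mul, map_pow, map_ofNat, MvPolynomial.aeval_X,
    Matrix.cons_val] at heq
  rw [← quarticE2] at heq
  set ξ := coordFun quarticE2 (X 0)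
  set η := coordFun quarticE2 (X 1)
  have hu : η ∈ adjoin ℚ {η, ξ} := subset_adjoin _ _ (by simp)
  have hw : ξ ∈ adjoin ℚ {η, ξ} := subset_adjoin _ _ (by simp)
  refine isBirationalVia_curveE (u := η) (w := ξ) ?_ (adjoin_eq_top_of_mem htop ?_ ?_) ht
    ?_ ?_ ?_
  · have hchar := algebraRat.charZero (FunctionField quarticE2)
    field_simp
    linear_combination heq
  · exact hw
  · exact hu
  · have hchar := algebraRat.charZero (FunctionField quarticE2)
    rw [hc]
    simp
  · have hchar := algebraRat.charZero (FunctionField quarticE2)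
    rw [hc, hc]
    simp
    field_simp
    ring
  · have hchar := algebraRat.charZero (FunctionField quarticE2)
    rw [hc, hc]
    simp
    field_simp
    ring

theorem isBirationalVia_quarticE3 : PlaneCurve.IsBirationalVia quarticE3 curveE
      (MvPolynomial.C (28 / 15) * MvPolynomial.X 2 ^ 2 * MvPolynomial.X 0
        + MvPolynomial.C (58 / 15) * MvPolynomial.X 0 ^ 3
        - MvPolynomial.X 0 ^ 2 * MvPolynomial.X 1)
      (MvPolynomial.C (56 / 15) * MvPolynomial.X 2 ^ 3
        + MvPolynomial.C (116 / 15) * MvPolynomial.X 2 * MvPolynomial.X 0 ^ 2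
        - 2 * MvPolynomial.X 0 * MvPolynomial.X 1 * MvPolynomial.X 2)
      (MvPolynomial.C (-8 / 15) * MvPolynomial.X 0 ^ 3) := by
  have heq := coordFun_self quarticE3
  have htop := adjoin_coordFun_eq_top quarticE3
  have ht := transcendental_quarticE3
  have hc : ∀ G, coordFun quarticE3 G = _ := coordFun_eq_aeval quarticE3
  rw [hc, quarticE3] at heq
  simp only [map_add, map_sub, map_mul, map_pow, map_ofNat, MvPolynomial.aeval_X,
    Matrix.cons_val] at heq
  rw [← quarticE3] at heq
  set ξ := coordFun quarticE3 (X 0)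
  set η := coordFun quarticE3 (X 1)
  have hξ : ξ ≠ 0 := fun h0 => ht (h0 ▸ isAlgebraic_zero)
  have hu : 1 / ξ ∈ adjoin ℚ {1 / ξ, η / ξ} := subset_adjoin _ _ (by simp)
  have hw : η / ξ ∈ adjoin ℚ {1 / ξ, η / ξ} := subset_adjoin _ _ (by simp)
  refine isBirationalVia_curveE (u := 1 / ξ) (w := η / ξ) ?_ (adjoin_eq_top_of_mem htop ?_ ?_) ht
    ?_ ?_ ?_
  · have hchar := algebraRat.charZero (FunctionField quarticE3)
    field_simp
    linear_combination heq
  · have := inv_mem hu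
    rwa [show (1 / ξ)⁻¹ = ξ by field_simp] at this
  · have := div_mem hw hu
    rwa [show η / ξ / (1 / ξ) = η by field_simp] at this
  · have hchar := algebraRat.charZero (FunctionField quarticE3)
    rw [hc]
    simp [hξ]
  · have hchar := algebraRat.charZero (FunctionField quarticE3)
    rw [hc, hc]
    simp
    field_simp
    ring
  · have hchar := algebraRat.charZero (FunctionField quarticE3)
    rw [hc, hc]
    simp
    field_simp
    ring


/-! ### The quotients of the Ciani quartic -/

theorem ciani_equation : 15 * coordFun ciani (X 0) ^ 4 + 112 * coordFun ciani (X 1) ^ 4 + 112 +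
    288 * coordFun ciani (X 1) ^ 2 - 88 * coordFun ciani (X 0) ^ 2 -
    88 * coordFun ciani (X 0) ^ 2 * coordFun ciani (X 1) ^ 2 = 0 := by
  have heq := coordFun_self ciani
  have hc : ∀ G, coordFun ciani G = _ := coordFun_eq_aeval ciani
  rw [hc, ciani_eq] at heq
  simp only [map_add, map_sub, map_mul, map_pow, map_ofNat, MvPolynomial.aeval_X,
    Matrix.cons_val] at heq
  rw [← ciani_eq] at heq
  linear_combination heq

theorem coordFun_ciani_one_ne_zero : coordFun ciani (X 1) ≠ 0 := fun h0 =>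
  transcendental_ciani (h0 ▸ isAlgebraic_zero)

theorem coordFun_ciani_zero_ne_zero : coordFun ciani (X 0) ≠ 0 := by
  intro h0
  have heq := ciani_equation
  rw [h0] at heq
  refine transcendental_ciani ⟨112 * Polynomial.X ^ 4 + 112 + 288 * Polynomial.X ^ 2,
    fun h => ?_, ?_⟩
  · have := congrArg (Polynomial.eval 0) h
    norm_num at this
  · simp only [map_add, map_mul, map_pow, map_ofNat, Polynomial.aeval_X]
    linear_combination heq

theorem isCurveFunctionField_ciani : IsCurveFunctionField ℚ (FunctionField ciani) := by
  have := finiteDimensional_of_adjoin_pair_eq_top (x := coordFun ciani (X 1))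
    (y := coordFun ciani (X 0)) (by rw [Set.pair_comm]; exact adjoin_coordFun_eq_top ciani) ?_
  · exact isCurveFunctionField_of_finiteDimensional transcendental_ciani
  · have hgen := mem_adjoin_simple_self ℚ (coordFun ciani (X 1))
    set M := ℚ⟮coordFun ciani (X 1)⟯
    let y : M := ⟨coordFun ciani (X 1), hgen⟩
    refine ⟨C 15 * Polynomial.X ^ 4 + C (-88 * (1 + y ^ 2)) * Polynomial.X ^ 2 +
      C (112 * y ^ 4 + 112 + 288 * y ^ 2), fun h => ?_, ?_⟩
    · have := congrArg (Polynomial.coeff · 4) h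
      simp only [Polynomial.coeff_add, Polynomial.coeff_C_mul, Polynomial.coeff_X_pow,
        Polynomial.coeff_C] at this
      norm_num at this
    · have hy : algebraMap M (FunctionField ciani) y = coordFun ciani (X 1) := rfl
      simp only [map_add, map_mul, map_pow, map_ofNat, map_one, map_neg, Polynomial.aeval_X,
        Polynomial.aeval_C, hy]
      linear_combination ciani_equation

/-- The pullbacks along the sign changes. -/
theorem exists_ciani_algEquiv (s : Fin 3 → ℚ) (hs : ∀ i, s i ^ 2 = 1) :
    ∃ σ : FunctionField ciani ≃ₐ[ℚ] FunctionField ciani,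
      (∀ i j : Fin 3, σ (ratio ciani (X i) (X j)) = (s i / s j) • ratio ciani (X i) (X j)) ∧
      σ (coordFun ciani (X 0)) = (s 0 / s 2) • coordFun ciani (X 0) ∧
      σ (coordFun ciani (X 1)) = (s 1 / s 2) • coordFun ciani (X 1) := by
  have h4 : ∀ i, (s i / s 2) ^ 2 = 1 := fun i => by rw [div_pow, hs, hs, div_one]
  obtain ⟨σ, hσ⟩ := exists_sign_algEquiv ciani hs (by
    rw [ciani_eq]
    simp only [map_add, map_sub, map_mul, map_pow, dehomog_X, map_ofNat, MvPolynomial.aeval_X,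
      Matrix.cons_val, map_one]
    have h0 : (MvPolynomial.C (s 0 / s 2) : MvPolynomial (Fin 2) ℚ) ^ 2 = 1 := by
      rw [← map_pow, h4, map_one]
    have h1 : (MvPolynomial.C (s 1 / s 2) : MvPolynomial (Fin 2) ℚ) ^ 2 = 1 := by
      rw [← map_pow, h4, map_one]
    linear_combination (15 * X 0 ^ 4 * (MvPolynomial.C (s 0 / s 2) ^ 2 + 1) - 88 * X 0 ^ 2 -
      88 * X 0 ^ 2 * X 1 ^ 2) * h0 + (112 * X 1 ^ 4 * (MvPolynomial.C (s 1 / s 2) ^ 2 + 1) +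
      288 * X 1 ^ 2 - 88 * X 0 ^ 2 * X 1 ^ 2 * MvPolynomial.C (s 0 / s 2) ^ 2) * h1)
  have h2 : ∀ i, ratio ciani (X i) (X 2) = coordFun ciani (X i) := fun i => by
    rw [ratio, coordFun_X_two, div_one]
  exact ⟨σ, hσ, by rw [← h2, hσ], by rw [← h2, hσ]⟩

theorem exists_quotient_ciani_one :
    ∃ σ : FunctionField ciani ≃ₐ[ℚ] FunctionField ciani,
      (∀ i j : Fin 3, σ (ratio ciani (X i) (X j)) =
        ((![-1, 1, 1] : Fin 3 → ℚ) i / (![-1, 1, 1] : Fin 3 → ℚ) j) • ratio ciani (X i) (X j)) ∧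
      σ (coordFun ciani (X 0)) = -coordFun ciani (X 0) ∧
      σ (coordFun ciani (X 1)) = coordFun ciani (X 1) ∧
      ∃ φ : curveE.FunctionField →ₐ[ℚ] FunctionField ciani, ∀ f, f ∈ φ.range ↔ σ f = f := by
  obtain ⟨σ, hσ, h0, h1⟩ := exists_ciani_algEquiv ![-1, 1, 1]
    (fun i => by fin_cases i <;> norm_num)
  simp at h0 h1
  refine ⟨σ, hσ, h0, h1, ?_⟩
  set ξ := coordFun ciani (X 0)
  set η := coordFun ciani (X 1)
  have hrel : 15 * (ξ ^ 2) ^ 2 - 88 * ξ ^ 2 - 88 * η ^ 2 * ξ ^ 2 + 112 * η ^ 4 + 112 +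
      288 * η ^ 2 = 0 := by
    linear_combination ciani_equation
  have hmem := mem_adjoin_curveE hrel
  refine exists_functionField_algHom_range_eq_fixed curveE (curveE_equation hrel)
    (adjoin_eq_top_of_mem (adjoin_coordFun_eq_top ciani) (subset_adjoin _ _ (Set.mem_insert _ _))
      (adjoin.mono _ _ _ (Set.subset_insert _ _) hmem.1)) transcendental_ciani ?_ ?_ h0
    coordFun_ciani_zero_ne_zero hmem.2
  · simp only [map_sub, map_mul, map_div₀, map_pow, map_ofNat, h0, h1, neg_sq]
  · simp only [map_sub, map_mul, map_div₀, map_pow, map_ofNat, h0, h1, neg_sq]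

theorem exists_quotient_ciani_two :
    ∃ σ : FunctionField ciani ≃ₐ[ℚ] FunctionField ciani,
      (∀ i j : Fin 3, σ (ratio ciani (X i) (X j)) =
        ((![1, -1, 1] : Fin 3 → ℚ) i / (![1, -1, 1] : Fin 3 → ℚ) j) • ratio ciani (X i) (X j)) ∧
      σ (coordFun ciani (X 0)) = coordFun ciani (X 0) ∧
      σ (coordFun ciani (X 1)) = -coordFun ciani (X 1) ∧
      ∃ φ : curveE'.FunctionField →ₐ[ℚ] FunctionField ciani, ∀ f, f ∈ φ.range ↔ σ f = f := by
  obtain ⟨σ, hσ, h0, h1⟩ := exists_ciani_algEquiv ![1, -1, 1]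
    (fun i => by fin_cases i <;> norm_num)
  simp at h0 h1
  exact ⟨σ, hσ, h0, h1, exists_quotient_curveE' ciani_equation (adjoin_coordFun_eq_top ciani)
    transcendental_ciani coordFun_ciani_one_ne_zero h0 h1⟩

theorem exists_quotient_ciani_three :
    ∃ σ : FunctionField ciani ≃ₐ[ℚ] FunctionField ciani,
      (∀ i j : Fin 3, σ (ratio ciani (X i) (X j)) =
        ((![1, 1, -1] : Fin 3 → ℚ) i / (![1, 1, -1] : Fin 3 → ℚ) j) • ratio ciani (X i) (X j)) ∧
      σ (coordFun ciani (X 0)) = -coordFun ciani (X 0) ∧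
      σ (coordFun ciani (X 1)) = -coordFun ciani (X 1) ∧
      ∃ φ : curveE'.FunctionField →ₐ[ℚ] FunctionField ciani, ∀ f, f ∈ φ.range ↔ σ f = f := by
  obtain ⟨σ, hσ, h0, h1⟩ := exists_ciani_algEquiv ![1, 1, -1]
    (fun i => by fin_cases i <;> norm_num)
  simp at h0 h1
  refine ⟨σ, hσ, h0, h1, ?_⟩
  have hη := coordFun_ciani_one_ne_zero
  have hrel := ciani_equation
  have htop := adjoin_coordFun_eq_top ciani
  set ξ := coordFun ciani (X 0)
  set η := coordFun ciani (X 1)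
  -- the equation of the quartic is symmetric in `Y` and `Z`
  have hu : ξ / η ∈ adjoin ℚ {ξ / η, 1 / η} := subset_adjoin _ _ (by simp)
  have hw : 1 / η ∈ adjoin ℚ {ξ / η, 1 / η} := subset_adjoin _ _ (by simp)
  refine exists_quotient_curveE' (ξ := ξ / η) (η := 1 / η) ?_ (adjoin_eq_top_of_mem htop ?_ ?_)
    transcendental_ciani (one_div_ne_zero hη) ?_ ?_
  · field_simp
    linear_combination hrel
  · have := div_mem hu hw
    rwa [show ξ / η / (1 / η) = ξ by field_simp] at this
  · have := inv_mem hw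
    rwa [show (1 / η)⁻¹ = η by field_simp] at this
  · rw [map_div₀, h0, h1, neg_div_neg_eq]
  · rw [map_div₀, map_one, h1, div_neg]

theorem isQuotientFunctionField_quarticE1 :
    IsQuotientFunctionField ciani ![-1, 1, 1] (FunctionField quarticE1) := by
  obtain ⟨σ, hσ, -, -, φ, hφ⟩ := exists_quotient_ciani_one
  obtain ⟨-, -, e, -, -⟩ := isBirationalVia_quarticE1
  refine ⟨inferInstance, σ, hσ, φ.comp (e.symm : FunctionField quarticE1 →ₐ[ℚ] curveE.FunctionField),
    φ.toRingHom.injective.comp e.symm.injective, fun f => ?_⟩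
  rw [← hφ]
  constructor
  · rintro ⟨g, rfl⟩
    exact ⟨e.symm g, rfl⟩
  · rintro ⟨g, rfl⟩
    exact ⟨e g, by simp⟩

theorem isQuotientFunctionField_two :
    IsQuotientFunctionField ciani ![1, -1, 1] curveE'.FunctionField := by
  obtain ⟨σ, hσ, -, -, φ, hφ⟩ := exists_quotient_ciani_two
  exact ⟨inferInstance, σ, hσ, φ, φ.toRingHom.injective, hφ⟩

theorem isQuotientFunctionField_three :
    IsQuotientFunctionField ciani ![1, 1, -1] curveE'.FunctionField := by
  obtain ⟨σ, hσ, -, -, φ, hφ⟩ := exists_quotient_ciani_three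
  exact ⟨inferInstance, σ, hσ, φ, φ.toRingHom.injective, hφ⟩

end

/-! ### The Mordell-Weil rank of the Jacobian -/

section


open MvPolynomial (X)
open PlaneCurve WeierstrassCurve.Affine

instance isElliptic_curveE : curveE.IsElliptic := by
  rw [WeierstrassCurve.isElliptic_iff, isUnit_iff_ne_zero]
  simp [curveE, WeierstrassCurve.Δ, WeierstrassCurve.b₂, WeierstrassCurve.b₄, WeierstrassCurve.b₆,
    WeierstrassCurve.b₈]
  norm_num

instance isElliptic_curveE' : curveE'.IsElliptic := by
  rw [WeierstrassCurve.isElliptic_iff, isUnit_iff_ne_zero]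
  simp [curveE', WeierstrassCurve.Δ, WeierstrassCurve.b₂, WeierstrassCurve.b₄, WeierstrassCurve.b₆,
    WeierstrassCurve.b₈]
  norm_num

open Polynomial in
theorem squarefree_cubic_curveE : Squarefree (cubic curveE) := by
  apply Separable.squarefree
  -- the coefficients of the Bézout relation for the cubic and its derivative
  refine ⟨C (-7063/450) + C (-482/75) * Polynomial.X,
    C (-16/15) + C (3479/450) * Polynomial.X + C (482/225) * Polynomial.X ^ 2,
    Polynomial.funext fun x => ?_⟩
  simp [cubic, curveE]
  ring

open Polynomial in
theorem squarefree_cubic_curveE' : Squarefree (cubic curveE') := by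
  apply Separable.squarefree
  -- the coefficients of the Bézout relation for the cubic and its derivative
  refine ⟨C (-22451/12544) + C (-1515/12544) * Polynomial.X,
    C (-1/7) + C (11187/12544) * Polynomial.X + C (505/12544) * Polynomial.X ^ 2,
    Polynomial.funext fun x => ?_⟩
  simp [cubic, curveE']
  ring

/-- The nonconstant function `Y/Z` has a zero. -/
instance nonempty_place_ciani : Nonempty (Place ℚ (FunctionField ciani)) := by
  have := isCurveFunctionField_ciani _ transcendental_ciani
  obtain ⟨S, -, -, hS⟩ := Place.exists_finset_zeros transcendental_ciani
  have hpos := Module.finrank_pos (R := IntermediateField.adjoin ℚ {coordFun ciani (X 1)})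
    (M := FunctionField ciani)
  by_contra h
  rw [not_nonempty_iff] at h
  rw [Finset.eq_empty_of_isEmpty S, Finset.sum_empty] at hS
  exact hpos.ne (by exact_mod_cast hS)

/-- The Jacobian of the Ciani quartic is isogenous to `E × E' × E'`, so it has rank zero when these
curves have only torsion points. -/
theorem rank_picZero_ciani (hE : ∀ P : curveE.Point, IsOfFinAddOrder P)
    (hE' : ∀ P : curveE'.Point, IsOfFinAddOrder P) :
    Module.rank ℤ (PicZero ℚ (FunctionField ciani)) = 0 := by
  obtain ⟨σ, -, hσ0, hσ1, φ, hφ⟩ := exists_quotient_ciani_one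
  obtain ⟨τ, -, hτ0, hτ1, φ', hφ'⟩ := exists_quotient_ciani_two
  obtain ⟨ρ, -, hρ0, hρ1, φ'', hφ''⟩ := exists_quotient_ciani_three
  have key : ∀ α β : FunctionField ciani →ₐ[ℚ] FunctionField ciani,
      α (coordFun ciani (X 0)) = β (coordFun ciani (X 0)) →
      α (coordFun ciani (X 1)) = β (coordFun ciani (X 1)) → ∀ x, α x = β x := fun α β h0 h1 =>
    algEquiv_ext_of_adjoin_eq_top (adjoin_coordFun_eq_top ciani) (by
      rintro _ (rfl | rfl)
      exacts [h0, h1])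
  have hσ : ∀ x, σ (σ x) = x := key (σ.trans σ) (AlgHom.id ℚ _) (by simp [hσ0]) (by simp [hσ1])
  have hτ : ∀ x, τ (τ x) = x := key (τ.trans τ) (AlgHom.id ℚ _) (by simp [hτ0]) (by simp [hτ1])
  have hρ : ∀ x, ρ (ρ x) = x := key (ρ.trans ρ) (AlgHom.id ℚ _) (by simp [hρ0]) (by simp [hρ1])
  have hρσ : ∀ x, ρ x = τ (σ x) := key ρ (σ.trans τ) (by simp [hσ0, hτ0, hρ0])
    (by simp [hσ1, hτ1, hρ1])
  refine Place.rank_picZero_eq_zero isCurveFunctionField_ciani ![σ, τ, ρ] hρσ fun i => ?_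
  fin_cases i
  · exact Place.exists_divisor_of_quotient_elliptic isCurveFunctionField_ciani rfl rfl
      squarefree_cubic_curveE hE hσ φ hφ
  · exact Place.exists_divisor_of_quotient_elliptic isCurveFunctionField_ciani rfl rfl
      squarefree_cubic_curveE' hE' hτ φ' hφ'
  · exact Place.exists_divisor_of_quotient_elliptic isCurveFunctionField_ciani rfl rfl
      squarefree_cubic_curveE' hE' hρ φ'' hφ''

end

/-! ### Splitting products that are fourth powers up to a constant -/

namespace Int

theorem exists_eq_pow_four_of_mul_eq {P Q s : ℤ} (hP : 0 ≤ P) (hQ : 0 ≤ Q) (h : IsCoprime P Q)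
    (hPQ : P * Q = s ^ 4) : ∃ p q, P = p ^ 4 ∧ Q = q ^ 4 ∧ s = p * q ∧ IsCoprime p q := by
  have key : ∀ {P Q : ℤ}, 0 ≤ P → IsCoprime P Q → P * Q = s ^ 4 → ∃ p, P = p ^ 4 := by
    intro P Q hP h hPQ
    obtain ⟨d, hd⟩ := exists_associated_pow_of_mul_eq_pow' h hPQ
    rcases Int.associated_iff.1 hd with hd | hd
    · exact ⟨d, hd.symm⟩
    · have : 0 ≤ d ^ 4 := by positivity
      exact ⟨0, by linarith⟩
  obtain ⟨p, hp⟩ := key hP h hPQ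
  obtain ⟨q, hq⟩ := key hQ h.symm (by rw [mul_comm, hPQ])
  have hcop : IsCoprime p q := by
    rw [hp, hq] at h
    exact (IsCoprime.pow_iff (by norm_num) (by norm_num)).1 h
  have h4 : s ^ 4 = (p * q) ^ 4 := by rw [mul_pow, ← hp, ← hq, hPQ]
  rcases (pow_eq_pow_iff_of_ne_zero (by norm_num : 4 ≠ 0)).1 h4 with h | ⟨h, -⟩
  · exact ⟨p, q, hp, hq, h, hcop⟩
  · exact ⟨-p, q, by rw [hp]; ring, hq, by rw [h]; ring, hcop.neg_left⟩

theorem pow_dvd_or_pow_dvd {P Q ℓ : ℤ} (hℓ : Prime ℓ) (h : IsCoprime P Q) {k : ℕ}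
    (hd : ℓ ^ k ∣ P * Q) : ℓ ^ k ∣ P ∨ ℓ ^ k ∣ Q := by
  by_cases hP : ℓ ∣ P
  · left
    have : ¬ ℓ ∣ Q := fun hQ => hℓ.not_isUnit (h.isUnit_of_dvd' hP hQ)
    exact ((hℓ.coprime_iff_not_dvd.2 this).pow_left).dvd_of_dvd_mul_right hd
  · right
    exact ((hℓ.coprime_iff_not_dvd.2 hP).pow_left).dvd_of_dvd_mul_left hd

/-- If `PQ = uvs⁴` with `P`, `Q` coprime and positive, `u ∣ P` and `v ∣ Q`, then `P/u` and `Q/v` are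
fourth powers. -/
theorem exists_of_mul_eq_mul_pow_four {P Q u v s : ℤ} (hP : 0 < P) (hQ : 0 < Q) (hu : 0 < u)
    (hv : 0 < v) (h : IsCoprime P Q) (hPQ : P * Q = u * v * s ^ 4) (huP : u ∣ P) (hvQ : v ∣ Q) :
    ∃ p q, P = u * p ^ 4 ∧ Q = v * q ^ 4 ∧ s = p * q ∧ IsCoprime p q := by
  obtain ⟨P, rfl⟩ := huP
  obtain ⟨Q, rfl⟩ := hvQ
  have h1 : P * Q = s ^ 4 := by
    apply mul_left_cancel₀ (mul_ne_zero hu.ne' hv.ne')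
    linear_combination hPQ
  obtain ⟨p, q, rfl, rfl, hs, hc⟩ := exists_eq_pow_four_of_mul_eq
    (pos_of_mul_pos_right hP hu.le).le (pos_of_mul_pos_right hQ hv.le).le
    h.of_mul_left_right.of_mul_right_right h1
  exact ⟨p, q, rfl, rfl, hs, hc⟩

theorem exists_add_eq_of_mul_eq {P Q ℓ s : ℤ} {k : ℕ} (hℓ : Prime ℓ) (hℓ0 : 0 < ℓ) (hP : 0 < P)
    (hQ : 0 < Q) (h : IsCoprime P Q) (hPQ : P * Q = ℓ ^ k * s ^ 4) :
    ∃ p q, P + Q = p ^ 4 + ℓ ^ k * q ^ 4 ∧ s = p * q ∧ IsCoprime p q := by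
  have hpow : 0 < ℓ ^ k := pow_pos hℓ0 k
  rcases pow_dvd_or_pow_dvd hℓ h (show ℓ ^ k ∣ P * Q from ⟨s ^ 4, hPQ⟩) with hd | hd
  · obtain ⟨p, q, e1, e2, e3, e4⟩ := exists_of_mul_eq_mul_pow_four hP hQ hpow one_pos h
      (by rw [mul_one, hPQ]) hd (one_dvd _)
    exact ⟨q, p, by rw [e1, e2]; ring, by rw [e3]; ring, e4.symm⟩
  · obtain ⟨p, q, e1, e2, e3, e4⟩ := exists_of_mul_eq_mul_pow_four hP hQ one_pos hpow h
      (by rw [one_mul, hPQ]) (one_dvd _) hd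
    exact ⟨p, q, by rw [e1, e2]; ring, e3, e4⟩

theorem isCoprime_of_add {P Q n s L : ℤ} (hL : P + Q = L) (hPQ : P * Q = n * s ^ 4)
    (hn : IsCoprime L n) (hs : IsCoprime L s) : IsCoprime P Q := by
  have h1 : IsCoprime L (P * Q) := hPQ ▸ hn.mul_right hs.pow_right
  have h2 := h1.of_mul_right_right
  rw [← hL] at h2
  obtain ⟨x, y, e⟩ := h2
  exact ⟨x, x + y, by linear_combination e⟩

/-- The prime `ℓ` divides the product exactly once up to fourth powers, so it cannot divide both
factors. -/
theorem isCoprime_of_sub {P Q m ℓ s L : ℤ} (hℓ : Prime ℓ) (hL : Q - P = L)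
    (hPQ : P * Q = m * ℓ * s ^ 4) (hm : ¬ ℓ ∣ m) (hLm : IsCoprime L m) (hs : IsCoprime L s)
    (h0 : P ≠ 0) : IsCoprime P Q := by
  refine isCoprime_of_prime_dvd (fun h => h0 h.1) fun z hz hzP hzQ => ?_
  have hzL : z ∣ L := hL ▸ dvd_sub hzQ hzP
  have hzs : ¬ z ∣ s := fun h => hz.not_isUnit (hs.isUnit_of_dvd' hzL h)
  have hzm : ¬ z ∣ m := fun h => hz.not_isUnit (hLm.isUnit_of_dvd' hzL h)
  have h1 : z ∣ m * ℓ * s ^ 4 := hPQ ▸ hzP.mul_right Q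
  have hzℓ : z ∣ ℓ := by
    rcases hz.dvd_or_dvd h1 with h | h
    · exact (hz.dvd_or_dvd h).resolve_left hzm
    · exact absurd (hz.dvd_of_dvd_pow h) hzs
  have hℓz : ℓ ∣ z := ((Prime.associated_of_dvd hz hℓ hzℓ).symm).dvd
  obtain ⟨P', rfl⟩ := hℓz.trans hzP
  obtain ⟨Q', rfl⟩ := hℓz.trans hzQ
  have h2 : ℓ * (P' * Q') = m * s ^ 4 := by
    apply mul_left_cancel₀ hℓ.ne_zero
    linear_combination hPQ
  rcases hℓ.dvd_or_dvd (h2 ▸ dvd_mul_right ℓ _) with h | h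
  · exact hm h
  · exact hzs (hzℓ.trans (hℓ.dvd_of_dvd_pow h))

theorem pos_and_pos_of_add_pos {P Q : ℤ} (h : 0 < P * Q) (h2 : 0 < P + Q) : 0 < P ∧ 0 < Q := by
  rcases (mul_pos_iff.1 h) with h | h
  · exact h
  · omega

theorem exists_factors_of_sq_sub_sq {y a N : ℤ} (hy : 0 < y) (h : y ^ 2 - a ^ 2 = 4 * N)
    (hN : 0 < N) (hya : Even (y - a)) :
    ∃ P Q, P * Q = N ∧ Q - P = a ∧ 0 < P ∧ 0 < Q ∧ P + Q = y := by
  obtain ⟨F, hF⟩ := hya.two_dvd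
  have hmul : F * (F + a) = N := by
    apply mul_left_cancel₀ (show (4 : ℤ) ≠ 0 by norm_num)
    linear_combination (-(y + a) - 2 * F) * hF + h
  have hpos := pos_and_pos_of_add_pos (by rwa [hmul]) (show 0 < F + (F + a) by omega)
  exact ⟨F, F + a, hmul, by ring, hpos.1, hpos.2, by linear_combination -hF⟩

theorem even_sub_of_sq_sub_sq {y a N : ℤ} (h : y ^ 2 - a ^ 2 = 4 * N) (ha : Odd a) :
    Even (y - a) := by
  refine Odd.sub_odd ((Int.odd_pow' two_ne_zero).1 ?_) ha
  rw [show y ^ 2 = a ^ 2 + 2 * (2 * N) by linear_combination h]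
  exact ha.pow.add_even (even_two_mul _)

/-- The step of a descent: if `y² - a² = 4ℓᵏp⁴` with `y` prime to `ℓᵏ` and `p`, then the coprime
factors `(y - a) / 2` and `(y + a) / 2` of `ℓᵏp⁴` are a fourth power and `ℓᵏ` times a fourth
power. -/
theorem exists_eq_add_of_sq_sub_sq {y a p ℓ : ℤ} {k : ℕ} (hℓ : Prime ℓ) (hℓ0 : 0 < ℓ)
    (h : y ^ 2 - a ^ 2 = 4 * ℓ ^ k * p ^ 4) (hy : 0 < y) (hp : p ≠ 0) (hya : Even (y - a))
    (hyℓ : IsCoprime y (ℓ ^ k)) (hyp : IsCoprime y p) :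
    ∃ r s, y = r ^ 4 + ℓ ^ k * s ^ 4 ∧ p = r * s ∧ IsCoprime r s := by
  obtain ⟨P, Q, hPQ, -, hP, hQ, hsum⟩ := exists_factors_of_sq_sub_sq (N := ℓ ^ k * p ^ 4) hy
    (by rw [h]; ring) (by positivity) hya
  obtain ⟨r, s, e⟩ := exists_add_eq_of_mul_eq hℓ hℓ0 hP hQ
    (isCoprime_of_add hsum hPQ hyℓ hyp) hPQ
  exact ⟨r, s, hsum ▸ e⟩

theorem exists_sq_eq_of_odd {r : ℤ} (h : Odd r) : ∃ t, r ^ 2 = 8 * t + 1 := by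
  obtain ⟨m, rfl⟩ := h
  obtain ⟨t, ht⟩ := Int.even_mul_succ_self m
  exact ⟨t, by linear_combination 4 * ht⟩

theorem isUnit_of_not_natAbs_lt {b s m : ℤ} (hb : b ≠ 0) (h : b = s * m)
    (hlt : ¬ s.natAbs < b.natAbs) : IsUnit m := by
  rw [h] at hb
  have hs : 0 < s.natAbs := natAbs_pos.2 (left_ne_zero_of_mul hb)
  have hm : 0 < m.natAbs := natAbs_pos.2 (right_ne_zero_of_mul hb)
  rw [h, natAbs_mul, not_lt] at hlt
  have h1 : m.natAbs ≤ 1 := Nat.le_of_mul_le_mul_left (by rwa [mul_one]) hs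
  exact Int.isUnit_iff_natAbs_eq.2 (by omega)

theorem sq_eq_one_of_isUnit {z : ℤ} (hz : IsUnit z) : z ^ 2 = 1 := by
  rcases Int.isUnit_iff.1 hz with rfl | rfl <;> norm_num

end Int

/-! ### The descent for the curve `y² = x³ + 22x² - 7x` -/

namespace Int

theorem sq_emod_four_ne_three (a : ℤ) : a ^ 2 % 4 ≠ 3 := by
  rcases Int.even_or_odd' a with ⟨k, rfl | rfl⟩
  · have : (2 * k) ^ 2 = 4 * k ^ 2 := by ring
    omega
  · have : (2 * k + 1) ^ 2 = 4 * (k ^ 2 + k) + 1 := by ring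
    omega

/-- A descent in the style of Fermat. Completing the square gives
`(2c - A)(2c + A) = 7b⁴` with `A = 2a² - 11b²`. One of the two ways to split the right-hand side is
impossible modulo a power of two; in the other one the formula for `a²` completes to a square again,
with a power of two in place of `7`, and splitting once more gives a solution with a smaller `b`,
unless `a² = 4b²`. -/
theorem sq_eq_four_mul_sq_of_quartic {a b c : ℤ} (h : c ^ 2 = a ^ 4 - 11 * a ^ 2 * b ^ 2 + 32 * b ^ 4)
    (hb : b ≠ 0) (hab : IsCoprime a b) : a ^ 2 = 4 * b ^ 2 := by
  induction hn : b.natAbs using Nat.strong_induction_on generalizing a b c with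
  | _ n ih =>
  subst hn
  wlog hc : 0 ≤ c generalizing c
  · exact this (c := -c) (by rw [neg_sq, h]) (by omega)
  have hb2 : 0 < b ^ 2 := by positivity
  have hb4 : 0 < b ^ 4 := by positivity
  have hc0 : 0 < c := by
    refine lt_of_le_of_ne hc fun h0 => ?_
    rw [← h0] at h
    nlinarith [sq_nonneg (2 * a ^ 2 - 11 * b ^ 2)]
  have h7 : Prime (7 : ℤ) := by norm_num
  have h2 : Prime (2 : ℤ) := Int.prime_two
  -- for even `b` the factors `2c ± A` are divided by `4`, and `b` is replaced by `b / 2`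
  rcases Int.even_or_odd' b with ⟨β, hβ | hβ⟩
  · have hbeven : Even b := ⟨β, by rw [hβ]; ring⟩
    have haodd : Odd a := by
      rw [← Int.not_even_iff_odd]
      exact fun hae => h2.not_isUnit (hab.isUnit_of_dvd' hae.two_dvd hbeven.two_dvd)
    have hcodd : Odd c := by
      have : Odd (c ^ 2) := by
        rw [h, show a ^ 4 - 11 * a ^ 2 * b ^ 2 + 32 * b ^ 4
          = a ^ 4 - 2 * (β * (11 * a ^ 2 * b) - 16 * b ^ 4) by rw [hβ]; ring]
        exact haodd.pow.sub_even (even_two_mul _)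
      exact (Int.odd_pow' two_ne_zero).1 this
    have haβ : IsCoprime a β := by rw [hβ] at hab; exact hab.of_mul_right_right
    have hβ0 : β ≠ 0 := by rintro rfl; simp [hβ] at hb
    obtain ⟨F, hF⟩ := (hcodd.sub_odd (haodd.pow (n := 2))).two_dvd
    obtain ⟨P, hP⟩ : ∃ P, P = F + 11 * β ^ 2 := ⟨_, rfl⟩
    obtain ⟨Q, hQ⟩ : ∃ Q, Q = F + a ^ 2 - 11 * β ^ 2 := ⟨_, rfl⟩
    have hPQ : P * Q = 1 * 7 * β ^ 4 := by
      apply mul_left_cancel₀ (show (4 : ℤ) ≠ 0 by norm_num)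
      rw [hP, hQ]
      rw [hβ] at h
      linear_combination h - (c + a ^ 2 + 2 * F) * hF
    have hadd : P + Q = c := by rw [hP, hQ]; linear_combination -hF
    have hpos := pos_and_pos_of_add_pos (P := P) (Q := Q) (by rw [hPQ]; positivity) (by omega)
    have hL : IsCoprime (Q - P) β := by
      have := (haβ.pow_left (m := 2)).add_mul_left_left (-22 * β)
      rwa [show Q - P = a ^ 2 + β * (-22 * β) by rw [hP, hQ]; ring]
    have hcop := isCoprime_of_sub h7 rfl hPQ (by norm_num) isCoprime_one_right hL hpos.1.ne'
    rcases h7.dvd_or_dvd (show 7 ∣ P * Q from ⟨β ^ 4, by rw [hPQ]; ring⟩) with hd | hd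
    · obtain ⟨p, q, e1, e2, e3, e4⟩ := exists_of_mul_eq_mul_pow_four hpos.1 hpos.2 (by norm_num)
        one_pos hcop (u := 7) (v := 1) (s := β) (by rw [hPQ]; ring) hd (one_dvd _)
      have ha : a ^ 2 = q ^ 4 + 22 * p ^ 2 * q ^ 2 - 7 * p ^ 4 := by
        rw [e3] at hP hQ; linear_combination e2 - e1 + hP - hQ
      obtain ⟨y, hy⟩ : ∃ y, y = q ^ 2 + 11 * p ^ 2 := ⟨_, rfl⟩
      have hyodd : Odd y := by
        have : Odd (y ^ 2) := by
          rw [show y ^ 2 = a ^ 2 + 2 * (64 * p ^ 4) by rw [hy, ha]; ring]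
          exact haodd.pow.add_even (even_two_mul _)
        exact (Int.odd_pow' two_ne_zero).1 this
      have hp0 : p ≠ 0 := fun h0 => hβ0 (by rw [e3, h0, zero_mul])
      have hy0 : 0 < y := by
        have : 0 < p ^ 2 := by positivity
        have := sq_nonneg q
        omega
      have hyp : IsCoprime y p := by
        have h1 : IsCoprime (q ^ 2 + p * (11 * p)) p := (e4.symm.pow_left).add_mul_left_left _
        rwa [show q ^ 2 + p * (11 * p) = y by rw [hy]; ring] at h1
      obtain ⟨r, s, f1, f2, f3⟩ := exists_eq_add_of_sq_sub_sq (k := 5) h2 two_pos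
        (y := y) (a := a) (p := p) (by rw [ha, hy]; ring) hy0 hp0 (hyodd.sub_odd haodd)
        (Int.isCoprime_two_left.2 hyodd).symm.pow_right hyp
      have hnew : q ^ 2 = r ^ 4 - 11 * r ^ 2 * s ^ 2 + 32 * s ^ 4 := by
        rw [f2] at hy
        linear_combination f1 - hy
      have hs0 : s ≠ 0 := by rintro rfl; simp [f2] at hp0
      have hlt : s.natAbs < b.natAbs := by
        have h1 : s.natAbs ≤ β.natAbs :=
          Nat.le_of_dvd (natAbs_pos.2 hβ0) (Int.natAbs_dvd_natAbs.2
            ⟨r * q, by rw [e3, f2]; ring⟩)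
        have : 0 < β.natAbs := natAbs_pos.2 hβ0
        omega
      have h1 := ih _ hlt hnew hs0 f3 rfl
      -- `r` is even, against `y = r⁴ + 32s⁴` being odd
      refine absurd hyodd (Int.not_odd_iff_even.2 ⟨2 * r ^ 2 * s ^ 2 + 16 * s ^ 4, ?_⟩)
      linear_combination f1 + r ^ 2 * h1
    · obtain ⟨p, q, e1, e2, e3, e4⟩ := exists_of_mul_eq_mul_pow_four hpos.1 hpos.2 one_pos
        (by norm_num) hcop (u := 1) (v := 7) (s := β) hPQ (one_dvd _) hd
      have ha : a ^ 2 = 7 * q ^ 4 + 22 * p ^ 2 * q ^ 2 - p ^ 4 := by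
        rw [e3] at hP hQ; linear_combination e2 - e1 + hP - hQ
      refine absurd ?_ (sq_emod_four_ne_three a)
      rcases Int.even_or_odd' p with ⟨t, rfl | rfl⟩ <;> rcases Int.even_or_odd' q with ⟨u, rfl | rfl⟩
      · exact absurd (e4.isUnit_of_dvd' (dvd_mul_right 2 t) (dvd_mul_right 2 u)) h2.not_isUnit
      · ring_nf at ha ⊢
        omega
      · ring_nf at ha ⊢
        omega
      · refine absurd hcodd (Int.not_odd_iff_even.2 ?_)
        rw [← hadd, e1, e2]
        rw [one_mul]
        exact (odd_two_mul_add_one t).pow.add_odd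
          ((show Odd (7 : ℤ) by decide).mul (odd_two_mul_add_one u).pow)
  · have hbodd : Odd b := ⟨β, hβ⟩
    have hb2' : IsCoprime 2 b := (Int.isCoprime_two_left.2 hbodd)
    obtain ⟨P, hP⟩ : ∃ P, P = 2 * c - 2 * a ^ 2 + 11 * b ^ 2 := ⟨_, rfl⟩
    obtain ⟨Q, hQ⟩ : ∃ Q, Q = 2 * c + 2 * a ^ 2 - 11 * b ^ 2 := ⟨_, rfl⟩
    have hPQ : P * Q = 1 * 7 * b ^ 4 := by rw [hP, hQ]; linear_combination 4 * h
    have hpos := pos_and_pos_of_add_pos (P := P) (Q := Q) (by rw [hPQ]; positivity) (by omega)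
    have hL : IsCoprime (Q - P) b := by
      have h1 : IsCoprime (2 ^ 2 * a ^ 2) b := (hb2'.pow_left).mul_left hab.pow_left
      have := h1.add_mul_left_left (-22 * b)
      rwa [show Q - P = 2 ^ 2 * a ^ 2 + b * (-22 * b) by rw [hP, hQ]; ring]
    have hcop := isCoprime_of_sub h7 rfl hPQ (by norm_num) isCoprime_one_right hL hpos.1.ne'
    rcases h7.dvd_or_dvd (show 7 ∣ P * Q from ⟨b ^ 4, by rw [hPQ]; ring⟩) with hd | hd
    · obtain ⟨p, q, e1, e2, e3, e4⟩ := exists_of_mul_eq_mul_pow_four hpos.1 hpos.2 (by norm_num)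
        one_pos hcop (u := 7) (v := 1) (s := b) (by rw [hPQ]; ring) hd (one_dvd _)
      have ha : 4 * a ^ 2 = q ^ 4 + 22 * p ^ 2 * q ^ 2 - 7 * p ^ 4 := by
        rw [e3] at hP hQ; linear_combination e2 - e1 + hP - hQ
      have hpq := e3 ▸ hbodd
      rw [Int.odd_mul] at hpq
      obtain ⟨t, ht⟩ := exists_sq_eq_of_odd hpq.1
      obtain ⟨u, hu⟩ := exists_sq_eq_of_odd hpq.2
      have haeven : Even a := by
        rw [← Int.not_odd_iff_even]
        intro ho
        obtain ⟨v, hv⟩ := exists_sq_eq_of_odd ho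
        have : 4 * (8 * v + 1) = (8 * u + 1) ^ 2 + 22 * (8 * t + 1) * (8 * u + 1)
          - 7 * (8 * t + 1) ^ 2 := by rw [← ht, ← hu, ← hv, ha]; ring
        ring_nf at this
        omega
      obtain ⟨a₁, rfl⟩ := haeven.two_dvd
      obtain ⟨y, hy⟩ : ∃ y, y = 3 + 2 * (u + 11 * t) := ⟨_, rfl⟩
      have hyq : 4 * y = q ^ 2 + 11 * p ^ 2 := by rw [ht, hu, hy]; ring
      have ha₁ : a₁ ^ 2 = y ^ 2 - 8 * p ^ 4 := by
        apply mul_left_cancel₀ (show (16 : ℤ) ≠ 0 by norm_num)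
        linear_combination ha - (4 * y + q ^ 2 + 11 * p ^ 2) * hyq
      have hyodd : Odd y := ⟨1 + (u + 11 * t), by rw [hy]; ring⟩
      have ha₁odd : Odd a₁ := by
        have : Odd (a₁ ^ 2) := by
          rw [ha₁]
          exact (hyodd.pow).sub_even ⟨4 * p ^ 4, by ring⟩
        exact (Int.odd_pow' two_ne_zero).1 this
      have hp0 : p ≠ 0 := fun h0 => hb (by rw [e3, h0, zero_mul])
      have hy0 : 0 < y := by
        have : 0 < p ^ 2 := by positivity
        have := sq_nonneg q
        omega
      have hyp : IsCoprime y p := by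
        have h1 : IsCoprime (q ^ 2 + p * (11 * p)) p := (e4.symm.pow_left).add_mul_left_left _
        rw [show q ^ 2 + p * (11 * p) = 4 * y by rw [hyq]; ring] at h1
        exact h1.of_mul_left_right
      obtain ⟨r, s, f1, f2, f3⟩ := exists_eq_add_of_sq_sub_sq (k := 1) h2 two_pos
        (y := y) (a := a₁) (p := p) (by rw [ha₁]; ring) hy0 hp0 (hyodd.sub_odd ha₁odd)
        (by rw [pow_one]; exact (Int.isCoprime_two_left.2 hyodd).symm) hyp
      have hq2 : q ^ 2 = 4 * r ^ 4 - 11 * r ^ 2 * s ^ 2 + 8 * s ^ 4 := by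
        rw [f2] at hyq
        linear_combination 4 * f1 - hyq
      have hnew : (2 * q) ^ 2 = (2 * r) ^ 4 - 11 * (2 * r) ^ 2 * s ^ 2 + 32 * s ^ 4 := by
        rw [mul_pow, hq2]
        ring
      rw [f2] at e3
      have hs0 : s ≠ 0 := by rintro rfl; simp [f2] at hp0
      have hs2 : IsCoprime 2 s :=
        Int.isCoprime_two_left.2 (Int.odd_mul.1 (f2 ▸ hpq.1)).2
      suffices hrs : r ^ 2 = 1 ∧ s ^ 2 = 1 by
        have hq1 : q ^ 2 = 1 := by
          have : r ^ 4 = 1 := by rw [show r ^ 4 = (r ^ 2) ^ 2 by ring, hrs.1, one_pow]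
          have : s ^ 4 = 1 := by rw [show s ^ 4 = (s ^ 2) ^ 2 by ring, hrs.2, one_pow]
          rw [hq2, hrs.1, hrs.2]
          omega
        have hp1 : p ^ 2 = 1 := by rw [f2, mul_pow, hrs.1, hrs.2, one_mul]
        have hb1 : b ^ 2 = 1 := by rw [e3, ← f2, mul_pow, hp1, hq1, one_mul]
        rw [show p ^ 4 = (p ^ 2) ^ 2 by ring, show q ^ 4 = (q ^ 2) ^ 2 by ring, hp1, hq1] at ha
        rw [hb1]
        linarith
      by_cases hlt : s.natAbs < b.natAbs
      · have h1 := ih _ hlt hnew hs0 (hs2.mul_left f3) rfl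
        have h3 : r ^ 2 = s ^ 2 := by linarith
        have h4 : IsCoprime (r ^ 2) (s ^ 2) := f3.pow
        rw [h3, isCoprime_self] at h4
        have h5 := sq_eq_one_of_isUnit (isUnit_pow_iff two_ne_zero |>.1 h4)
        exact ⟨h3.trans h5, h5⟩
      · -- here `|s| = |b|`, so that the other factors of `b` are units
        have h3 := isUnit_of_not_natAbs_lt (m := r * q) hb (by rw [e3]; ring) hlt
        have hr1 := sq_eq_one_of_isUnit (isUnit_of_mul_isUnit_left h3)
        have hq1 := sq_eq_one_of_isUnit (isUnit_of_mul_isUnit_right h3)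
        refine ⟨hr1, ?_⟩
        have h5 : (s ^ 2 - 1) * (8 * s ^ 2 - 3) = 0 := by
          have h6 : r ^ 4 = 1 := by rw [show r ^ 4 = (r ^ 2) ^ 2 by ring, hr1, one_pow]
          rw [hq1, h6, hr1] at hq2
          linear_combination -hq2
        rcases mul_eq_zero.1 h5 with h5 | h5 <;> omega
    · obtain ⟨p, q, e1, e2, e3, e4⟩ := exists_of_mul_eq_mul_pow_four hpos.1 hpos.2 one_pos
        (by norm_num) hcop (u := 1) (v := 7) (s := b) hPQ (one_dvd _) hd
      have ha : 4 * a ^ 2 = 7 * q ^ 4 + 22 * p ^ 2 * q ^ 2 - p ^ 4 := by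
        rw [e3] at hP hQ; linear_combination e2 - e1 + hP - hQ
      have hpq := e3 ▸ hbodd
      rw [Int.odd_mul] at hpq
      obtain ⟨t, ht⟩ := exists_sq_eq_of_odd hpq.1
      obtain ⟨u, hu⟩ := exists_sq_eq_of_odd hpq.2
      refine absurd ?_ (sq_emod_four_ne_three a)
      have : a ^ 2 = 7 + 4 * (28 * u ^ 2 + 7 * u + 88 * (t * u) + 11 * t + 11 * u - 4 * t ^ 2 - t) := by
        apply mul_left_cancel₀ (show (4 : ℤ) ≠ 0 by norm_num)
        rw [ha, show p ^ 4 = (p ^ 2) ^ 2 by ring, show q ^ 4 = (q ^ 2) ^ 2 by ring, ht, hu]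
        ring
      omega

end Int

/-! ### The descent for the curve `y² = x³ + (7/2)x² - (15/16)x` -/

namespace Int

/-- Modulo `3` the equation is `a² = 2q⁴ - p⁴ - p²q²`, which forces `3 ∣ a`. -/
theorem sq_ne_of_not_three_dvd {a p q u v w : ℤ} (ha : ¬ 3 ∣ a) (hu : u % 3 = 1) (hv : v % 3 = 2)
    (hw : w % 3 = 1) : a ^ 2 ≠ v * q ^ 4 - u * p ^ 4 - w * p ^ 2 * q ^ 2 := by
  intro h
  have key : ∀ a p q : ZMod 3, a ≠ 0 → a ^ 2 ≠ 2 * q ^ 4 - 1 * p ^ 4 - 1 * p ^ 2 * q ^ 2 := by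
    decide
  have hu' : (u : ZMod 3) = (1 : ℤ) := (ZMod.intCast_eq_intCast_iff' u 1 3).2 (by omega)
  have hv' : (v : ZMod 3) = (2 : ℤ) := (ZMod.intCast_eq_intCast_iff' v 2 3).2 (by omega)
  have hw' : (w : ZMod 3) = (1 : ℤ) := (ZMod.intCast_eq_intCast_iff' w 1 3).2 (by omega)
  refine key a p q (fun h0 => ha ?_) ?_
  · exact_mod_cast (ZMod.intCast_zmod_eq_zero_iff_dvd a 3).1 h0
  · have h1 := congrArg (Int.cast : ℤ → ZMod 3) h
    push_cast at h1
    rw [h1, hu', hv', hw']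
    push_cast
    ring

theorem three_dvd_of_sq_eq {a b c m : ℤ} (hb : ¬ 3 ∣ b) (h : c ^ 2 = 3 * m + 158 * a ^ 2 * b ^ 2) :
    3 ∣ a ∧ 3 ∣ c := by
  have key : ∀ a b c : ZMod 3, b ≠ 0 → c ^ 2 = 2 * a ^ 2 * b ^ 2 → a = 0 ∧ c = 0 := by decide
  have hz : ∀ x : ℤ, (x : ZMod 3) = 0 ↔ 3 ∣ x := fun x => by
    exact_mod_cast ZMod.intCast_zmod_eq_zero_iff_dvd x 3
  rw [← hz, ← hz]
  refine key a b c (fun h0 => hb ((hz b).1 h0)) ?_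
  have h1 := congrArg (Int.cast : ℤ → ZMod 3) h
  push_cast at h1
  rw [h1, show (3 : ZMod 3) = 0 from rfl, show (158 : ZMod 3) = 2 from rfl, zero_mul, zero_add]

/-- The descent for the quartic `c² = a⁴ + 158a²b² + 3⁸b⁴` prime to `3`: completing the square,
`(c - A)(c + A) = 320b⁴` with `A = a² + 79b²`. In the only splitting of the right-hand side without
a local obstruction, the formula for `a²` completes to a square in the same way, with `3⁸` in place
of `320`, and splitting once more gives a solution with a smaller `b`. -/
theorem eq_zero_of_quartic_of_not_three_dvd {a b c : ℤ}
    (h : c ^ 2 = a ^ 4 + 158 * a ^ 2 * b ^ 2 + 6561 * b ^ 4) (h3 : ¬ 3 ∣ a) (hab : IsCoprime a b) :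
    b = 0 := by
  induction hn : b.natAbs using Nat.strong_induction_on generalizing a b c with
  | _ n ih =>
  subst hn
  wlog hc : 0 ≤ c generalizing c
  · exact this (c := -c) (by rw [neg_sq, h]) (by omega)
  by_contra hb
  have hb2 : 0 < b ^ 2 := by positivity
  have hb4 : 0 < b ^ 4 := by positivity
  have hc0 : 0 < c := by
    refine lt_of_le_of_ne hc fun h0 => ?_
    rw [← h0] at h
    have : 0 ≤ a ^ 4 + 158 * a ^ 2 * b ^ 2 := by positivity
    linarith
  have h5p : Prime (5 : ℤ) := by norm_num
  have h3p : Prime (3 : ℤ) := by norm_num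
  have h2p : Prime (2 : ℤ) := Int.prime_two
  -- the second splitting, and the comparison of the new solution with the given one
  have step : ∀ {d y A p q m : ℤ}, y = d ^ 2 * q ^ 2 - 158 * p ^ 2 →
      y ^ 2 - A ^ 2 = 4 * 3 ^ 8 * p ^ 4 → 0 < y → ¬ 3 ∣ A → Even (y - A) → IsCoprime (d * q) p →
      b = p * (m * q) → 1 < q ^ 2 → False := by
    intro d y A p q m hy hyA hy0 hA heven hcop hbp hq
    have hp : p ≠ 0 := by rintro rfl; simp [hbp] at hb
    have hy3 : ¬ 3 ∣ y := fun hd => hA <| h3p.dvd_of_dvd_pow (n := 2) <| by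
      rw [show A ^ 2 = y * y - 3 * (4 * 3 ^ 7 * p ^ 4) by linear_combination -hyA]
      exact dvd_sub (hd.mul_right y) (dvd_mul_right _ _)
    have hyp : IsCoprime y p := by
      have h1 := (hcop.pow_left (m := 2)).add_mul_left_left (-158 * p)
      rwa [show (d * q) ^ 2 + p * (-158 * p) = y by rw [hy]; ring] at h1
    obtain ⟨r, s, f1, f2, f3⟩ := exists_eq_add_of_sq_sub_sq (k := 8) h3p (by norm_num) hyA hy0 hp
      heven ((h3p.coprime_iff_not_dvd.2 hy3).symm.pow_right) hyp
    have hs0 : s ≠ 0 := by rintro rfl; simp [f2] at hp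
    have hr3 : ¬ 3 ∣ r := fun hd => hy3 <| by
      rw [f1]
      exact dvd_add (dvd_pow hd (by norm_num)) ⟨3 ^ 7 * s ^ 4, by ring⟩
    by_cases hlt : s.natAbs < b.natAbs
    · refine hs0 (ih _ hlt (a := r) (c := d * q) ?_ hr3 f3 rfl)
      rw [f2] at hy
      linear_combination f1 - hy
    · have h1 := isUnit_of_not_natAbs_lt (m := r * m * q) hb (by rw [hbp, f2]; ring) hlt
      exact hq.ne' (sq_eq_one_of_isUnit (isUnit_of_mul_isUnit_right h1))
  -- powers of two are removed from `c ± A` until they are coprime, which depends on the parities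
  rcases Int.even_or_odd' b with ⟨β, hβ | hβ⟩
  · have hbeven : Even b := ⟨β, by rw [hβ]; ring⟩
    have hβ0 : β ≠ 0 := by rintro rfl; simp [hβ] at hb
    have haodd : Odd a := by
      rw [← Int.not_even_iff_odd]
      exact fun hae => h2p.not_isUnit (hab.isUnit_of_dvd' hae.two_dvd hbeven.two_dvd)
    have haβ : IsCoprime a β := by rw [hβ] at hab; exact hab.of_mul_right_right
    obtain ⟨A, hA⟩ : ∃ A, A = a ^ 2 + 316 * β ^ 2 := ⟨_, rfl⟩
    have hAodd : Odd A := by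
      rw [hA]
      exact haodd.pow.add_even ⟨158 * β ^ 2, by ring⟩
    have hAβ : IsCoprime A β := by
      have := (haβ.pow_left (m := 2)).add_mul_left_left (316 * β)
      rwa [show a ^ 2 + β * (316 * β) = A by rw [hA]; ring] at this
    have hcA : c ^ 2 - A ^ 2 = 4 * (1280 * β ^ 4) := by
      rw [hβ] at h
      rw [h, hA]; ring
    obtain ⟨P, Q, hPQ, hQP, hP0, hQ0, -⟩ := exists_factors_of_sq_sub_sq hc0 hcA (by positivity)
      (even_sub_of_sq_sub_sq hcA hAodd)
    have hcop := isCoprime_of_sub (m := 256) h5p hQP (by rw [hPQ]; ring) (by norm_num)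
      ((Int.isCoprime_two_left.2 hAodd).symm.pow_right (n := 8)) hAβ hP0.ne'
    rcases pow_dvd_or_pow_dvd h5p hcop (k := 1) ⟨256 * β ^ 4, by rw [hPQ]; ring⟩ with h5 | h5 <;>
    rcases pow_dvd_or_pow_dvd h2p hcop (k := 8) ⟨5 * β ^ 4, by rw [hPQ]; ring⟩ with h2 | h2
    · obtain ⟨p, q, rfl, rfl, e3, e4⟩ := exists_of_mul_eq_mul_pow_four hP0 hQ0 (u := 1280) (v := 1)
        (by norm_num) one_pos hcop (by rw [hPQ]; ring)
        (IsCoprime.mul_dvd (by norm_num) h2 h5) (one_dvd _)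
      have ha : a ^ 2 = q ^ 4 - 1280 * p ^ 4 - 316 * p ^ 2 * q ^ 2 := by
        rw [e3] at hA; linear_combination -hA - hQP
      have hp0 : p ≠ 0 := by rintro rfl; simp at hP0
      have hp1 : 0 < p ^ 2 := by positivity
      have hq : 320 * p ^ 2 ≤ q ^ 2 := by
        have h1 : 0 ≤ (q ^ 2 + 4 * p ^ 2) * (q ^ 2 - 320 * p ^ 2) := by
          rw [show (q ^ 2 + 4 * p ^ 2) * (q ^ 2 - 320 * p ^ 2) = a ^ 2 by rw [ha]; ring]
          positivity
        linarith [nonneg_of_mul_nonneg_right h1 (show 0 < q ^ 2 + 4 * p ^ 2 by positivity)]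
      have hy : (q ^ 2 - 158 * p ^ 2) ^ 2 - a ^ 2 = 4 * (3 ^ 8 * p ^ 4) := by rw [ha]; ring
      exact step (d := 1) (y := q ^ 2 - 158 * p ^ 2) (A := a) (p := p) (q := q) (m := 2) (by ring)
        (by rw [hy]; ring) (by linarith) h3 (even_sub_of_sq_sub_sq hy haodd)
        (by rw [one_mul]; exact e4.symm) (by rw [hβ, e3]; ring) (by linarith)
    · obtain ⟨p, q, rfl, rfl, e3, e4⟩ := exists_of_mul_eq_mul_pow_four hP0 hQ0 (u := 5) (v := 256)
        (by norm_num) (by norm_num) hcop (by rw [hPQ]; ring) h5 h2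
      have ha : a ^ 2 = 256 * q ^ 4 - 5 * p ^ 4 - 316 * p ^ 2 * q ^ 2 := by
        rw [e3] at hA; linear_combination -hA - hQP
      refine sq_emod_four_ne_three a ?_
      rcases Int.even_or_odd' p with ⟨t, rfl | rfl⟩
      · have : Even (a ^ 2) := by
          rw [ha]
          exact ⟨128 * q ^ 4 - 40 * t ^ 4 - 632 * t ^ 2 * q ^ 2, by ring⟩
        exact absurd haodd.pow (Int.not_odd_iff_even.2 this)
      · ring_nf at ha ⊢
        omega
    · obtain ⟨p, q, rfl, rfl, e3, e4⟩ := exists_of_mul_eq_mul_pow_four hP0 hQ0 (u := 256) (v := 5)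
        (by norm_num) (by norm_num) hcop (by rw [hPQ]; ring) h2 h5
      refine sq_ne_of_not_three_dvd h3 (p := p) (q := q) (u := 256) (v := 5) (w := 316)
        (by norm_num) (by norm_num) (by norm_num) ?_
      rw [e3] at hA
      linear_combination -hA - hQP
    · obtain ⟨p, q, rfl, rfl, e3, e4⟩ := exists_of_mul_eq_mul_pow_four hP0 hQ0 (u := 1) (v := 1280)
        one_pos (by norm_num) hcop (by rw [hPQ]; ring) (one_dvd _)
        (IsCoprime.mul_dvd (by norm_num) h2 h5)
      refine sq_ne_of_not_three_dvd h3 (p := p) (q := q) (u := 1) (v := 1280) (w := 316)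
        (by norm_num) (by norm_num) (by norm_num) ?_
      rw [e3] at hA
      linear_combination -hA - hQP
  have hbodd : Odd b := ⟨β, hβ⟩
  obtain ⟨A, hA⟩ : ∃ A, A = a ^ 2 + 79 * b ^ 2 := ⟨_, rfl⟩
  have hcA : c ^ 2 - A ^ 2 = 4 * (80 * b ^ 4) := by
    rw [h, hA]; ring
  have hAb : IsCoprime A b := by
    have := (hab.pow_left (m := 2)).add_mul_left_left (79 * b)
    rwa [show a ^ 2 + b * (79 * b) = A by rw [hA]; ring] at this
  rcases Int.even_or_odd a with haeven | haodd
  · have hAodd : Odd A := by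
      rw [hA]
      exact (haeven.pow_of_ne_zero two_ne_zero).add_odd
        ((show Odd (79 : ℤ) by decide).mul hbodd.pow)
    obtain ⟨P, Q, hPQ, hQP, hP0, hQ0, -⟩ := exists_factors_of_sq_sub_sq hc0 hcA (by positivity)
      (even_sub_of_sq_sub_sq hcA hAodd)
    have hcop := isCoprime_of_sub (m := 16) h5p hQP (by rw [hPQ]; ring) (by norm_num)
      ((Int.isCoprime_two_left.2 hAodd).symm.pow_right (n := 4)) hAb hP0.ne'
    rcases pow_dvd_or_pow_dvd h5p hcop (k := 1) ⟨16 * b ^ 4, by rw [hPQ]; ring⟩ with h5 | h5 <;>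
    rcases pow_dvd_or_pow_dvd h2p hcop (k := 4) ⟨5 * b ^ 4, by rw [hPQ]; ring⟩ with h2 | h2
    · obtain ⟨p, q, rfl, rfl, e3, e4⟩ := exists_of_mul_eq_mul_pow_four hP0 hQ0 (u := 80) (v := 1)
        (by norm_num) one_pos hcop (by rw [hPQ]; ring)
        (IsCoprime.mul_dvd (by norm_num) h2 h5) (one_dvd _)
      have ha : a ^ 2 = q ^ 4 - 80 * p ^ 4 - 79 * p ^ 2 * q ^ 2 := by
        rw [e3] at hA; linear_combination -hA - hQP
      rw [e3, Int.odd_mul] at hbodd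
      obtain ⟨t, ht⟩ := exists_sq_eq_of_odd hbodd.1
      obtain ⟨u, hu⟩ := exists_sq_eq_of_odd hbodd.2
      obtain ⟨α, rfl⟩ := haeven.two_dvd
      rw [show p ^ 4 = (p ^ 2) ^ 2 by ring, show q ^ 4 = (q ^ 2) ^ 2 by ring, ht, hu] at ha
      ring_nf at ha
      omega
    · obtain ⟨p, q, rfl, rfl, e3, e4⟩ := exists_of_mul_eq_mul_pow_four hP0 hQ0 (u := 5) (v := 16)
        (by norm_num) (by norm_num) hcop (by rw [hPQ]; ring) h5 h2
      have ha : a ^ 2 = 16 * q ^ 4 - 5 * p ^ 4 - 79 * p ^ 2 * q ^ 2 := by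
        rw [e3] at hA; linear_combination -hA - hQP
      have hp0 : p ≠ 0 := by rintro rfl; simp at hP0
      have hp1 : 0 < p ^ 2 := by positivity
      have hq : 5 * p ^ 2 ≤ q ^ 2 := by
        have h1 : 0 ≤ (16 * q ^ 2 + p ^ 2) * (q ^ 2 - 5 * p ^ 2) := by
          rw [show (16 * q ^ 2 + p ^ 2) * (q ^ 2 - 5 * p ^ 2) = a ^ 2 by rw [ha]; ring]
          positivity
        linarith [nonneg_of_mul_nonneg_right h1 (show 0 < 16 * q ^ 2 + p ^ 2 by positivity)]
      have hp2 : IsCoprime 2 p := Int.isCoprime_two_left.2 (Int.odd_mul.1 (e3 ▸ hbodd)).1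
      exact step (d := 8) (y := 64 * q ^ 2 - 158 * p ^ 2) (A := 16 * a) (p := p) (q := q) (m := 1)
        (by ring) (by rw [mul_pow, ha]; ring) (by linarith)
        (fun hd => h3 ((h3p.dvd_or_dvd hd).resolve_left (by norm_num)))
        ⟨32 * q ^ 2 - 79 * p ^ 2 - 8 * a, by ring⟩
        ((hp2.pow_left (m := 3)).mul_left e4.symm) (by rw [e3]; ring) (by linarith)
    · obtain ⟨p, q, rfl, rfl, e3, e4⟩ := exists_of_mul_eq_mul_pow_four hP0 hQ0 (u := 16) (v := 5)
        (by norm_num) (by norm_num) hcop (by rw [hPQ]; ring) h2 h5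
      refine sq_ne_of_not_three_dvd h3 (p := p) (q := q) (u := 16) (v := 5) (w := 79)
        (by norm_num) (by norm_num) (by norm_num) ?_
      rw [e3] at hA
      linear_combination -hA - hQP
    · obtain ⟨p, q, rfl, rfl, e3, e4⟩ := exists_of_mul_eq_mul_pow_four hP0 hQ0 (u := 1) (v := 80)
        one_pos (by norm_num) hcop (by rw [hPQ]; ring) (one_dvd _)
        (IsCoprime.mul_dvd (by norm_num) h2 h5)
      refine sq_ne_of_not_three_dvd h3 (p := p) (q := q) (u := 1) (v := 80) (w := 79)
        (by norm_num) (by norm_num) (by norm_num) ?_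
      rw [e3] at hA
      linear_combination -hA - hQP
  · -- here `8` divides both `A` and `c`
    obtain ⟨t, ht⟩ := exists_sq_eq_of_odd haodd
    obtain ⟨u, hu⟩ := exists_sq_eq_of_odd hbodd
    obtain ⟨k, hk⟩ : ∃ k, k = t + 79 * u + 10 := ⟨_, rfl⟩
    have hAk : A = 8 * k := by rw [hA, ht, hu, hk]; ring
    obtain ⟨c, rfl⟩ : 8 ∣ c := (Int.pow_dvd_pow_iff two_ne_zero).1
      ⟨k ^ 2 + 5 * b ^ 4, by rw [hAk] at hcA; linear_combination hcA⟩
    have hck : (2 * c) ^ 2 - (2 * k) ^ 2 = 4 * (5 * b ^ 4) := by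
      apply mul_left_cancel₀ (show (16 : ℤ) ≠ 0 by norm_num)
      rw [hAk] at hcA
      linear_combination hcA
    obtain ⟨P, Q, hPQ, hQP, hP0, hQ0, -⟩ := exists_factors_of_sq_sub_sq (by omega) hck (by positivity)
      ⟨c - k, by ring⟩
    have hkb : IsCoprime (2 * k) b :=
      (Int.isCoprime_two_left.2 hbodd).mul_left (hAk ▸ hAb).of_mul_left_right
    have hcop := isCoprime_of_sub (m := 1) h5p hQP (by rw [hPQ]; ring) (by norm_num)
      isCoprime_one_right hkb hP0.ne'
    rcases pow_dvd_or_pow_dvd h5p hcop (k := 1) ⟨b ^ 4, by rw [hPQ]; ring⟩ with h5 | h5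
    · obtain ⟨p, q, rfl, rfl, e3, e4⟩ := exists_of_mul_eq_mul_pow_four hP0 hQ0 (u := 5) (v := 1)
        (by norm_num) one_pos hcop (by rw [hPQ]; ring) h5 (one_dvd _)
      have ha : a ^ 2 = 4 * q ^ 4 - 20 * p ^ 4 - 79 * p ^ 2 * q ^ 2 := by
        rw [hAk, e3] at hA; linear_combination -hA - 4 * hQP
      have hp0 : p ≠ 0 := by rintro rfl; simp at hP0
      have hp1 : 0 < p ^ 2 := by positivity
      have hq : 20 * p ^ 2 ≤ q ^ 2 := by
        have h1 : 0 ≤ (4 * q ^ 2 + p ^ 2) * (q ^ 2 - 20 * p ^ 2) := by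
          rw [show (4 * q ^ 2 + p ^ 2) * (q ^ 2 - 20 * p ^ 2) = a ^ 2 by rw [ha]; ring]
          positivity
        linarith [nonneg_of_mul_nonneg_right h1 (show 0 < 4 * q ^ 2 + p ^ 2 by positivity)]
      have hp2 : IsCoprime 2 p := Int.isCoprime_two_left.2 (Int.odd_mul.1 (e3 ▸ hbodd)).1
      exact step (d := 4) (y := 16 * q ^ 2 - 158 * p ^ 2) (A := 8 * a) (p := p) (q := q) (m := 1)
        (by ring) (by rw [mul_pow, ha]; ring) (by linarith)
        (fun hd => h3 ((h3p.dvd_or_dvd hd).resolve_left (by norm_num)))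
        ⟨8 * q ^ 2 - 79 * p ^ 2 - 4 * a, by ring⟩
        ((hp2.pow_left (m := 2)).mul_left e4.symm) (by rw [e3]; ring) (by linarith)
    · obtain ⟨p, q, rfl, rfl, e3, e4⟩ := exists_of_mul_eq_mul_pow_four hP0 hQ0 (u := 1) (v := 5)
        one_pos (by norm_num) hcop (by rw [hPQ]; ring) (one_dvd _) h5
      refine sq_ne_of_not_three_dvd h3 (p := p) (q := q) (u := 4) (v := 20) (w := 79)
        (by norm_num) (by norm_num) (by norm_num) ?_
      rw [hAk, e3] at hA
      linear_combination -hA - 4 * hQP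

/-- When `3` divides `a`, then so does `81`, and the roles of `a / 81` and `b` are exchanged. -/
theorem eq_zero_or_eq_zero_of_quartic {a b c : ℤ}
    (h : c ^ 2 = a ^ 4 + 158 * a ^ 2 * b ^ 2 + 6561 * b ^ 4) (hab : IsCoprime a b) :
    a = 0 ∨ b = 0 := by
  by_cases h3 : 3 ∣ a
  · left
    have h3p : Prime (3 : ℤ) := by norm_num
    have hb : ¬ 3 ∣ b := fun hd => h3p.not_isUnit (hab.isUnit_of_dvd' h3 hd)
    have h9 : (9 : ℤ) ≠ 0 := by norm_num
    obtain ⟨a, rfl⟩ := h3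
    obtain ⟨c, rfl⟩ := h3p.dvd_of_dvd_pow (show 3 ∣ c ^ 2 from
      ⟨27 * a ^ 4 + 474 * a ^ 2 * b ^ 2 + 2187 * b ^ 4, by linear_combination h⟩)
    have h : c ^ 2 = 3 * (3 * a ^ 4 + 243 * b ^ 4) + 158 * a ^ 2 * b ^ 2 := by
      apply mul_left_cancel₀ h9; linear_combination h
    obtain ⟨⟨a, rfl⟩, c, rfl⟩ := three_dvd_of_sq_eq hb h
    have h : c ^ 2 = 3 * (27 * a ^ 4 + 27 * b ^ 4) + 158 * a ^ 2 * b ^ 2 := by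
      apply mul_left_cancel₀ h9; linear_combination h
    obtain ⟨⟨a, rfl⟩, c, rfl⟩ := three_dvd_of_sq_eq hb h
    have h : c ^ 2 = 3 * (243 * a ^ 4 + 3 * b ^ 4) + 158 * a ^ 2 * b ^ 2 := by
      apply mul_left_cancel₀ h9; linear_combination h
    obtain ⟨⟨a, rfl⟩, c, rfl⟩ := three_dvd_of_sq_eq hb h
    have h : c ^ 2 = b ^ 4 + 158 * b ^ 2 * a ^ 2 + 6561 * a ^ 4 := by
      apply mul_left_cancel₀ h9; linear_combination h
    have hba : IsCoprime b a := by
      have := hab.of_mul_left_right.of_mul_left_right.of_mul_left_right.of_mul_left_right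
      exact this.symm
    rw [eq_zero_of_quartic_of_not_three_dvd h hb hba]
    ring
  · exact Or.inr (eq_zero_of_quartic_of_not_three_dvd h h3 hab)

end Int

/-! ### Rational points of the two elliptic curves -/

section RationalPoints

/-- A rational point on `v² = x⁴ + ex² + f`, cleared of denominators. -/
theorem Rat.exists_int_of_sq_eq_quartic {v x : ℚ} {e f : ℤ} (h : v ^ 2 = x ^ 4 + e * x ^ 2 + f) :
    ∃ a b c : ℤ, b ≠ 0 ∧ IsCoprime a b ∧ x = a / b ∧
      c ^ 2 = a ^ 4 + e * a ^ 2 * b ^ 2 + f * b ^ 4 := by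
  have hb : (x.den : ℚ) ≠ 0 := by exact_mod_cast x.den_ne_zero
  have hx : x = x.num / (x.den : ℤ) := by exact_mod_cast (Rat.num_div_den x).symm
  have hsq : IsSquare ((x.num ^ 4 + e * x.num ^ 2 * (x.den : ℤ) ^ 2 + f * (x.den : ℤ) ^ 4 : ℤ) : ℚ) := by
    refine ⟨v * (x.den : ℚ) ^ 2, ?_⟩
    have hnum : (x.num : ℚ) = x * x.den := (Rat.mul_den_eq_num x).symm
    push_cast
    rw [hnum]
    linear_combination -(x.den : ℚ) ^ 4 * h
  obtain ⟨c, hc⟩ := Rat.isSquare_intCast_iff.1 hsq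
  exact ⟨x.num, x.den, c, by exact_mod_cast x.den_ne_zero,
    Int.isCoprime_iff_gcd_eq_one.2 x.reduced, hx, by rw [hc, sq]⟩

theorem Rat.sq_eq_four_of_quartic {v x : ℚ} (h : v ^ 2 = x ^ 4 - 11 * x ^ 2 + 32) : x ^ 2 = 4 := by
  obtain ⟨a, b, c, hb, hab, rfl, hc⟩ := Rat.exists_int_of_sq_eq_quartic (v := v) (x := x)
    (e := -11) (f := 32) (by push_cast; linear_combination h)
  have h4 := Int.sq_eq_four_mul_sq_of_quartic (c := c) (by rw [hc]; ring) hb hab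
  have hb' : (b : ℚ) ≠ 0 := by exact_mod_cast hb
  rw [div_pow, div_eq_iff (by positivity)]
  exact_mod_cast h4

theorem Rat.eq_zero_of_quartic {w u : ℚ} (h : w ^ 2 = u ^ 4 + 158 * u ^ 2 + 6561) : u = 0 := by
  obtain ⟨a, b, c, hb, hab, rfl, hc⟩ := Rat.exists_int_of_sq_eq_quartic (v := w) (x := u)
    (e := 158) (f := 6561) (by push_cast; linear_combination h)
  rcases Int.eq_zero_or_eq_zero_of_quartic hc hab with rfl | h0
  · simp
  · exact absurd h0 hb

/-- The standard `2`-isogeny with kernel `{∞, (0, 0)}`. -/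
theorem isogeny_two_equation {F : Type*} [Field F] {x y a b : F} (hx : x ≠ 0)
    (h : y ^ 2 = x * (x ^ 2 + a * x + b)) :
    (y * (x ^ 2 - b) / x ^ 2) ^ 2
      = (y / x) ^ 2 * (((y / x) ^ 2) ^ 2 - 2 * a * (y / x) ^ 2 + (a ^ 2 - 4 * b)) := by
  have hyx : (y / x) ^ 2 = (x ^ 2 + a * x + b) / x := by
    rw [div_pow, h]; field_simp
  have h1 : (y * (x ^ 2 - b) / x ^ 2) ^ 2 = (y / x) ^ 2 * ((x ^ 2 - b) / x) ^ 2 := by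
    field_simp
  rw [h1, hyx]
  field_simp
  ring

/-- The two successive `2`-isogenies `y² = x(x + 1)(x + 16) → y² = x(x - 9)(x - 25)` and
`y² = x(x + 16)(x + 25) → y² = x(x - 1)(x - 81)` lead to the quartic
`w² = u⁴ + 158u² + 3⁸`. -/
theorem eq_zero_or_sq_eq_of_equation {x y : ℚ} (h : y ^ 2 = x * (x ^ 2 + 17 * x + 16)) :
    y = 0 ∨ x ^ 2 = 16 := by
  by_contra! hne
  obtain ⟨hy, h16⟩ := hne
  have hx : x ≠ 0 := by rintro rfl; simp at h; exact hy h
  have h1 := isogeny_two_equation hx h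
  obtain ⟨s, hs⟩ : ∃ s, s = y / x := ⟨_, rfl⟩
  obtain ⟨t, ht⟩ : ∃ t, t = y * (x ^ 2 - 16) / x ^ 2 := ⟨_, rfl⟩
  rw [← hs, ← ht] at h1
  have hsx : s ^ 2 * x = x ^ 2 + 17 * x + 16 := by
    rw [hs, div_pow, h]; field_simp
  have ht0 : t ≠ 0 := by
    rw [ht]
    exact div_ne_zero (mul_ne_zero hy (sub_ne_zero.2 h16)) (pow_ne_zero 2 hx)
  obtain ⟨z, hz⟩ : ∃ z, z = s ^ 2 - 25 := ⟨_, rfl⟩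
  have hs2 : s ^ 2 = z + 25 := by rw [hz]; ring
  have hz0 : z ≠ 0 := by
    rintro rfl
    rw [hs2] at hsx
    have : (x - 4) ^ 2 = 0 := by linear_combination -hsx
    have : x = 4 := sub_eq_zero.1 (pow_eq_zero_iff two_ne_zero |>.1 this)
    exact h16 (by rw [this]; norm_num)
  have hsq : ∀ {q : ℚ}, ¬ IsSquare q → s ^ 2 ≠ q := fun hq he => hq ⟨s, by rw [← he, sq]⟩
  have hz20 : z ≠ -20 := fun he => hsq (q := 5) (by norm_num) (by rw [hs2, he]; norm_num)
  have hz20' : z ≠ 20 := fun he => hsq (q := 45) (by norm_num) (by rw [hs2, he]; norm_num)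
  have h2 : t ^ 2 = z * (z ^ 2 + 41 * z + 400) := by rw [h1, hs2]; ring
  have h3 := isogeny_two_equation hz0 h2
  obtain ⟨m, hm⟩ : ∃ m, m = t / z := ⟨_, rfl⟩
  obtain ⟨n, hn⟩ : ∃ n, n = t * (z ^ 2 - 400) / z ^ 2 := ⟨_, rfl⟩
  rw [← hm, ← hn] at h3
  have hmz : m ^ 2 * z = z ^ 2 + 41 * z + 400 := by
    rw [hm, div_pow, h2]; field_simp
  have hn0 : n ≠ 0 := by
    rw [hn]
    refine div_ne_zero (mul_ne_zero ht0 ?_) (pow_ne_zero 2 hz0)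
    rw [show z ^ 2 - 400 = (z - 20) * (z - -20) by ring]
    exact mul_ne_zero (sub_ne_zero.2 hz20') (sub_ne_zero.2 hz20)
  obtain ⟨g, hg⟩ : ∃ g, g = m ^ 2 - 1 := ⟨_, rfl⟩
  have hm2 : m ^ 2 = g + 1 := by rw [hg]; ring
  have hg0 : g ≠ 0 := by
    rintro rfl
    rw [hm2] at hmz
    have : (z + 20) ^ 2 = 0 := by linear_combination -hmz
    exact hz20 (eq_neg_of_add_eq_zero_left (pow_eq_zero_iff two_ne_zero |>.1 this))
  have h4 : n ^ 2 = (g + 1) * g * (g - 80) := by rw [h3, hm2]; ring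
  have hu : (n / g) ^ 2 = (g + 1) * (g - 80) / g := by
    rw [div_pow, h4]; field_simp
  have hw : (g + 80 / g) ^ 2 = (n / g) ^ 4 + 158 * (n / g) ^ 2 + 6561 := by
    rw [show (n / g) ^ 4 = ((n / g) ^ 2) ^ 2 by ring, hu]
    field_simp
    ring
  exact div_ne_zero hn0 hg0 (Rat.eq_zero_of_quartic hw)

theorem equation_curveE_iff (x y : ℚ) : curveE.Equation x y ↔
    (x, y) ∈ ({(0, 0), (-3 / 4, -3 / 2), (-3 / 4, 3 / 2), (1 / 4, 0), (5 / 4, -5 / 2),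
      (5 / 4, 5 / 2), (-15 / 4, 0)} : Set (ℚ × ℚ)) := by
  simp only [WeierstrassCurve.Affine.equation_iff, curveE, Set.mem_insert_iff, Set.mem_singleton_iff,
    Prod.mk.injEq]
  constructor
  · intro h
    have h1 := eq_zero_or_sq_eq_of_equation (x := 4 * x - 1) (y := 8 * y) (by linear_combination 64 * h)
    rcases h1 with h1 | h1
    · obtain rfl : y = 0 := by linarith
      have : x * (x - 1 / 4) * (x + 15 / 4) = 0 := by linear_combination -h
      rcases mul_eq_zero.1 this with h2 | h2
      · rcases mul_eq_zero.1 h2 with h2 | h2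
        · simp [h2]
        · simp [show x = 1 / 4 by linarith]
      · simp [show x = -15 / 4 by linarith]
    · have : (x - 5 / 4) * (x + 3 / 4) = 0 := by linear_combination h1 / 16
      rcases mul_eq_zero.1 this with h2 | h2
      · obtain rfl : x = 5 / 4 := by linarith
        have : (y - 5 / 2) * (y + 5 / 2) = 0 := by linear_combination h
        rcases mul_eq_zero.1 this with h3 | h3
        · simp [show y = 5 / 2 by linarith]
        · simp [show y = -5 / 2 by linarith]
      · obtain rfl : x = -3 / 4 := by linarith
        have : (y - 3 / 2) * (y + 3 / 2) = 0 := by linear_combination h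
        rcases mul_eq_zero.1 this with h3 | h3
        · simp [show y = 3 / 2 by linarith]
        · simp [show y = -3 / 2 by linarith]
  · rintro (h | h | h | h | h | h | h) <;> obtain ⟨rfl, rfl⟩ := h <;> norm_num

theorem mem_of_equation_curveE' {x y : ℚ} (h : curveE'.Equation x y) :
    (x, y) ∈ ({(0, 0), (1, 4), (1, -4), (-7, 28), (-7, -28)} : Set (ℚ × ℚ)) := by
  simp only [WeierstrassCurve.Affine.equation_iff, curveE'] at h
  simp only [Set.mem_insert_iff, Set.mem_singleton_iff, Prod.mk.injEq]
  by_cases hx : x = 0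
  · subst hx
    left
    simpa using h
  · right
    obtain ⟨u, hu⟩ : ∃ u, u = y / (2 * x) := ⟨_, rfl⟩
    obtain rfl : y = 2 * x * u := by rw [hu]; field_simp
    have h1 : 4 * x * u ^ 2 = x ^ 2 + 22 * x - 7 := by
      apply mul_left_cancel₀ hx
      linear_combination h
    have h2 := Rat.sq_eq_four_of_quartic (v := (x - 2 * u ^ 2 + 11) / 2) (x := u)
      (by linear_combination -h1 / 4)
    have h3 : (x - 1) * (x + 7) = 0 := by linear_combination 4 * x * h2 - h1
    have h4 : (u - 2) * (u + 2) = 0 := by linear_combination h2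
    rcases mul_eq_zero.1 h3 with h3 | h3 <;> rcases mul_eq_zero.1 h4 with h4 | h4
    · obtain rfl : x = 1 := by linarith
      obtain rfl : u = 2 := by linarith
      norm_num
    · obtain rfl : x = 1 := by linarith
      obtain rfl : u = -2 := by linarith
      norm_num
    · obtain rfl : x = -7 := by linarith
      obtain rfl : u = 2 := by linarith
      norm_num
    · obtain rfl : x = -7 := by linarith
      obtain rfl : u = -2 := by linarith
      norm_num

namespace WeierstrassCurve.Affine.Point

/-- The points of an elliptic curve are the solutions of the equation and the point at infinity. -/
def equivOptionEquation {F : Type*} [Field F] (W : WeierstrassCurve.Affine F) [W.IsElliptic] :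
    W.Point ≃ Option {p : F × F // W.Equation p.1 p.2} where
  toFun
    | 0 => none
    | some x y h => Option.some ⟨(x, y), h.1⟩
  invFun
    | none => 0
    | Option.some p => some p.1.1 p.1.2 (equation_iff_nonsingular.1 p.2)
  left_inv P := by cases P <;> rfl
  right_inv p := by cases p <;> rfl

theorem isOfFinAddOrder_of_finite {F : Type*} [Field F] [DecidableEq F]
    (W : WeierstrassCurve.Affine F) [W.IsElliptic]
    {S : Set (F × F)} (hS : S.Finite) (h : ∀ x y, W.Equation x y → (x, y) ∈ S) (P : W.Point) :
    IsOfFinAddOrder P := by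
  have : Finite {p : F × F // W.Equation p.1 p.2} := hS.subset fun p hp => h p.1 p.2 hp
  have := Finite.of_equiv _ (equivOptionEquation W).symm
  exact _root_.isOfFinAddOrder_of_finite P

theorem rank_eq_zero {F : Type*} [Field F] [DecidableEq F]
    {W : WeierstrassCurve.Affine F} (h : ∀ P : W.Point, IsOfFinAddOrder P) :
    Module.rank ℤ W.Point = 0 := by
  rw [rank_eq_zero_iff]
  intro P
  obtain ⟨n, hn, hP⟩ := isOfFinAddOrder_iff_nsmul_eq_zero.1 (h P)
  exact ⟨n, by exact_mod_cast hn.ne', by rw [natCast_zsmul, hP]⟩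

end WeierstrassCurve.Affine.Point

theorem isOfFinAddOrder_curveE (P : curveE.Point) : IsOfFinAddOrder P :=
  WeierstrassCurve.Affine.Point.isOfFinAddOrder_of_finite curveE (Set.toFinite _)
    (fun x y => (equation_curveE_iff x y).1) P

theorem isOfFinAddOrder_curveE' (P : curveE'.Point) : IsOfFinAddOrder P :=
  WeierstrassCurve.Affine.Point.isOfFinAddOrder_of_finite curveE' (Set.toFinite _)
    (fun _ _ => mem_of_equation_curveE') P

theorem card_point_curveE : Nat.card curveE.Point = 8 := by
  obtain ⟨S, hS⟩ : ∃ S : Finset (ℚ × ℚ), S = {(0, 0), (-3 / 4, -3 / 2), (-3 / 4, 3 / 2),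
    (1 / 4, 0), (5 / 4, -5 / 2), (5 / 4, 5 / 2), (-15 / 4, 0)} := ⟨_, rfl⟩
  have h7 : S.card = 7 := by rw [hS]; norm_num [Finset.card_insert_of_notMem]
  have : {p : ℚ × ℚ | curveE.Equation p.1 p.2} = S := by
    ext p
    rw [Set.mem_ofPred_eq, equation_curveE_iff, hS]
    simp
  have hc : Nat.card {p : ℚ × ℚ // curveE.Equation p.1 p.2} = 7 :=
    (Nat.card_congr (Equiv.setCongr this)).trans (by simp [h7])
  have : Finite {p : ℚ × ℚ // curveE.Equation p.1 p.2} := Nat.finite_of_card_ne_zero (by omega)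
  rw [Nat.card_congr (WeierstrassCurve.Affine.Point.equivOptionEquation curveE), Finite.card_option, hc]

end RationalPoints

/-! ### Points and smoothness of the quartic -/

section Quartic

open MvPolynomial

theorem isHomogeneous_cianiInt : cianiInt.IsHomogeneous 4 := by
  have h4 : ∀ (c : ℤ) i, (C c * X i ^ 4 : MvPolynomial (Fin 3) ℤ).IsHomogeneous 4 := fun c i =>
    isHomogeneous_C_mul_X_pow c i 4
  have h22 : ∀ (c : ℤ) i j, (C c * X i ^ 2 * X j ^ 2 : MvPolynomial (Fin 3) ℤ).IsHomogeneous 4 :=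
    fun c i j => (isHomogeneous_C_mul_X_pow c i 2).mul ((isHomogeneous_X ℤ j).pow 2)
  exact (((((h4 15 0).add (h4 112 1)).add (h4 112 2)).add (h22 288 1 2)).sub (h22 88 0 2)).sub
    (h22 88 0 1)

variable {k : Type} [Field k]

theorem eval_map_cianiInt (v : Fin 3 → k) :
    eval v (map (Int.castRingHom k) cianiInt) = 15 * v 0 ^ 4 + 112 * v 1 ^ 4 + 112 * v 2 ^ 4
      + 288 * v 1 ^ 2 * v 2 ^ 2 - 88 * v 0 ^ 2 * v 2 ^ 2 - 88 * v 0 ^ 2 * v 1 ^ 2 := by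
  simp [cianiInt]

/-- The partial derivatives of the quartic, up to constants, have no common zero. -/
theorem eq_zero_of_partials_eq_zero {K : Type*} [Field K] (h2 : (2 : K) ≠ 0) (h15 : (15 : K) ≠ 0)
    (h7 : (7 : K) ≠ 0) {x y z : K} (hx : x * (15 * x ^ 2 - 44 * (y ^ 2 + z ^ 2)) = 0)
    (hy : y * (28 * y ^ 2 + 36 * z ^ 2 - 11 * x ^ 2) = 0)
    (hz : z * (28 * z ^ 2 + 36 * y ^ 2 - 11 * x ^ 2) = 0) : x = 0 ∧ y = 0 ∧ z = 0 := by
  have hp : ∀ (n : ℕ) {a : K}, 2 ^ n * a ^ 2 = 0 → a = 0 := fun n a ha =>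
    pow_eq_zero_iff two_ne_zero |>.1 ((mul_eq_zero.1 ha).resolve_left (pow_ne_zero n h2))
  have h15' : ∀ {a : K}, 15 * a ^ 2 = 0 → a = 0 := fun ha =>
    pow_eq_zero_iff two_ne_zero |>.1 ((mul_eq_zero.1 ha).resolve_left h15)
  have h28' : ∀ {a : K}, 28 * a ^ 2 = 0 → a = 0 := fun {a} ha => hp 2 <|
    (mul_eq_zero.1 (show 7 * (2 ^ 2 * a ^ 2) = 0 by linear_combination ha)).resolve_left h7
  rcases mul_eq_zero.1 hx with x0 | hx <;> rcases mul_eq_zero.1 hy with y0 | hy <;>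
    rcases mul_eq_zero.1 hz with z0 | hz
  · exact ⟨x0, y0, z0⟩
  · subst x0 y0
    exact ⟨rfl, rfl, h28' (by linear_combination hz)⟩
  · subst x0 z0
    exact ⟨rfl, h28' (by linear_combination hy), rfl⟩
  · subst x0
    exact ⟨rfl, hp 9 (by linear_combination 36 * hz - 28 * hy),
      hp 9 (by linear_combination 36 * hy - 28 * hz)⟩
  · subst y0 z0
    exact ⟨h15' (by linear_combination hx), rfl, rfl⟩
  · subst y0
    exact ⟨hp 6 (by linear_combination -28 * hx - 44 * hz), rfl,
      hp 6 (by linear_combination -11 * hx - 15 * hz)⟩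
  · subst z0
    exact ⟨hp 6 (by linear_combination -28 * hx - 44 * hy),
      hp 6 (by linear_combination -11 * hx - 15 * hy), rfl⟩
  · have hyz : 2 ^ 3 * y ^ 2 = 2 ^ 3 * z ^ 2 := by linear_combination hz - hy
    have hy0 : y = 0 := hp 6 (by
      linear_combination -88 * hx - 120 * hy + (-56) * hyz)
    have hz0 : z = 0 := hp 3 (by rw [← hyz, hy0]; ring)
    subst hy0 hz0
    exact ⟨h15' (by linear_combination hx), rfl, rfl⟩

theorem isSmooth_map_cianiInt (h2 : (2 : k) ≠ 0) (h15 : (15 : k) ≠ 0) (h7 : (7 : k) ≠ 0) :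
    PlaneCurve.IsSmooth (map (Int.castRingHom k) cianiInt) := by
  intro v hv _
  by_contra! h
  have hne : ∀ {n : ℕ} [n.AtLeastTwo], (OfNat.ofNat n : k) ≠ 0 →
      (OfNat.ofNat n : AlgebraicClosure k) ≠ 0 := fun {n} _ hn => by
    rw [← map_ofNat (algebraMap k (AlgebraicClosure k)) n]
    exact (map_ne_zero _).2 hn
  have h2 := hne h2
  have h15 := hne h15
  have h7 := hne h7
  have e0 := h 0
  have e1 := h 1
  have e2 := h 2
  have hd : ∀ (i : Fin 3) (n : ℕ) [n.AtLeastTwo],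
      pderiv i (OfNat.ofNat n : MvPolynomial (Fin 3) k) = 0 := fun i n _ => by
    rw [← map_ofNat C n, pderiv_C]
  simp only [cianiInt, map_add, map_sub, map_mul, map_pow, map_ofNat, map_X, Derivation.leibniz,
    Derivation.leibniz_pow, pderiv_X, hd] at e0 e1 e2
  simp at e0 e1 e2
  have h4 : (2 : AlgebraicClosure k) ^ 4 ≠ 0 := pow_ne_zero 4 h2
  have key := eq_zero_of_partials_eq_zero h2 h15 h7 (x := v 0) (y := v 1) (z := v 2)
    (mul_left_cancel₀ h4 (by linear_combination 4 * e0))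
    (mul_left_cancel₀ h4 (by linear_combination e1))
    (mul_left_cancel₀ h4 (by linear_combination e2))
  exact hv (_root_.funext fun i => by fin_cases i <;> simp [key])

theorem mk_mem_points_map_cianiInt {v : Fin 3 → k} (hv : v ≠ 0) :
    Projectivization.mk k v hv ∈ PlaneCurve.points (map (Int.castRingHom k) cianiInt) ↔
      15 * v 0 ^ 4 + 112 * v 1 ^ 4 + 112 * v 2 ^ 4
      + 288 * v 1 ^ 2 * v 2 ^ 2 - 88 * v 0 ^ 2 * v 2 ^ 2 - 88 * v 0 ^ 2 * v 1 ^ 2 = 0 := by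
  obtain ⟨a, ha⟩ := Projectivization.exists_smul_eq_mk_rep k v hv
  change eval (Projectivization.mk k v hv).rep _ = 0 ↔ _
  rw [← ha, eval_map_cianiInt]
  refine Iff.trans ?_ (mul_eq_zero_iff_left (pow_ne_zero 4 a.ne_zero))
  simp only [Pi.smul_apply, Units.smul_def, smul_eq_mul]
  ring_nf

/-- The points of the quartic over a field, from those in the chart `Z ≠ 0`. The points on the line
`Z = 0` are reduced to these by the symmetry in `Y` and `Z`. -/
theorem points_map_cianiInt {c : k} (hc : c = -2) (h15 : (15 : k) ≠ 0)
    (h : ∀ x y : k, 15 * x ^ 4 + 112 * y ^ 4 + 112 + 288 * y ^ 2 - 88 * x ^ 2 - 88 * x ^ 2 * y ^ 2 = 0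
      → (x = 2 ∨ x = -2) ∧ y = 0) :
    PlaneCurve.points (map (Int.castRingHom k) cianiInt) =
      {Projectivization.mk k ![2, 1, 0] (by simp), Projectivization.mk k ![c, 1, 0] (by simp),
        Projectivization.mk k ![2, 0, 1] (by simp), Projectivization.mk k ![c, 0, 1] (by simp)} := by
  subst hc
  ext P
  induction P using Projectivization.ind with | _ v hv
  rw [mk_mem_points_map_cianiInt]
  simp only [Set.mem_insert_iff, Set.mem_singleton_iff, Projectivization.mk_eq_mk_iff']
  constructor
  · intro hF
    by_cases hz : v 2 = 0
    · by_cases hy : v 1 = 0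
      · rw [hy, hz] at hF
        have hx : v 0 = 0 := by simpa [h15] using hF
        exact absurd (_root_.funext fun i => by fin_cases i <;> simp [hx, hy, hz]) hv
      · obtain ⟨hx, -⟩ := h (v 0 / v 1) 0 (by
          rw [hz] at hF
          field_simp
          linear_combination hF)
        rw [div_eq_iff hy, div_eq_iff hy] at hx
        rcases hx with hx | hx
        · left
          exact ⟨v 1, _root_.funext fun i => by fin_cases i <;> simp [hx, hz, mul_comm]⟩
        · right; left
          exact ⟨v 1, _root_.funext fun i => by fin_cases i <;> simp [hx, hz, mul_comm]⟩
    · obtain ⟨hx, hy⟩ := h (v 0 / v 2) (v 1 / v 2) (by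
          field_simp
          linear_combination hF)
      rw [div_eq_iff hz, div_eq_iff hz] at hx
      have hy : v 1 = 0 := by simpa [hz] using hy
      rcases hx with hx | hx
      · right; right; left
        exact ⟨v 2, _root_.funext fun i => by fin_cases i <;> simp [hx, hy, mul_comm]⟩
      · right; right; right
        exact ⟨v 2, _root_.funext fun i => by fin_cases i <;> simp [hx, hy, mul_comm]⟩
  · rintro (⟨a, ha⟩ | ⟨a, ha⟩ | ⟨a, ha⟩ | ⟨a, ha⟩) <;> rw [← ha] <;> simp <;> ring

theorem ncard_points_map_cianiInt {c : k} (hc : c = -2) (h2 : (2 : k) ≠ 0) :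
    ({Projectivization.mk k ![2, 1, 0] (by simp), Projectivization.mk k ![c, 1, 0] (by simp),
        Projectivization.mk k ![2, 0, 1] (by simp), Projectivization.mk k ![c, 0, 1] (by simp)} :
        Set (ℙ k (Fin 3 → k))).ncard = 4 := by
  have h4 : (2 : k) ≠ -2 := fun h => h2 (by
    have : (2 : k) * 2 = 0 := by linear_combination h
    simpa using this)
  subst hc
  rw [Set.ncard_insert_of_notMem, Set.ncard_insert_of_notMem, Set.ncard_pair]
  all_goals
    simp only [Set.mem_insert_iff, Set.mem_singleton_iff, ne_eq, Projectivization.mk_eq_mk_iff',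
      not_or, not_exists]
  · intro a ha
    have e0 := congrFun ha 0
    have e2 := congrFun ha 2
    simp at e0 e2
    simp_all
  · refine ⟨fun a ha => ?_, fun a ha => ?_⟩ <;> simpa using congrFun ha 1
  · refine ⟨fun a ha => ?_, fun a ha => ?_, fun a ha => ?_⟩
    · have e0 := congrFun ha 0
      have e1 := congrFun ha 1
      simp at e0 e1
      simp_all
    · simpa using congrFun ha 1
    · simpa using congrFun ha 1

/-- The rational points of the quartic with `Z ≠ 0`, found from their images on `E`. -/
theorem eq_of_ciani_affine_equation_rat {x y : ℚ}
    (h : 15 * x ^ 4 + 112 * y ^ 4 + 112 + 288 * y ^ 2 - 88 * x ^ 2 - 88 * x ^ 2 * y ^ 2 = 0) :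
    (x = 2 ∨ x = -2) ∧ y = 0 := by
  obtain ⟨t, ht⟩ : ∃ t, t = (15 * x ^ 2 - 28 * y ^ 2 - 58) / 8 := ⟨_, rfl⟩
  have hx : x ^ 2 = (8 * t + 28 * y ^ 2 + 58) / 15 := by rw [ht]; ring
  have hE : curveE.Equation t (2 * y * t) := by
    simp only [WeierstrassCurve.Affine.equation_iff, curveE]
    rw [show x ^ 4 = (x ^ 2) ^ 2 by ring, hx] at h
    linear_combination (-15 / 64 * t) * h
  have hsq : ∀ {q : ℚ}, ¬ IsSquare q → x ^ 2 ≠ q := fun hq he => hq ⟨x, by rw [← he, sq]⟩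
  rw [equation_curveE_iff] at hE
  simp only [Set.mem_insert_iff, Set.mem_singleton_iff, Prod.mk.injEq] at hE
  have hy1 : ∀ {s : ℚ}, 2 * y * t = s → t ≠ 0 → y = s / (2 * t) := fun hs ht0 => by
    rw [← hs]; field_simp
  rcases hE with ⟨h1, h2⟩ | ⟨h1, h2⟩ | ⟨h1, h2⟩ | ⟨h1, h2⟩ | ⟨h1, h2⟩ | ⟨h1, h2⟩ | ⟨h1, h2⟩
  · rw [show x ^ 4 = (x ^ 2) ^ 2 by ring, hx, h1] at h
    exact absurd h (by ring_nf; norm_num)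
  all_goals
    have hy := hy1 h2 (by rw [h1]; norm_num)
    rw [h1] at hy hx
    rw [hy] at hx
    norm_num at hx hy
  · exact absurd hx (hsq (by norm_num))
  · exact absurd hx (hsq (by norm_num))
  · exact ⟨sq_eq_sq_iff_eq_or_eq_neg.1 (by rw [hx]; norm_num), hy⟩
  · exact absurd hx (hsq (by norm_num))
  · exact absurd hx (hsq (by norm_num))
  · exact absurd hx (hsq (by norm_num))

theorem eq_of_ciani_affine_equation_zmod : ∀ x y : ZMod 17,
    15 * x ^ 4 + 112 * y ^ 4 + 112 + 288 * y ^ 2 - 88 * x ^ 2 - 88 * x ^ 2 * y ^ 2 = 0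
      → (x = 2 ∨ x = -2) ∧ y = 0 := by
  decide

end Quartic

end

theorem mainTheorem1 :
    -- `C` is smooth, and its rational points
    PlaneCurve.IsSmooth ciani ∧
    PlaneCurve.points ciani =
      {Projectivization.mk ℚ ![2, 1, 0] (by simp), Projectivization.mk ℚ ![-2, 1, 0] (by simp),
        Projectivization.mk ℚ ![2, 0, 1] (by simp), Projectivization.mk ℚ ![-2, 0, 1] (by simp)} ∧
    (PlaneCurve.points ciani).ncard = 4 ∧
    -- the elliptic curve `E` has rank `0` and exactly eight rational points
    curveE.IsElliptic ∧
    Module.rank ℤ curveE.Point = 0 ∧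
    (∀ x y : ℚ, curveE.Equation x y ↔
      (x, y) ∈ ({(0, 0), (-3 / 4, -3 / 2), (-3 / 4, 3 / 2), (1 / 4, 0), (5 / 4, -5 / 2),
        (5 / 4, 5 / 2), (-15 / 4, 0)} : Set (ℚ × ℚ))) ∧
    Nat.card curveE.Point = 8 ∧
    -- `E₁`, `E₂`, `E₃` are isomorphic to `E` by the given transformations
    PlaneCurve.IsBirationalVia quarticE1 curveE
      (MvPolynomial.C (28 / 15) * MvPolynomial.X 0 ^ 2 * MvPolynomial.X 1
        + MvPolynomial.C (58 / 15) * MvPolynomial.X 1 ^ 3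
        - MvPolynomial.X 1 ^ 2 * MvPolynomial.X 2)
      (MvPolynomial.C (56 / 15) * MvPolynomial.X 0 ^ 3
        + MvPolynomial.C (116 / 15) * MvPolynomial.X 0 * MvPolynomial.X 1 ^ 2
        - 2 * MvPolynomial.X 0 * MvPolynomial.X 1 * MvPolynomial.X 2)
      (MvPolynomial.C (-8 / 15) * MvPolynomial.X 1 ^ 3) ∧
    PlaneCurve.IsBirationalVia quarticE2 curveE
      (MvPolynomial.C (28 / 15) * MvPolynomial.X 1 ^ 2 * MvPolynomial.X 2
        + MvPolynomial.C (58 / 15) * MvPolynomial.X 2 ^ 3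
        - MvPolynomial.X 2 ^ 2 * MvPolynomial.X 0)
      (MvPolynomial.C (56 / 15) * MvPolynomial.X 1 ^ 3
        + MvPolynomial.C (116 / 15) * MvPolynomial.X 1 * MvPolynomial.X 2 ^ 2
        - 2 * MvPolynomial.X 0 * MvPolynomial.X 1 * MvPolynomial.X 2)
      (MvPolynomial.C (-8 / 15) * MvPolynomial.X 2 ^ 3) ∧
    PlaneCurve.IsBirationalVia quarticE3 curveE
      (MvPolynomial.C (28 / 15) * MvPolynomial.X 2 ^ 2 * MvPolynomial.X 0
        + MvPolynomial.C (58 / 15) * MvPolynomial.X 0 ^ 3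
        - MvPolynomial.X 0 ^ 2 * MvPolynomial.X 1)
      (MvPolynomial.C (56 / 15) * MvPolynomial.X 2 ^ 3
        + MvPolynomial.C (116 / 15) * MvPolynomial.X 2 * MvPolynomial.X 0 ^ 2
        - 2 * MvPolynomial.X 0 * MvPolynomial.X 1 * MvPolynomial.X 2)
      (MvPolynomial.C (-8 / 15) * MvPolynomial.X 0 ^ 3) ∧
    -- the quotients of `C` by its three involutions
    PlaneCurve.IsQuotientFunctionField ciani ![-1, 1, 1] (PlaneCurve.FunctionField quarticE1) ∧
    PlaneCurve.IsQuotientFunctionField ciani ![1, -1, 1] curveE'.FunctionField ∧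
    PlaneCurve.IsQuotientFunctionField ciani ![1, 1, -1] curveE'.FunctionField ∧
    curveE'.IsElliptic ∧
    Module.rank ℤ curveE'.Point = 0 ∧
    -- the Jacobian of `C` has rank `0`, and Stoll's bound is attained at `17`
    PlaneCurve.HasMordellWeilRank ciani 0 ∧
    PlaneCurve.IsSmooth cianiMod17 ∧
    PlaneCurve.points cianiMod17 =
      {Projectivization.mk (ZMod 17) ![2, 1, 0] (by simp),
        Projectivization.mk (ZMod 17) ![15, 1, 0] (by simp),
        Projectivization.mk (ZMod 17) ![2, 0, 1] (by simp),
        Projectivization.mk (ZMod 17) ![15, 0, 1] (by simp)} ∧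
    PlaneCurve.StollBoundAttained cianiInt 17 := by
  have hpt : PlaneCurve.points ciani =
      {Projectivization.mk ℚ ![2, 1, 0] (by simp), Projectivization.mk ℚ ![-2, 1, 0] (by simp),
        Projectivization.mk ℚ ![2, 0, 1] (by simp), Projectivization.mk ℚ ![-2, 0, 1] (by simp)} :=
    points_map_cianiInt rfl (by norm_num) fun _ _ => eq_of_ciani_affine_equation_rat
  have hcard : (PlaneCurve.points ciani).ncard = 4 := by
    rw [hpt]
    exact ncard_points_map_cianiInt rfl two_ne_zero
  have hsmooth : PlaneCurve.IsSmooth ciani :=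
    isSmooth_map_cianiInt two_ne_zero (by norm_num) (by norm_num)
  have hrank : PlaneCurve.HasMordellWeilRank ciani 0 := ⟨inferInstance, by
    rw [rank_picZero_ciani isOfFinAddOrder_curveE isOfFinAddOrder_curveE', Nat.cast_zero]⟩
  have hsmooth17 : PlaneCurve.IsSmooth cianiMod17 :=
    isSmooth_map_cianiInt (by decide) (by decide) (by decide)
  have hpt17 : PlaneCurve.points cianiMod17 =
      {Projectivization.mk (ZMod 17) ![2, 1, 0] (by simp),
        Projectivization.mk (ZMod 17) ![15, 1, 0] (by simp),
        Projectivization.mk (ZMod 17) ![2, 0, 1] (by simp),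
        Projectivization.mk (ZMod 17) ![15, 0, 1] (by simp)} :=
    points_map_cianiInt rfl (by decide) eq_of_ciani_affine_equation_zmod
  have hcard17 : (PlaneCurve.points cianiMod17).ncard = 4 := by
    rw [hpt17]
    exact ncard_points_map_cianiInt rfl (by decide)
  exact ⟨hsmooth, hpt, hcard, isElliptic_curveE,
    WeierstrassCurve.Affine.Point.rank_eq_zero isOfFinAddOrder_curveE, equation_curveE_iff,
    card_point_curveE, isBirationalVia_quarticE1, isBirationalVia_quarticE2,
    isBirationalVia_quarticE3, isQuotientFunctionField_quarticE1, isQuotientFunctionField_two,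
    isQuotientFunctionField_three, isElliptic_curveE',
    WeierstrassCurve.Affine.Point.rank_eq_zero isOfFinAddOrder_curveE', hrank, hsmooth17, hpt17,
    4, 0, isHomogeneous_cianiInt, hsmooth, by decide, hrank, by decide, hsmooth17, by norm_num,
    hcard.trans hcard17.symm⟩
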